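/- **Setting.** A polygonal curve $P$ in $\mathbb{R}^d$ with vertices $p_1,\dots,p_n$ ($n\ge 1$) is the piecewise linear map $P:[1,n]\to\mathbb{R}^d$ with $P(t)=p_i+(t-i)(p_{i+1}-p_i)$ for $t\in[i,i+1]$. It is *$c$-packed* if for every $r>0$ the total length of $P$ inside any ball of radius $r$ is at most $cr$. The Fréchet distance of $P$ and $Q$ (with $n$ and $m$ vertices) is $d_F(P,Q)=\min_{(f,g)}\max_{t\in[0,1]}\|P(f(t))-Q(g(t))\|$, where $f:[0,1]\to[1,n]$ and $g:[0,1]\to[1,m]$ range over the non-decreasing surjections. The $\delta$-free space of $P,Q$ is the set of $(x,y)\in[1,n]\times[1,m]$ with $\|P(x)-Q(y)\|\le\delta$; a point of it is reachable if a path that is monotone in both coordinates leads to it from $(1,1)$ inside the free space; a cell $[i,i+1]\times[j,j+1]$ is reachable if it contains a reachable point (a curve with one vertex counts as having one edge of length $0$). The greedy $\mu$-simplification of $P$ is the subsequence of its vertices that starts with $p_1$ and always continues with the first later vertex at distance at least $\mu$ from the last one taken. **FallibleDecider**$(P,Q,\Delta,\varepsilon,c')$. Let $S_P,S_Q$ be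 the greedy $\frac{\varepsilon}{4}\Delta$-simplifications of $P$ and $Q$, and $K=(1+\varepsilon)^2\,(27c'+96c'/\varepsilon)\,(n+m)$. Explore the reachable cells of the $(1+\frac{\varepsilon}{2})\Delta$-free space of $S_P,S_Q$, in the order of the antidiagonals, up to $\lfloor K\rfloor+1$ cells. Report "Yes" if the final corner $(|S_P|,|S_Q|)$ is found to be reachable; otherwise "Timeout" if more than $K$ cells were explored; otherwise "No". **RefineUpperBound**$(P,Q,\Delta^+,\varepsilon)$. Let $\Delta_i=\Delta^+/(1+\varepsilon)^i$ and start with $c'=1$. Repeat: if FallibleDecider$(P,Q,\Delta^+,\varepsilon,c')$ is "Yes", scan $b=0,1,2,\dots$ for the smallest $b$ such that FallibleDecider$(P,Q,\Delta_{2^b},\varepsilon,c')$ is not "Yes"; find by binary search an $i\in\{1,\dots,2^b\}$ such that FallibleDecider is "Yes" for $\Delta_{i-1}$ and not "Yes" for $\Delta_i$; if it is "No" for $\Delta_i$, return $(1+\varepsilon)\Delta_{i-1}$. If nothing was returned, replace $c'$ by $2c'$. Time is the number of steps on a real RAM, where an arithmetic operation, square root or comparison of numbers, a distance, difference or inner product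 of two points of $\mathbb{R}^d$, and an elementary operation on a sequence each count as one step. **Lemma (RefineUpperBound).** There is an absolute constant $C>0$ such that the following holds. Let $P$ and $Q$ be polygonal curves in $\mathbb{R}^d$ with $n$ and $m$ vertices, such that $d_F(P,Q)>0$ and at least one of $P$ and $Q$ is $c$-packed, where $c\ge 1$ is not known to the procedure. Let $\varepsilon\in(0,1]$ and $\Delta^+\ge d_F(P,Q)$. Then RefineUpperBound$(P,Q,\Delta^+,\varepsilon)$ terminates and returns a value $\Delta$ with $$d_F(P,Q)\le\Delta<(1+\varepsilon)^2\,d_F(P,Q),$$ after at most $$C\cdot c\,\frac{n+m}{\varepsilon}\left(1+\log\left(1+\frac1\varepsilon\log\frac{\Delta^+}{d_F(P,Q)}\right)\right)$$ steps. -/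

import Mathlib

namespace Frechet

noncomputable section

/-! ### Polygonal curves, packedness, Fréchet distance -/

/-- Points of `ℝ^d`, with the Euclidean norm. -/
abbrev Pt (d : ℕ) : Type := EuclideanSpace ℝ (Fin d)

/-- A polygonal curve in `ℝ^d`, given by its nonempty sequence of vertices. -/
structure Curve (d : ℕ) where
  verts : List (Pt d)
  ne_nil : verts ≠ []

namespace Curve

variable {d : ℕ}

/-- The number of vertices. -/
def size (P : Curve d) : ℕ := P.verts.length

/-- The vertex with index `i` (indices start at `0`); past the end it is the last vertex. -/
def vertex (P : Curve d) (i : ℕ) : Pt d := P.verts.getD i (P.verts.getLast P.ne_nil)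

/-- The curve as a piecewise linear function on `[0, n - 1]`, where `n` is the number of vertices:
on `[i, i + 1]` it runs linearly from vertex `i` to vertex `i + 1`. -/
def eval (P : Curve d) (t : ℝ) : Pt d :=
  AffineMap.lineMap (P.vertex ⌊t⌋₊) (P.vertex (⌊t⌋₊ + 1)) (t - ⌊t⌋₊)

/-- The total length of the curve inside the closed ball `B(x, r)`: the sum over the edges of the
length of the part of the edge that lies in the ball. -/
def lengthInBall (P : Curve d) (x : Pt d) (r : ℝ) : ℝ :=
  ∑ i ∈ Finset.range (P.size - 1),
    dist (P.vertex i) (P.vertex (i + 1)) *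
      MeasureTheory.volume.real
        {t : ℝ | t ∈ Set.Icc (0 : ℝ) 1 ∧
          AffineMap.lineMap (P.vertex i) (P.vertex (i + 1)) t ∈ Metric.closedBall x r}

/-- `P` is `c`-packed. -/
def IsPacked (P : Curve d) (c : ℝ) : Prop :=
  ∀ (x : Pt d) (r : ℝ), 0 < r → P.lengthInBall x r ≤ c * r

/-- `f` restricts to a non-decreasing surjection from `[0, 1]` onto the domain of `P`. -/
def IsReparam (P : Curve d) (f : ℝ → ℝ) : Prop :=
  MonotoneOn f (Set.Icc 0 1) ∧ f '' Set.Icc 0 1 = Set.Icc 0 ((P.size : ℝ) - 1)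

end Curve

/-- The continuous Fréchet distance: the infimum over all matchings `(f, g)` of the largest
distance between matched points. -/
def frechetDist {d : ℕ} (P Q : Curve d) : ℝ :=
  sInf {δ : ℝ | ∃ f g : ℝ → ℝ, P.IsReparam f ∧ Q.IsReparam g ∧
    δ = sSup ((fun t => dist (P.eval (f t)) (Q.eval (g t))) '' Set.Icc 0 1)}

/-! ### Step counting

Time is counted on a real RAM. A program is a value together with the number of elementary steps
spent on it. One step is charged, through `op`, for each elementary operation: an arithmetic
operation, a square root or a comparison of numbers; a distance, a difference or an inner product
of points of `ℝ^d`; reading an entry of a sequence by its index, appending an entry to a sequence,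
taking the next entry of a sequence; forming or inspecting a record of bounded size. Adding `1` or
`2` to an index is part of the operation that uses the index. Branching on a computed Boolean and
passing on a computed value are free. -/

/-- A value together with the number of steps spent on computing it. -/
structure Timed (α : Type) where
  val : α
  steps : ℕ

instance : Monad Timed where
  pure a := ⟨a, 0⟩
  bind x f := ⟨(f x.val).val, x.steps + (f x.val).steps⟩

/-- One elementary operation with result `a`. -/
def op {α : Type} (a : α) : Timed α := ⟨a, 1⟩

/-! ### Greedy simplification -/

/-- The vertices that the greedy `μ`-simplification takes from the remaining vertices, if the last
vertex that it has taken is `s`: always the first one at distance at least `μ` from the last one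
taken. -/
def simplifyFrom {d : ℕ} (μ : ℝ) : Pt d → List (Pt d) → Timed (List (Pt d))
  | _, [] => op []
  | s, q :: qs => do
    let q ← op q
    let r ← op (dist s q)
    let far ← op (decide (μ ≤ r))
    if far then do
      let rest ← simplifyFrom μ q qs
      op (q :: rest)
    else
      simplifyFrom μ s qs

/-- The greedy `μ`-simplification of `P`; it starts with the first vertex of `P`. -/
def simplify {d : ℕ} (μ : ℝ) (P : Curve d) : Timed (Curve d) := do
  let s ← op (P.verts.head P.ne_nil)
  let rest ← simplifyFrom μ s P.verts.tail
  op ⟨s :: rest, List.cons_ne_nil s rest⟩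

/-! ### Exploring the reachable cells of the free space -/

/-- The interval of all `t ∈ [0, 1]` for which the point `a + t (b - a)` has distance at most `δ`
from `s` (for `δ ≥ 0`), found by solving a quadratic equation; `none` if there is no such `t`. -/
def freeInterval {d : ℕ} (δ : ℝ) (s a b : Pt d) : Timed (Option (ℝ × ℝ)) := do
  let u ← op (b - a)
  let w ← op (a - s)
  let A ← op (inner ℝ u u)
  let B ← op (inner ℝ u w)
  let W ← op (inner ℝ w w)
  let δ2 ← op (δ * δ)
  let C ← op (W - δ2)
  let degenerate ← op (decide (A = 0))
  if degenerate then do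
    let free ← op (decide (C ≤ 0))
    if free then op (some (0, 1)) else op none
  else do
    let B2 ← op (B * B)
    let AC ← op (A * C)
    let D ← op (B2 - AC)
    let noRoot ← op (decide (D < 0))
    if noRoot then op none
    else do
      let r ← op (Real.sqrt D)
      let B' ← op (-B)
      let x ← op (B' - r)
      let y ← op (B' + r)
      let x ← op (x / A)
      let y ← op (y / A)
      let lo ← op (max 0 x)
      let hi ← op (min 1 y)
      let nonempty ← op (decide (lo ≤ hi))
      if nonempty then op (some (lo, hi)) else op none

/-- The lowest point of the reachable part of a side of a cell whose free interval is `I`.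
`opposite` and `adjacent` are the lowest reachable points of the parallel and of the other entry
side of the cell, if there are any. From a reachable point of the other entry side all of `I` can
be reached; otherwise, from the lowest reachable point `l` of the parallel side, the part of `I`
above `l`. -/
def exitSide (I : Option (ℝ × ℝ)) (opposite adjacent : Option ℝ) : Timed (Option ℝ) := do
  let I ← op I
  match I with
  | none => op none
  | some (lo, hi) => do
    let adjacent ← op adjacent
    match adjacent with
    | some _ => op (some lo)
    | none => do
      let opposite ← op opposite
      match opposite with
      | none => op none
      | some l => do
        let x ← op (max lo l)
        let nonempty ← op (decide (x ≤ hi))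
        if nonempty then op (some x) else op none

/-- A record for the cell `[i, i + 1] × [j, j + 1]`: the lowest reachable points, in coordinates
relative to the cell, that are known on its left and on its bottom side, if there are any. -/
structure Entry where
  i : ℕ
  j : ℕ
  left : Option ℝ
  bottom : Option ℝ

/-- Takes the cell of the first record `e` of the queue `e :: q`, joining `e` with the record that
follows it if that one belongs to the same cell. -/
def popCell (e : Entry) : List Entry → Timed (Entry × List Entry)
  | [] => op (e, [])
  | e' :: q => do
    let same ← op (decide (e.i = e'.i))
    let same' ← op (decide (e.j = e'.j))
    if same && same' then
      op (⟨e.i, e.j, e.left.or e'.left, e.bottom.or e'.bottom⟩, q)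
    else
      op (e, e' :: q)

/-- Appends the record `f x` at the end of the queue, if `lo` is `some x`. -/
def enqueue (q : List Entry) (lo : Option ℝ) (f : ℝ → Entry) : Timed (List Entry) :=
  match lo with
  | none => op q
  | some x => op (q ++ [f x])

/-- The possible reports of the fallible decider. -/
inductive Answer
  | yes
  | no
  | timeout

/-- Explores the reachable cells of the `δ`-free space of `S` and `T`, in the order of the queue,
which goes through the antidiagonals `i + j = 0, 1, 2, …` one after the other, each by increasing
`i`. At most as many cells are explored as the first number says: the report is "yes" as soon as
the final corner of the parameter space is found to be reachable, "timeout" if that many cells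
have been explored before this, and "no" if the reachable cells are exhausted earlier.
A curve with one vertex counts as having one edge, of length `0`, so that the parameter space
always has a cell. -/
def explore {d : ℕ} (S T : Curve d) (δ : ℝ) : ℕ → List Entry → Timed Answer
  | 0, _ => op Answer.timeout
  | _ + 1, [] => op Answer.no
  | k + 1, e :: q => do
    let (e, q) ← popCell e q
    let p₀ ← op (S.vertex e.i)
    let p₁ ← op (S.vertex (e.i + 1))
    let q₀ ← op (T.vertex e.j)
    let q₁ ← op (T.vertex (e.j + 1))
    let hasRight ← op (decide (e.i + 2 < S.size))
    let hasTop ← op (decide (e.j + 2 < T.size))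
    if !hasRight && !hasTop then do
      let r ← op (dist p₁ q₁)
      let free ← op (decide (r ≤ δ))
      if free then op Answer.yes else explore S T δ k q
    else do
      let top ← if hasTop then do
          let I ← freeInterval δ q₁ p₀ p₁
          exitSide I e.bottom e.left
        else op none
      let right ← if hasRight then do
          let I ← freeInterval δ p₁ q₀ q₁
          exitSide I e.left e.bottom
        else op none
      let q ← enqueue q top (fun x => ⟨e.i, e.j + 1, none, some x⟩)
      let q ← enqueue q right (fun y => ⟨e.i + 1, e.j, some y, none⟩)
      explore S T δ k q

/-- The queue that the exploration starts with: the cell at the corner `(0, 0)`, if this corner is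
free. -/
def startQueue {d : ℕ} (S T : Curve d) (δ : ℝ) : Timed (List Entry) := do
  let p ← op (S.vertex 0)
  let q ← op (T.vertex 0)
  let r ← op (dist p q)
  let free ← op (decide (r ≤ δ))
  if free then op [⟨0, 0, some 0, some 0⟩] else op []

/-- The least positive integer that exceeds `K` (for `K ≥ 0`), found by counting `1, 2, 3, …` with
one increment and one comparison each, since rounding is not an elementary operation. -/
def countBeyond (K : ℝ) : Timed ℕ := ⟨⌊K⌋₊ + 1, 2 * (⌊K⌋₊ + 1)⟩

/-- `FallibleDecider(P, Q, Δ, ε, c)`: explores at most `⌊K⌋ + 1` reachable cells of the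
`(1 + ε/2)Δ`-free space of the greedy `(ε/4)Δ`-simplifications, where
`K = (1 + ε)² (27 c + 96 c / ε) (n + m)`. -/
def fallibleDecider {d : ℕ} (P Q : Curve d) (Δ ε c : ℝ) : Timed Answer := do
  let ε4 ← op (ε / 4)
  let μ ← op (ε4 * Δ)
  let S ← simplify μ P
  let T ← simplify μ Q
  let ε1 ← op (1 + ε)
  let ε1sq ← op (ε1 * ε1)
  let a ← op (27 * c)
  let b ← op (96 * c)
  let b ← op (b / ε)
  let ab ← op (a + b)
  let N ← op ((P.size + Q.size : ℕ) : ℝ)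
  let K ← op (ε1sq * ab)
  let K ← op (K * N)
  let ε2 ← op (ε / 2)
  let ε2 ← op (1 + ε2)
  let δ ← op (ε2 * Δ)
  let q ← startQueue S T δ
  let budget ← countBeyond K
  explore S T δ budget q

/-! ### The search procedure

Write `Δ_i = Δ⁺ / (1 + ε)^i`. -/

/-- The linear scan for the smallest `b` such that the fallible decider does not report "yes" for
`Δ_(2^b)`. In the round for `b` the number `r` is `(1 + ε)^(2^b)`, and `pows` lists
`(1 + ε)^(2^k)` for `k = b - 1, …, 0`; the scan returns the list `pows` for the `b` it finds. The
first argument bounds the number of rounds; if it is used up, the result is `none`. -/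
def scan {d : ℕ} (P Q : Curve d) (Δup ε c : ℝ) :
    ℕ → (r : ℝ) → (pows : List ℝ) → Timed (Option (List ℝ))
  | 0, _, _ => pure none
  | k + 1, r, pows => do
    let Δ ← op (Δup / r)
    let a ← fallibleDecider P Q Δ ε c
    let a ← op a
    match a with
    | Answer.yes => do
      let r2 ← op (r * r)
      let pows ← op (r :: pows)
      scan P Q Δup ε c k r2 pows
    | _ => op (some pows)

/-- The binary search for an `i` such that the decider reports "yes" for `Δ_(i-1)` but not for
`Δ_i`; it returns `Δ_(i-1)`. The search interval is `(l, l + 2^k]`, `k` being the length of the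
list, which holds `(1 + ε)^(2^(k-1)), …, (1 + ε)^(2^0)`, and `Δlo` is `Δ_l`; the value that is
probed is the one at the middle of the interval. -/
def binarySearch {d : ℕ} (P Q : Curve d) (ε c : ℝ) : (Δlo : ℝ) → List ℝ → Timed ℝ
  | Δlo, [] => op Δlo
  | Δlo, r :: rs => do
    let Δmid ← op (Δlo / r)
    let a ← fallibleDecider P Q Δmid ε c
    let a ← op a
    match a with
    | Answer.yes => binarySearch P Q ε c Δmid rs
    | _ => binarySearch P Q ε c Δlo rs

/-- One round of `RefineUpperBound`, for one estimate `c` of the packedness. The result is `none`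
if the bound `fuel` on the rounds of the scan is used up, `some none` if the round ends without an
answer, so that the estimate `c` has to be doubled, and `some (some Δ)` if `Δ` is returned. -/
def refineRound {d : ℕ} (fuel : ℕ) (P Q : Curve d) (Δup ε c : ℝ) :
    Timed (Option (Option ℝ)) := do
  let a ← fallibleDecider P Q Δup ε c
  let a ← op a
  match a with
  | Answer.yes => do
    let ε1 ← op (1 + ε)
    let pows ← scan P Q Δup ε c fuel ε1 []
    match pows with
    | none => pure none
    | some pows => do
      let Δlo ← binarySearch P Q ε c Δup pows
      let Δhi ← op (Δlo / ε1)
      let a ← fallibleDecider P Q Δhi ε c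
      let a ← op a
      match a with
      | Answer.no => do
        let Δ ← op (ε1 * Δlo)
        op (some (some Δ))
      | _ => op (some none)
  | _ => op (some none)

/-- The main loop of `RefineUpperBound`, from the estimate `c` on. -/
def refineLoop {d : ℕ} (fuel : ℕ) (P Q : Curve d) (Δup ε : ℝ) : ℕ → ℝ → Timed (Option ℝ)
  | 0, _ => pure none
  | k + 1, c => do
    let res ← refineRound fuel P Q Δup ε c
    match res with
    | none => pure none
    | some (some Δ) => op (some Δ)
    | some none => do
      let c2 ← op (2 * c)
      refineLoop fuel P Q Δup ε k c2

/-- `RefineUpperBound(P, Q, Δ⁺, ε)`, where each of the two loops without an a priori bound (the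
doubling of the estimate of the packedness, which starts at `1`, and the linear scan) is cut off
after `fuel` rounds, with the result `none`. -/
def refineUpperBound {d : ℕ} (fuel : ℕ) (P Q : Curve d) (Δup ε : ℝ) : Timed (Option ℝ) :=
  refineLoop fuel P Q Δup ε fuel 1

/-- The procedure `RefineUpperBound`, run on `(P, Q, Δ⁺, ε)` without any cut-off, terminates after
`time` steps and returns `Δ`. -/
def RefineUpperBoundReturns {d : ℕ} (P Q : Curve d) (Δup ε Δ : ℝ) (time : ℕ) : Prop :=
  ∃ N : ℕ, ∀ fuel : ℕ, N ≤ fuel → refineUpperBound fuel P Q Δup ε = ⟨some Δ, time⟩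

end

end Frechet

namespace Frechet

noncomputable section

open Set

/-! ### Evaluation of polygonal curves -/

namespace Curve

variable {d : ℕ}

/-! Both definite answers of the fallible decider can be trusted, whatever the estimate `c'` is: the
greedy simplification with `μ = εΔ/4` moves a curve by less than `μ`, so "yes" implies `d_F ≤ (1 +
ε)Δ` and "no" implies `d_F > Δ`. If the answers at `Δ_{i-1}` and `Δ_i` are "yes" and "no", then `(1
+ ε)Δ_{i-1} = (1 + ε)²Δ_i` lies in the required range. The only obstacle is a timeout, and
packedness excludes it once `c' ≥ 2c` (`fallibleDecider_ne_timeout`).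

This rests on a count of reachable cells (`IsSimplification.card_reachableCells_le`) that needs only
one packed curve, say `P` with simplification `S`. An edge of `S` that meets a ball of radius `r`
accounts for length at least `μ` of `P` in the concentric ball of radius `r + 4μ`, and different
edges use different parts of `P`; hence few edges of `S` come near a given vertex of `T`. This
bounds the cells entered from below, and those entered from the left along a short edge of `T`. Long
edges of `T` are charged to a vertex of `S` instead: a monotone path that passes several of them,
each time near that vertex, forces `P` to use up length in a ball around it each time
(`IsSimplification.card_long_le`).

The free space is convex inside a cell, so the exploration needs only the lowest reachable point on
each side. Chains from the start (`Reach`) serve for soundness, chains to the end (`ReachesEnd`) for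
completeness, and a timeout exhibits as many distinct reachable cells as the budget allows.

For the time, a "yes" at `Δ_(2^b)` bounds `(1 + ε)^(2^b)` in terms of `Δ⁺ / d_F`, so a round makes
logarithmically many probes (`rounds_le_of_yes`), each of cost `O(c'(n + m)/ε)`. The costs of the
rounds are dominated by a geometric series whose largest estimate is `O(c)`
(`exists_refineLoop_eq`). -/

theorem size_pos (P : Curve d) : 0 < P.size :=
  List.length_pos_iff.mpr P.ne_nil

theorem vertex_of_lt (P : Curve d) {i : ℕ} (h : i < P.size) : P.vertex i = P.verts[i]'h := by
  have h' : i < P.verts.length := h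
  rw [vertex, List.getD_eq_getElem?_getD, List.getElem?_eq_getElem h']
  rfl

theorem vertex_of_le (P : Curve d) {i : ℕ} (h : P.size ≤ i + 1) :
    P.vertex i = P.verts.getLast P.ne_nil := by
  rcases Nat.lt_or_ge i P.size with h' | h'
  · rw [vertex_of_lt P h', List.getLast_eq_getElem]
    congr 1
    simp only [size] at *
    omega
  · simp [vertex, List.getD_eq_getElem?_getD, List.getElem?_eq_none (show P.verts.length ≤ i from h')]

theorem eval_eq_lineMap (P : Curve d) (i : ℕ) {x : ℝ} (h₀ : (i : ℝ) ≤ x) (h₁ : x ≤ i + 1) :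
    P.eval x = AffineMap.lineMap (P.vertex i) (P.vertex (i + 1)) (x - i) := by
  rcases h₁.lt_or_eq with h | h
  · have : ⌊x⌋₊ = i := by
      rw [Nat.floor_eq_iff (le_trans (Nat.cast_nonneg i) h₀)]
      exact ⟨h₀, h⟩
    simp [eval, this]
  · have : ⌊x⌋₊ = i + 1 := by
      rw [h]; exact_mod_cast Nat.floor_natCast (R := ℝ) (i + 1)
    rw [eval, this, h]; simp

theorem eval_natCast (P : Curve d) (i : ℕ) : P.eval i = P.vertex i := by
  rw [P.eval_eq_lineMap i le_rfl (by linarith)]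
  simp

theorem eval_of_le (P : Curve d) {x : ℝ} (h : (P.size : ℝ) - 1 ≤ x) :
    P.eval x = P.verts.getLast P.ne_nil := by
  have hs : P.size ≤ ⌊x⌋₊ + 1 := by
    have h1 : (P.size : ℝ) < (⌊x⌋₊ + 1 : ℕ) + 1 := by
      have := Nat.lt_floor_add_one x
      push_cast; linarith
    have h2 : P.size < ⌊x⌋₊ + 1 + 1 := by exact_mod_cast h1
    omega
  rw [eval, P.vertex_of_le hs, P.vertex_of_le (by omega), AffineMap.lineMap_same]
  rfl

/-- Past the last vertex a curve stands still. This lets a one-vertex curve be treated as having an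
edge of length zero. -/
theorem eval_min (P : Curve d) (x : ℝ) : P.eval (min x ((P.size : ℝ) - 1)) = P.eval x := by
  rcases le_total x ((P.size : ℝ) - 1) with h | h
  · rw [min_eq_left h]
  · rw [min_eq_right h, P.eval_of_le le_rfl, P.eval_of_le h]

/-- Boundedness makes the `sSup` in `frechetDist` a true supremum and not the default value of an
unbounded set. -/
theorem norm_eval_le (P : Curve d) : ∃ M : ℝ, ∀ x, 0 ≤ x → ‖P.eval x‖ ≤ M := by
  obtain ⟨M, hM⟩ : ∃ M : ℝ, ∀ i, ‖P.vertex i‖ ≤ M := by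
    refine ⟨∑ i ∈ Finset.range P.size, ‖P.vertex i‖, fun i => ?_⟩
    have key : ∀ j < P.size, ‖P.vertex j‖ ≤ ∑ i ∈ Finset.range P.size, ‖P.vertex i‖ := fun j hj =>
      Finset.single_le_sum (f := fun i => ‖P.vertex i‖) (fun _ _ => norm_nonneg _)
        (Finset.mem_range.mpr hj)
    rcases Nat.lt_or_ge i P.size with h | h
    · exact key i h
    · have hp := P.size_pos
      rw [P.vertex_of_le (by omega : P.size ≤ i + 1),
        ← P.vertex_of_le (by omega : P.size ≤ (P.size - 1) + 1)]
      exact key _ (by omega)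
  refine ⟨M, fun x hx => ?_⟩
  have hc := convex_closedBall (0 : Pt d) M
  have := hc.lineMap_mem (x := P.vertex ⌊x⌋₊) (y := P.vertex (⌊x⌋₊ + 1))
    (by simpa using hM _) (by simpa using hM _) (t := x - ⌊x⌋₊)
    ⟨by linarith [Nat.floor_le hx], by linarith [Nat.lt_floor_add_one x]⟩
  simpa [eval] using this

/-- The difference of two linear motions is a linear motion, and balls around the origin are convex.
This is the source of the convexity of the free space in a cell. -/
theorem lineMap_dist_le {a b a' b' : Pt d} {D t : ℝ} (h₀ : dist a a' ≤ D) (h₁ : dist b b' ≤ D)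
    (ht : t ∈ Icc (0 : ℝ) 1) :
    dist (AffineMap.lineMap a b t) (AffineMap.lineMap a' b' t) ≤ D := by
  have hc := convex_closedBall (0 : Pt d) D
  have := hc.lineMap_mem (x := a - a') (y := b - b') (by simpa [dist_eq_norm] using h₀)
    (by simpa [dist_eq_norm] using h₁) ht
  rw [mem_closedBall_zero_iff] at this
  rw [dist_eq_norm]
  refine le_trans (le_of_eq ?_) this
  congr 1
  simp only [AffineMap.lineMap_apply_module]
  module

end Curve

/-! ### Monotone surjections between intervals -/

/-- `f` restricts to a non-decreasing surjection from `[0, a]` onto `[0, b]`. -/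
def MonoOnto (f : ℝ → ℝ) (a b : ℝ) : Prop :=
  MonotoneOn f (Icc 0 a) ∧ f '' Icc 0 a = Icc 0 b

namespace MonoOnto

variable {f g : ℝ → ℝ} {a b c : ℝ}

theorem mapsTo (h : MonoOnto f a b) {x : ℝ} (hx : x ∈ Icc 0 a) : f x ∈ Icc 0 b :=
  h.2 ▸ mem_image_of_mem f hx

theorem exists_eq (h : MonoOnto f a b) {y : ℝ} (hy : y ∈ Icc 0 b) : ∃ x ∈ Icc 0 a, f x = y := by
  rw [← h.2] at hy; exact hy

theorem comp (hg : MonoOnto g b c) (hf : MonoOnto f a b) : MonoOnto (fun x => g (f x)) a c := by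
  refine ⟨fun x hx y hy hxy => hg.1 (hf.mapsTo hx) (hf.mapsTo hy) (hf.1 hx hy hxy), ?_⟩
  have : (fun x => g (f x)) '' Icc 0 a = g '' (f '' Icc 0 a) := (image_image g f _).symm
  rw [this, hf.2, hg.2]

theorem continuousOn (h : MonoOnto f a b) : ContinuousOn f (Icc 0 a) := by
  let F : Icc 0 a → Icc 0 b := fun x => ⟨f x, h.mapsTo x.2⟩
  have hF : Monotone F := fun x y hxy => h.1 x.2 y.2 hxy
  have hs : Function.Surjective F := fun y => by
    obtain ⟨x, hx, hxy⟩ := h.exists_eq y.2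
    exact ⟨⟨x, hx⟩, Subtype.ext hxy⟩
  have : Continuous F := by
    rcases lt_or_ge b 0 with hb | hb
    · have : IsEmpty (Icc 0 b) := by simp [hb]
      have := Function.isEmpty F
      exact continuous_of_const fun x => isEmptyElim x
    · exact hF.continuous_of_surjective hs
  rw [continuousOn_iff_continuous_domRestrict]
  exact continuous_subtype_val.comp this

theorem map_zero (h : MonoOnto f a b) (hb : 0 ≤ b) : f 0 = 0 := by
  obtain ⟨x, hx, hx0⟩ := h.exists_eq (left_mem_Icc.mpr hb)
  have h0 : (0 : ℝ) ∈ Icc 0 a := ⟨le_rfl, hx.1.trans hx.2⟩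
  exact le_antisymm (hx0 ▸ h.1 h0 hx hx.1) (h.mapsTo h0).1

theorem map_right (h : MonoOnto f a b) (hb : 0 ≤ b) : f a = b := by
  obtain ⟨x, hx, hxb⟩ := h.exists_eq (right_mem_Icc.mpr hb)
  have h0 : a ∈ Icc 0 a := ⟨hx.1.trans hx.2, le_rfl⟩
  exact le_antisymm (h.mapsTo h0).2 (hxb ▸ h.1 hx h0 hx.2)

theorem of_continuousOn (hm : MonotoneOn f (Icc 0 a)) (hc : ContinuousOn f (Icc 0 a)) (ha : 0 ≤ a)
    (h0 : f 0 = 0) (h1 : f a = b) : MonoOnto f a b := by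
  refine ⟨hm, Subset.antisymm ?_ ?_⟩
  · rintro _ ⟨x, hx, rfl⟩
    exact ⟨h0 ▸ hm (left_mem_Icc.mpr ha) hx hx.1, h1 ▸ hm hx (right_mem_Icc.mpr ha) hx.2⟩
  · have := intermediate_value_Icc ha hc
    rwa [h0, h1] at this

theorem mul_left (ha : 0 ≤ a) (hb : 0 < b) : MonoOnto (fun x => a * x) b (a * b) :=
  of_continuousOn (fun _ _ _ _ h => mul_le_mul_of_nonneg_left h ha) (by fun_prop) hb.le (by simp) rfl

theorem min_right (ha : 0 ≤ a) (hab : a ≤ b) : MonoOnto (fun x => min x a) b a :=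
  of_continuousOn (fun _ _ _ _ h => min_le_min_right a h) (by fun_prop) (ha.trans hab)
    (by simp [ha]) (by simp [hab])

/-- The fibre product of two monotone surjections onto the same interval is traversed by a monotone
pair. -/
theorem exists_fiber (hb : 0 ≤ b) (hf : MonoOnto f a b) (hg : MonoOnto g c b) :
    ∃ X Y : ℝ → ℝ, MonoOnto X (a + c) a ∧ MonoOnto Y (a + c) c ∧
      ∀ s ∈ Icc 0 (a + c), f (X s) = g (Y s) := by
  have ha : 0 ≤ a := by
    obtain ⟨x, hx, -⟩ := hf.exists_eq (left_mem_Icc.mpr hb)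
    exact hx.1.trans hx.2
  have hc : 0 ≤ c := by
    obtain ⟨x, hx, -⟩ := hg.exists_eq (left_mem_Icc.mpr hb)
    exact hx.1.trans hx.2
  have hf0 := hf.map_zero hb
  have hfa := hf.map_right hb
  have hg0 := hg.map_zero hb
  have hgc := hg.map_right hb
  -- The fibre product is parametrized by `s = x + y`. Among the solutions `x` of `f x = g (s - x)`
  -- the largest is chosen; this choice makes both coordinates monotone in `s`.
  have key : ∀ s ∈ Icc 0 (a + c), ∃ x, IsGreatest
      {x | x ∈ Icc (max 0 (s - c)) (min a s) ∧ f x - g (s - x) = 0} x := by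
    rintro s ⟨hs0, hs1⟩
    have hle : max 0 (s - c) ≤ min a s := by
      simp only [max_le_iff, le_min_iff]
      exact ⟨⟨ha, by linarith⟩, hs0, by linarith⟩
    have hcont : ContinuousOn (fun x => f x - g (s - x)) (Icc (max 0 (s - c)) (min a s)) := by
      refine (hf.continuousOn.mono fun x hx => ?_).sub
        (hg.continuousOn.comp (by fun_prop) fun x hx => ?_)
      · simp only [mem_Icc, max_le_iff, le_min_iff] at hx
        exact ⟨hx.1.1, hx.2.1⟩
      · simp only [mem_Icc, max_le_iff, le_min_iff] at hx
        exact ⟨by linarith, by linarith⟩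
    have hcl : IsCompact {x | x ∈ Icc (max 0 (s - c)) (min a s) ∧ f x - g (s - x) = 0} := by
      have := hcont.preimage_isClosed_of_isClosed isClosed_Icc (isClosed_singleton (x := (0 : ℝ)))
      exact isCompact_Icc.of_isClosed_subset this fun x hx => hx.1
    refine hcl.exists_isGreatest ?_
    have hmem : (0 : ℝ) ∈ Icc (f (max 0 (s - c)) - g (s - max 0 (s - c)))
        (f (min a s) - g (s - min a s)) := by
      constructor
      · rcases le_total 0 (s - c) with h | h
        · rw [max_eq_right h]
          have := (hf.mapsTo (x := s - c) ⟨h, by linarith⟩).2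
          simp only [sub_sub_cancel, hgc]; linarith
        · rw [max_eq_left h, hf0]
          have := (hg.mapsTo (x := s - 0) ⟨by linarith, by linarith⟩).1
          linarith
      · rcases le_total a s with h | h
        · rw [min_eq_left h, hfa]
          have := (hg.mapsTo (x := s - a) ⟨by linarith, by linarith⟩).2
          linarith
        · rw [min_eq_right h, sub_self, hg0]
          have := (hf.mapsTo (x := s) ⟨by linarith, by linarith⟩).1
          linarith
    obtain ⟨x, hx, hx0⟩ := intermediate_value_Icc hle hcont hmem
    exact ⟨x, hx, hx0⟩
  choose! X hX using key
  have hXa : ∀ s ∈ Icc 0 (a + c), X s ∈ Icc 0 a := fun s hs => by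
    have := (hX s hs).1.1
    simp only [mem_Icc, max_le_iff, le_min_iff] at this
    exact ⟨this.1.1, this.2.1⟩
  have hYc : ∀ s ∈ Icc 0 (a + c), s - X s ∈ Icc 0 c := fun s hs => by
    have := (hX s hs).1.1
    simp only [mem_Icc, max_le_iff, le_min_iff] at this
    exact ⟨by linarith, by linarith⟩
  have hXY : ∀ s ∈ Icc 0 (a + c), f (X s) = g (s - X s) := fun s hs => by
    linarith [(hX s hs).1.2]
  have hmax : ∀ s ∈ Icc 0 (a + c), ∀ x ∈ Icc 0 a, s - x ∈ Icc 0 c → f x = g (s - x) → x ≤ X s := by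
    intro s hs x hx hsx h
    refine (hX s hs).2 ⟨?_, by linarith⟩
    simp only [mem_Icc, max_le_iff, le_min_iff] at hx hsx ⊢
    exact ⟨⟨hx.1, by linarith⟩, hx.2, by linarith⟩
  have hXm : MonotoneOn X (Icc 0 (a + c)) := by
    intro s hs s' hs' hss
    by_contra! hlt
    have h1 := hf.1 (hXa s' hs') (hXa s hs) hlt.le
    have h2 := hg.1 (hYc s hs) (hYc s' hs') (by linarith)
    have e1 := hXY s hs
    have e2 := hXY s' hs'
    -- If `X` decreased, the inequalities for `f` and `g` would force equalities, so that `X s`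
    -- would be a larger solution for `s'` too.
    have hm : s' - X s ∈ Icc 0 c := ⟨by linarith [(hYc s hs).1], by linarith [(hYc s' hs').2]⟩
    have h3 := hg.1 (hYc s hs) hm (by linarith)
    have h4 := hg.1 hm (hYc s' hs') (by linarith)
    have := hmax s' hs' (X s) (hXa s hs) hm (by linarith)
    linarith
  have hYm : MonotoneOn (fun s => s - X s) (Icc 0 (a + c)) := by
    intro s hs s' hs' hss
    by_contra! hlt
    have h1 := hg.1 (hYc s' hs') (hYc s hs) hlt.le
    have h2 := hf.1 (hXa s hs) (hXa s' hs') (hXm hs hs' hss)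
    have e1 := hXY s hs
    have e2 := hXY s' hs'
    have hm : s - (s' - X s') ∈ Icc 0 a :=
      ⟨by linarith [(hXa s hs).1], by linarith [(hXa s' hs').2]⟩
    have h3 := hf.1 (hXa s hs) hm (by linarith)
    have h4 := hf.1 hm (hXa s' hs') (by linarith)
    have := hmax s hs (s - (s' - X s')) hm (by simpa using hYc s' hs')
      (by rw [sub_sub_cancel]; linarith)
    linarith
  have hXc : ContinuousOn X (Icc 0 (a + c)) := by
    have : LipschitzOnWith 1 X (Icc 0 (a + c)) := by
      refine LipschitzOnWith.of_dist_le_mul fun s hs s' hs' => ?_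
      rw [Real.dist_eq, Real.dist_eq, NNReal.coe_one, one_mul]
      rcases le_total s s' with h | h
      · have h1 := hXm hs hs' h
        have h2 := hYm hs hs' h
        simp only at h2
        rw [abs_of_nonpos (by linarith), abs_of_nonpos (by linarith)]
        linarith
      · have h1 := hXm hs' hs h
        have h2 := hYm hs' hs h
        simp only at h2
        rw [abs_of_nonneg (by linarith), abs_of_nonneg (by linarith)]
        linarith
    exact this.continuousOn
  have hac : 0 ≤ a + c := by linarith
  have l := left_mem_Icc.mpr hac
  have r := right_mem_Icc.mpr hac
  have hX0 : X 0 = 0 := le_antisymm (by linarith [(hYc 0 l).1]) (hXa 0 l).1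
  have hX1 : X (a + c) = a := le_antisymm (hXa _ r).2 (by linarith [(hYc _ r).2])
  refine ⟨X, fun s => s - X s, of_continuousOn hXm hXc hac hX0 hX1,
    of_continuousOn hYm (continuousOn_id.sub hXc) hac (by simp [hX0]) (by simp [hX1]), hXY⟩

end MonoOnto

/-! ### Matchings -/

variable {d : ℕ}

/-- The part of `P` up to `x` and the part of `Q` up to `y` can be traversed simultaneously with
distance at most `D`. -/
def Matched (P Q : Curve d) (x y D : ℝ) : Prop :=
  ∃ f g : ℝ → ℝ, MonoOnto f 1 x ∧ MonoOnto g 1 y ∧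
    ∀ t ∈ Icc (0 : ℝ) 1, dist (P.eval (f t)) (Q.eval (g t)) ≤ D

theorem Matched.symm {P Q : Curve d} {x y D : ℝ} (h : Matched P Q x y D) : Matched Q P y x D := by
  obtain ⟨f, g, hf, hg, h⟩ := h
  exact ⟨g, f, hg, hf, fun t ht => by rw [dist_comm]; exact h t ht⟩

theorem Curve.one_le_size (P : Curve d) : (0 : ℝ) ≤ (P.size : ℝ) - 1 := by
  have : (1 : ℝ) ≤ P.size := by exact_mod_cast P.size_pos
  linarith

theorem frechetDist_le_of_matched {P Q : Curve d} {D : ℝ}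
    (h : Matched P Q (P.size - 1) (Q.size - 1) D) : frechetDist P Q ≤ D := by
  obtain ⟨f, g, hf, hg, h⟩ := h
  have hsup : sSup ((fun t => dist (P.eval (f t)) (Q.eval (g t))) '' Set.Icc 0 1) ≤ D := by
    refine csSup_le ((nonempty_Icc.mpr zero_le_one).image _) ?_
    rintro _ ⟨t, ht, rfl⟩
    exact h t ht
  refine le_trans (csInf_le ?_ ?_) hsup
  · refine ⟨0, ?_⟩
    rintro _ ⟨f, g, -, -, rfl⟩
    refine Real.sSup_nonneg ?_
    rintro _ ⟨t, -, rfl⟩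
    exact dist_nonneg
  · exact ⟨f, g, hf, hg, rfl⟩

/-- The inequality is strict because the infimum is not shown to be attained. -/
theorem matched_of_frechetDist_lt {P Q : Curve d} {D : ℝ} (h : frechetDist P Q < D) :
    Matched P Q (P.size - 1) (Q.size - 1) D := by
  have hne : {δ : ℝ | ∃ f g : ℝ → ℝ, P.IsReparam f ∧ Q.IsReparam g ∧
      δ = sSup ((fun t => dist (P.eval (f t)) (Q.eval (g t))) '' Set.Icc 0 1)}.Nonempty := by
    have hP := MonoOnto.mul_left P.one_le_size one_pos
    have hQ := MonoOnto.mul_left Q.one_le_size one_pos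
    rw [mul_one] at hP hQ
    exact ⟨_, _, _, hP, hQ, rfl⟩
  obtain ⟨_, ⟨f, g, hf, hg, rfl⟩, hlt⟩ := exists_lt_of_csInf_lt hne h
  have hf' : MonoOnto f 1 (P.size - 1) := hf
  have hg' : MonoOnto g 1 (Q.size - 1) := hg
  refine ⟨f, g, hf, hg, fun t ht => le_trans (le_csSup ?_
    (mem_image_of_mem (fun t => dist (P.eval (f t)) (Q.eval (g t))) ht)) hlt.le⟩
  obtain ⟨M, hM⟩ := P.norm_eval_le
  obtain ⟨M', hM'⟩ := Q.norm_eval_le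
  refine ⟨M + M', ?_⟩
  rintro _ ⟨s, hs, rfl⟩
  simp only [dist_eq_norm]
  exact (norm_sub_le _ _).trans (add_le_add (hM _ (hf'.mapsTo hs).1) (hM' _ (hg'.mapsTo hs).1))

/-- A monotone surjection from the domain of `P` onto that of `S` that moves points by at most `μ`
pulls matchings with `S` back to matchings with `P`. -/
theorem Matched.pullback {P S T : Curve d} {σ : ℝ → ℝ} {y μ D : ℝ}
    (hσ : MonoOnto σ (P.size - 1) (S.size - 1))
    (hd : ∀ x ∈ Icc (0 : ℝ) (P.size - 1), dist (P.eval x) (S.eval (σ x)) ≤ μ)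
    (h : Matched S T (S.size - 1) y D) : Matched P T (P.size - 1) y (μ + D) := by
  obtain ⟨f, g, hf, hg, h⟩ := h
  obtain ⟨X, Y, hX, hY, hXY⟩ := MonoOnto.exists_fiber S.one_le_size hσ hf
  have hP := P.one_le_size
  -- The fibre product of `σ` and `f` is traversed over an interval whose length is the sum of those
  -- of their domains, `P.size - 1` and `1`; it is rescaled to `[0, 1]`.
  have hL : MonoOnto (fun t => ((P.size : ℝ) - 1 + 1) * t) 1 ((P.size : ℝ) - 1 + 1) := by
    simpa using MonoOnto.mul_left (a := (P.size : ℝ) - 1 + 1) (by linarith) one_pos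
  refine ⟨_, _, hX.comp hL, hg.comp (hY.comp hL), fun t ht => ?_⟩
  have ht' := hL.mapsTo ht
  refine (dist_triangle _ (S.eval (σ (X ((P.size - 1 + 1) * t)))) _).trans (add_le_add ?_ ?_)
  · exact hd _ (hX.mapsTo ht')
  · rw [hXY _ ht']
    exact h _ (hY.mapsTo ht')

theorem Matched.pushforward {P S T : Curve d} {σ : ℝ → ℝ} {y μ D : ℝ}
    (hσ : MonoOnto σ (P.size - 1) (S.size - 1))
    (hd : ∀ x ∈ Icc (0 : ℝ) (P.size - 1), dist (P.eval x) (S.eval (σ x)) ≤ μ)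
    (h : Matched P T (P.size - 1) y D) : Matched S T (S.size - 1) y (μ + D) := by
  obtain ⟨f, g, hf, hg, h⟩ := h
  refine ⟨_, g, hσ.comp hf, hg, fun t ht => ?_⟩
  refine (dist_triangle _ (P.eval (f t)) _).trans (add_le_add ?_ (h t ht))
  rw [dist_comm]
  exact hd _ (hf.mapsTo ht)

end

end Frechet

namespace Frechet

noncomputable section

open Set

variable {d : ℕ}

/-! ### Computations with step counts -/

namespace Timed

variable {α β : Type}

@[simp] theorem bind_val (x : Timed α) (f : α → Timed β) : (x >>= f).val = (f x.val).val := rfl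

@[simp] theorem bind_steps (x : Timed α) (f : α → Timed β) :
    (x >>= f).steps = x.steps + (f x.val).steps := rfl

end Timed

@[simp] theorem op_val {α : Type} (a : α) : (op a).val = a := rfl

@[simp] theorem op_steps {α : Type} (a : α) : (op a).steps = 1 := rfl

theorem op_bind_val {α β : Type} (a : α) (f : α → Timed β) : (op a >>= f).val = (f a).val := rfl

theorem op_bind_steps {α β : Type} (a : α) (f : α → Timed β) :
    (op a >>= f).steps = 1 + (f a).steps := rfl

/-! ### The structure of greedy simplifications -/

theorem simplifyFrom_cons (μ : ℝ) (s q : Pt d) (qs : List (Pt d)) :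
    (simplifyFrom μ s (q :: qs)).val =
      if μ ≤ dist s q then q :: (simplifyFrom μ q qs).val else (simplifyFrom μ s qs).val := by
  by_cases h : μ ≤ dist s q <;> simp [simplifyFrom, h]

theorem simplifyFrom_steps_le (μ : ℝ) (s : Pt d) (qs : List (Pt d)) :
    (simplifyFrom μ s qs).steps ≤ 4 * qs.length + 1 := by
  induction qs generalizing s with
  | nil => simp [simplifyFrom]
  | cons q qs ih =>
    have h₁ := ih q
    have h₂ := ih s
    by_cases h : μ ≤ dist s q <;> simp [simplifyFrom, h] <;> omega

theorem simplify_steps_le (μ : ℝ) (P : Curve d) : (simplify μ P).steps ≤ 4 * P.size := by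
  simp only [simplify, Timed.bind_steps, op_val, op_steps]
  have h := simplifyFrom_steps_le μ (P.verts.head P.ne_nil) P.verts.tail
  have hp : 0 < P.verts.length := P.size_pos
  simp only [List.length_tail, Curve.size] at *
  omega

/-- Generalized for the induction: `p` is the vertex read last and `s` the vertex taken last, and
the two may differ inside a run. -/
theorem exists_simplifyFrom_index {μ : ℝ} (s p : Pt d) (qs : List (Pt d)) (hp : dist p s < μ) :
    ∃ ρ : ℕ → ℕ, ρ 0 = 0 ∧ ρ qs.length = (simplifyFrom μ s qs).val.length ∧
      (∀ l < qs.length, ρ (l + 1) = ρ l ∨ (ρ (l + 1) = ρ l + 1 ∧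
        (p :: qs)[l + 1]? = (s :: (simplifyFrom μ s qs).val)[ρ (l + 1)]? ∧
        ∃ a b, (p :: qs)[l + 1]? = some b ∧ (s :: (simplifyFrom μ s qs).val)[ρ l]? = some a ∧
          μ ≤ dist a b)) ∧
      ∀ l ≤ qs.length, ∃ a b, (p :: qs)[l]? = some a ∧
        (s :: (simplifyFrom μ s qs).val)[ρ l]? = some b ∧ dist a b < μ := by
  induction qs generalizing s p with
  | nil =>
    refine ⟨fun _ => 0, rfl, by simp [simplifyFrom], by simp, ?_⟩
    intro l hl
    obtain rfl : l = 0 := by simpa using hl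
    exact ⟨p, s, by simp, by simp, hp⟩
  | cons q qs ih =>
    rw [simplifyFrom_cons]
    split_ifs with h
    · have hμ : 0 < μ := dist_nonneg.trans_lt hp
      obtain ⟨ρ, h0, h1, h2, h3⟩ := ih q q (by simpa using hμ)
      refine ⟨fun l => if l = 0 then 0 else ρ (l - 1) + 1, by simp, by simp [h1], ?_, ?_⟩
      · intro l hl
        rcases l with _ | l
        · right
          simp only [h0, zero_add, Nat.sub_self, one_ne_zero, if_false, if_true]
          exact ⟨trivial, by simp, s, q, by simp, by simp, h⟩
        · simpa using h2 l (by simpa using hl)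
      · intro l hl
        rcases l with _ | l
        · exact ⟨p, s, by simp, by simp, hp⟩
        · simpa using h3 l (by simpa using hl)
    · obtain ⟨ρ, h0, h1, h2, h3⟩ := ih s q (by rw [dist_comm]; exact not_le.mp h)
      refine ⟨fun l => if l = 0 then 0 else ρ (l - 1), by simp, by simp [h1], ?_, ?_⟩
      · intro l hl
        rcases l with _ | l
        · left; simp [h0]
        · simpa using h2 l (by simpa using hl)
      · intro l hl
        rcases l with _ | l
        · exact ⟨p, s, by simp, by simp, hp⟩
        · simpa using h3 l (by simpa using hl)

/-- `S` arises from `P` by collapsing runs of consecutive vertices: the vertex `l` of `P` belongs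
to the run of the vertex `ρ l` of `S`. Every run starts with a vertex of `S`, has all its vertices at
distance less than `μ` from it, and ends because the next vertex has distance at least `μ`. -/
structure IsSimplification (μ : ℝ) (P S : Curve d) (ρ : ℕ → ℕ) : Prop where
  zero : ρ 0 = 0
  last : ρ (P.size - 1) = S.size - 1
  vertex_zero : S.vertex 0 = P.vertex 0
  step : ∀ l, l + 1 < P.size → ρ (l + 1) = ρ l ∨ (ρ (l + 1) = ρ l + 1 ∧
    S.vertex (ρ l + 1) = P.vertex (l + 1) ∧ μ ≤ dist (S.vertex (ρ l)) (S.vertex (ρ l + 1)))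
  near : ∀ l < P.size, dist (P.vertex l) (S.vertex (ρ l)) < μ

theorem vertex_eq_of_getElem? {P : Curve d} {i : ℕ} {a : Pt d} (h : P.verts[i]? = some a) :
    P.vertex i = a := by
  simp [Curve.vertex, List.getD_eq_getElem?_getD, h]

theorem exists_isSimplification {μ : ℝ} (hμ : 0 < μ) (P : Curve d) :
    ∃ ρ, IsSimplification μ P (simplify μ P).val ρ := by
  obtain ⟨V, hV⟩ := P
  rcases V with _ | ⟨p, qs⟩
  · exact absurd rfl hV
  obtain ⟨ρ, h0, h1, h2, h3⟩ := exists_simplifyFrom_index p p qs (μ := μ) (by simpa using hμ)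
  set S := (simplify μ ⟨p :: qs, hV⟩).val with hS
  have hv : S.verts = p :: (simplifyFrom μ p qs).val := rfl
  rw [← hv] at h2 h3
  refine ⟨ρ, h0, ?_, ?_, ?_, ?_⟩
  · simp [Curve.size, hv, h1]
  · simp [Curve.vertex, hv]
  · intro l hl
    rcases h2 l (by simpa [Curve.size] using hl) with h | ⟨h, h', a, b, hb, ha, hab⟩
    · exact Or.inl h
    · refine Or.inr ⟨h, ?_, ?_⟩
      · rw [← h, vertex_eq_of_getElem? (h'.symm.trans hb), vertex_eq_of_getElem? (P := ⟨p :: qs, hV⟩) hb]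
      · rw [← h, vertex_eq_of_getElem? (h'.symm.trans hb), vertex_eq_of_getElem? ha]
        exact hab
  · intro l hl
    obtain ⟨a, b, ha, hb, hab⟩ := h3 l (by simp [Curve.size] at hl; omega)
    rw [vertex_eq_of_getElem? (P := ⟨p :: qs, hV⟩) ha, vertex_eq_of_getElem? hb]
    exact hab

namespace IsSimplification

variable {μ : ℝ} {P S : Curve d} {ρ : ℕ → ℕ}

theorem mono (h : IsSimplification μ P S ρ) {k l : ℕ} (hkl : k ≤ l) (hl : l < P.size) :
    ρ k ≤ ρ l := by
  induction l, hkl using Nat.le_induction with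
  | base => exact le_rfl
  | succ l hkl ih =>
    have := ih (by omega)
    rcases h.step l hl with h | h <;> omega

theorem le_self (h : IsSimplification μ P S ρ) {l : ℕ} (hl : l < P.size) : ρ l ≤ l := by
  induction l with
  | zero => simp [h.zero]
  | succ l ih =>
    have := ih (by omega)
    rcases h.step l hl with h | h <;> omega

theorem size_le (h : IsSimplification μ P S ρ) : S.size ≤ P.size := by
  have h1 := h.le_self (l := P.size - 1) (by have := P.size_pos; omega)
  have := P.size_pos
  have := h.last
  omega

/-- The piecewise linear interpolation of the index map. -/
def reparam (ρ : ℕ → ℕ) (x : ℝ) : ℝ :=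
  ρ ⌊x⌋₊ + (x - ⌊x⌋₊) * ((ρ (⌊x⌋₊ + 1) : ℝ) - ρ ⌊x⌋₊)

theorem reparam_eq (ρ : ℕ → ℕ) (l : ℕ) {x : ℝ} (h₀ : (l : ℝ) ≤ x) (h₁ : x ≤ l + 1) :
    reparam ρ x = ρ l + (x - l) * ((ρ (l + 1) : ℝ) - ρ l) := by
  rcases h₁.lt_or_eq with h | h
  · have : ⌊x⌋₊ = l := by
      rw [Nat.floor_eq_iff (le_trans (Nat.cast_nonneg l) h₀)]
      exact ⟨h₀, h⟩
    simp [reparam, this]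
  · have : ⌊x⌋₊ = l + 1 := by
      rw [h]; exact_mod_cast Nat.floor_natCast (R := ℝ) (l + 1)
    rw [reparam, this, h]; simp

theorem reparam_natCast (ρ : ℕ → ℕ) (l : ℕ) : reparam ρ l = ρ l := by
  simp [reparam_eq ρ l le_rfl (by linarith)]

theorem reparam_monoOnto_nat (h : IsSimplification μ P S ρ) (l : ℕ) (hl : l < P.size) :
    MonoOnto (reparam ρ) l (ρ l) := by
  induction l with
  | zero =>
    rw [h.zero]
    have : reparam ρ 0 = 0 := by simpa [h.zero] using reparam_natCast ρ 0
    refine ⟨?_, ?_⟩ <;> simp [this]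
  | succ l ih =>
    have ih := ih (by omega)
    have hU : Icc (0 : ℝ) (l + 1 : ℕ) = Icc (0 : ℝ) l ∪ Icc (l : ℝ) (l + 1) := by
      push_cast
      rw [Icc_union_Icc_eq_Icc (by positivity) (by linarith)]
    have hle : (ρ l : ℝ) ≤ ρ (l + 1) := by
      exact_mod_cast h.mono (Nat.le_succ l) hl
    have hm : MonotoneOn (reparam ρ) (Icc (l : ℝ) (l + 1)) := by
      intro x hx y hy hxy
      rw [reparam_eq ρ l hx.1 hx.2, reparam_eq ρ l hy.1 hy.2]
      have := mul_le_mul_of_nonneg_right (show x - l ≤ y - l by linarith)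
        (show (0 : ℝ) ≤ ρ (l + 1) - ρ l by linarith)
      linarith
    have hc : ContinuousOn (reparam ρ) (Icc (l : ℝ) (l + 1)) := by
      refine ContinuousOn.congr (f := fun x : ℝ => ρ l + (x - l) * ((ρ (l + 1) : ℝ) - ρ l))
        (by fun_prop) fun x hx => reparam_eq ρ l hx.1 hx.2
    refine MonoOnto.of_continuousOn ?_ ?_ (by positivity) ?_ (reparam_natCast _ _)
    · rw [hU]
      exact ih.1.union_right hm ⟨right_mem_Icc.mpr (by positivity), fun x hx => hx.2⟩
        ⟨left_mem_Icc.mpr (by linarith), fun x hx => hx.1⟩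
    · rw [hU]
      exact ih.continuousOn.union_of_isClosed hc isClosed_Icc isClosed_Icc
    · simpa [h.zero] using reparam_natCast ρ 0

theorem reparam_monoOnto (h : IsSimplification μ P S ρ) :
    MonoOnto (reparam ρ) (P.size - 1) (S.size - 1) := by
  have hp := P.size_pos
  have hs := S.size_pos
  have := h.reparam_monoOnto_nat (P.size - 1) (by omega)
  rwa [h.last, Nat.cast_sub (by omega), Nat.cast_sub (by omega), Nat.cast_one] at this

/-- Skipped vertices are strictly closer than `μ`, and there are finitely many. The slack gained
here offsets the infimum in `frechetDist` that need not be attained. -/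
theorem exists_near_le (h : IsSimplification μ P S ρ) :
    ∃ μ' < μ, ∀ l < P.size, dist (P.vertex l) (S.vertex (ρ l)) ≤ μ' := by
  obtain ⟨l, hl, hmax⟩ := (Finset.range P.size).exists_max_image
    (fun l => dist (P.vertex l) (S.vertex (ρ l))) ⟨0, by simpa using P.size_pos⟩
  exact ⟨_, h.near l (by simpa using hl), fun k hk => hmax k (by simpa using hk)⟩

/-- On an edge of `P` inside a run, the point on `S` waits at the vertex of the run. On an edge that
ends a run, it traverses the edge of `S`, which has the same endpoint. Either way the distance at
the ends of the edge controls the interior. -/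
theorem dist_eval_reparam_le (h : IsSimplification μ P S ρ) {μ' : ℝ}
    (hμ' : ∀ l < P.size, dist (P.vertex l) (S.vertex (ρ l)) ≤ μ') {x : ℝ}
    (hx : x ∈ Icc (0 : ℝ) (P.size - 1)) : dist (P.eval x) (S.eval (reparam ρ x)) ≤ μ' := by
  obtain ⟨hx0, hx1⟩ := hx
  have hp := P.size_pos
  have hf := Nat.floor_le hx0
  have hf' := Nat.lt_floor_add_one x
  have hl : ⌊x⌋₊ < P.size := by
    have : (⌊x⌋₊ : ℝ) < P.size := by linarith
    exact_mod_cast this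
  set l := ⌊x⌋₊ with hldef
  rcases Nat.lt_or_ge (l + 1) P.size with hl1 | hl1
  · rw [P.eval_eq_lineMap l hf hf'.le, reparam_eq ρ l hf hf'.le]
    have ht : x - l ∈ Icc (0 : ℝ) 1 := ⟨by linarith, by linarith⟩
    rcases h.step l hl1 with hs | ⟨hs, hv, -⟩
    · rw [hs, sub_self, mul_zero, add_zero, S.eval_natCast,
        ← AffineMap.lineMap_same_apply (k := ℝ) (S.vertex (ρ l)) (x - l)]
      refine Curve.lineMap_dist_le (hμ' l hl) ?_ ht
      rw [← hs]
      exact hμ' _ hl1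
    · have hr : (ρ l : ℝ) + (x - l) * ((ρ (l + 1) : ℕ) - ρ l) = ρ l + (x - l) := by
        rw [hs]; push_cast; ring
      rw [hr, S.eval_eq_lineMap (ρ l) (by linarith [ht.1]) (by linarith [ht.2]), add_sub_cancel_left]
      refine Curve.lineMap_dist_le (hμ' l hl) ?_ ht
      rw [hv, dist_self]
      exact dist_nonneg.trans (hμ' l hl)
  · have : x = l := by
      refine le_antisymm ?_ hf
      have : (P.size : ℝ) ≤ l + 1 := by exact_mod_cast hl1
      linarith
    rw [this, P.eval_natCast, reparam_natCast, S.eval_natCast]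
    exact hμ' l hl

end IsSimplification

end

end Frechet

namespace Frechet

noncomputable section

open Set MeasureTheory

variable {d : ℕ}

/-! ### The length of a curve inside a ball -/

/-- The parameters in `[0, 1]` for which the segment from `a` to `b` is in the ball `B(z, R)`. -/
def ballParams (a b z : Pt d) (R : ℝ) : Set ℝ :=
  {t : ℝ | t ∈ Icc (0 : ℝ) 1 ∧ AffineMap.lineMap a b t ∈ Metric.closedBall z R}

theorem ballParams_subset (a b z : Pt d) (R : ℝ) : ballParams a b z R ⊆ Icc 0 1 := fun _ h => h.1

theorem measurableSet_ballParams (a b z : Pt d) (R : ℝ) : MeasurableSet (ballParams a b z R) := by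
  refine measurableSet_Icc.inter ?_
  exact (Metric.isClosed_closedBall.preimage AffineMap.lineMap_continuous).measurableSet

theorem volume_ballParams_inter_ne_top (a b z : Pt d) (R : ℝ) (s : Set ℝ) :
    volume (ballParams a b z R ∩ s) ≠ ⊤ :=
  ne_top_of_le_ne_top (by simp : volume (Icc (0 : ℝ) 1) ≠ ⊤)
    (measure_mono (inter_subset_left.trans (ballParams_subset a b z R)))

theorem convex_ballParams (a b z : Pt d) (R : ℝ) : Convex ℝ (ballParams a b z R) :=
  (convex_Icc _ _).inter ((convex_closedBall z R).affine_preimage _)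

/-- The distance to `z`, clipped at `R`, is constant outside the ball and changes inside it with
speed at most `dist a b`. Clipping avoids any computation of where the segment crosses the sphere.
-/
theorem abs_clipped_dist_sub_le (a b z : Pt d) (R : ℝ) {u v : ℝ} (hu : 0 ≤ u) (huv : u ≤ v)
    (hv : v ≤ 1) :
    |min (dist (AffineMap.lineMap a b v) z) R - min (dist (AffineMap.lineMap a b u) z) R| ≤
      dist a b * volume.real (ballParams a b z R ∩ Ioc u v) := by
  have hlip : ∀ s t : ℝ, dist (AffineMap.lineMap a b s : Pt d) z ≤
      dist (AffineMap.lineMap a b t : Pt d) z + |s - t| * dist a b := fun s t => by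
    have h1 := dist_triangle (AffineMap.lineMap a b s : Pt d) (AffineMap.lineMap a b t) z
    rw [dist_lineMap_lineMap, Real.dist_eq] at h1
    linarith
  have hmeas : ∀ p q : ℝ, p ≤ q → Ioc p q ⊆ ballParams a b z R ∩ Ioc u v →
      dist a b * (q - p) ≤ dist a b * volume.real (ballParams a b z R ∩ Ioc u v) := fun p q hpq h => by
    refine mul_le_mul_of_nonneg_left ?_ dist_nonneg
    have := measureReal_mono (μ := volume) h (volume_ballParams_inter_ne_top a b z R _)
    rwa [Real.volume_real_Ioc_of_le hpq] at this
  rcases (dist_nonneg (x := a) (y := b)).eq_or_lt with hL | hL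
  · have h1 := hlip u v
    have h2 := hlip v u
    rw [← hL, mul_zero, add_zero] at h1 h2
    rw [le_antisymm h1 h2, sub_self, abs_zero, ← hL, zero_mul]
  have hnn : 0 ≤ dist a b * volume.real (ballParams a b z R ∩ Ioc u v) := by positivity
  by_cases hu' : dist (AffineMap.lineMap a b u : Pt d) z ≤ R <;>
    by_cases hv' : dist (AffineMap.lineMap a b v : Pt d) z ≤ R
  · rw [min_eq_left hu', min_eq_left hv']
    refine le_trans ?_ (hmeas u v huv fun t ht => ⟨?_, ht⟩)
    · have h1 := hlip u v
      have h2 := hlip v u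
      rw [abs_sub_comm u v] at h1
      rw [abs_of_nonneg (show 0 ≤ v - u by linarith)] at h1 h2
      rw [abs_le]
      constructor <;> linarith
    · have hc := (convex_ballParams a b z R).ordConnected
      exact hc.out (show u ∈ _ from ⟨⟨hu, by linarith⟩, hu'⟩)
        (show v ∈ _ from ⟨⟨by linarith, hv⟩, hv'⟩) ⟨ht.1.le, ht.2⟩
  · push Not at hv'
    rw [min_eq_left hu', min_eq_right hv'.le, abs_of_nonneg (by linarith)]
    -- The segment needs at least the time `D / dist a b` to leave the ball, so an initial piece of
    -- that duration is inside.
    set D := R - dist (AffineMap.lineMap a b u : Pt d) z with hD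
    have hq : D / dist a b ≤ v - u := by
      rw [div_le_iff₀ hL]
      have h2 := hlip v u
      rw [abs_of_nonneg (show 0 ≤ v - u by linarith)] at h2
      linarith
    have hq0 : 0 ≤ D / dist a b := div_nonneg (by linarith) hL.le
    have := hmeas u (u + D / dist a b) (by linarith) fun t ht => ⟨⟨⟨by linarith [ht.1],
      by linarith [ht.2]⟩, ?_⟩, ht.1, by linarith [ht.2]⟩
    · rwa [add_sub_cancel_left, mul_div_cancel₀ _ hL.ne'] at this
    · rw [Metric.mem_closedBall]
      refine (hlip t u).trans ?_
      rw [abs_of_nonneg (by linarith [ht.1])]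
      have : (t - u) * dist a b ≤ D := by
        rw [← le_div_iff₀ hL]; linarith [ht.2]
      linarith
  · push Not at hu'
    rw [min_eq_left hv', min_eq_right hu'.le, abs_of_nonpos (by linarith)]
    set D := R - dist (AffineMap.lineMap a b v : Pt d) z with hD
    have hq : D / dist a b ≤ v - u := by
      rw [div_le_iff₀ hL]
      have h2 := hlip u v
      rw [abs_of_nonpos (show u - v ≤ 0 by linarith)] at h2
      linarith
    have hq0 : 0 ≤ D / dist a b := div_nonneg (by linarith) hL.le
    have := hmeas (v - D / dist a b) v (by linarith) fun t ht => ⟨⟨⟨by linarith [ht.1],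
      by linarith [ht.2]⟩, ?_⟩, by linarith [ht.1], ht.2⟩
    · rw [sub_sub_cancel, mul_div_cancel₀ _ hL.ne'] at this
      linarith
    · rw [Metric.mem_closedBall]
      refine (hlip t v).trans ?_
      rw [abs_of_nonpos (by linarith [ht.2])]
      have : -(t - v) * dist a b ≤ D := by
        rw [← le_div_iff₀ hL]; linarith [ht.1]
      linarith
  · push Not at hu' hv'
    rwa [min_eq_right hu'.le, min_eq_right hv'.le, sub_self, abs_zero]

namespace Curve

/-- The length of the edge `l` of `P` inside the ball `B(z, R)`, up to the parameter `x` of `P`. -/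
def edgeLengthTo (P : Curve d) (z : Pt d) (R : ℝ) (l : ℕ) (x : ℝ) : ℝ :=
  dist (P.vertex l) (P.vertex (l + 1)) *
    volume.real (ballParams (P.vertex l) (P.vertex (l + 1)) z R ∩ Iic (x - l))

/-- The length of the edge `l` of `P` inside the ball `B(z, R)`. -/
def edgeLength (P : Curve d) (z : Pt d) (R : ℝ) (l : ℕ) : ℝ :=
  dist (P.vertex l) (P.vertex (l + 1)) *
    volume.real (ballParams (P.vertex l) (P.vertex (l + 1)) z R)

/-- The length of `P` inside the ball `B(z, R)` up to the parameter `x`. -/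
def lengthTo (P : Curve d) (z : Pt d) (R x : ℝ) : ℝ :=
  ∑ l ∈ Finset.range (P.size - 1), P.edgeLengthTo z R l x

variable (P : Curve d) (z : Pt d) (R : ℝ)

theorem lengthInBall_eq : P.lengthInBall z R = ∑ l ∈ Finset.range (P.size - 1), P.edgeLength z R l :=
  rfl

theorem edgeLength_nonneg (l : ℕ) : 0 ≤ P.edgeLength z R l := by
  unfold edgeLength; positivity

theorem lengthTo_nonneg (x : ℝ) : 0 ≤ P.lengthTo z R x :=
  Finset.sum_nonneg fun l _ => by unfold edgeLengthTo; positivity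

theorem lengthTo_le (x : ℝ) : P.lengthTo z R x ≤ P.lengthInBall z R := by
  rw [lengthInBall_eq]
  refine Finset.sum_le_sum fun l _ => mul_le_mul_of_nonneg_left ?_ dist_nonneg
  refine measureReal_mono inter_subset_left ?_
  simpa using volume_ballParams_inter_ne_top (P.vertex l) (P.vertex (l + 1)) z R univ

theorem edgeLengthTo_sub (l : ℕ) {x y : ℝ} (h : x ≤ y) :
    P.edgeLengthTo z R l y - P.edgeLengthTo z R l x = dist (P.vertex l) (P.vertex (l + 1)) *
      volume.real (ballParams (P.vertex l) (P.vertex (l + 1)) z R ∩ Ioc (x - l) (y - l)) := by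
  rw [edgeLengthTo, edgeLengthTo, ← mul_sub]
  congr 1
  have hsub : ballParams (P.vertex l) (P.vertex (l + 1)) z R ∩ Iic (x - l) ⊆
      ballParams (P.vertex l) (P.vertex (l + 1)) z R ∩ Iic (y - l) :=
    inter_subset_inter_right _ (Iic_subset_Iic.mpr (by linarith))
  rw [← measureReal_sdiff hsub ((measurableSet_ballParams _ _ _ _).inter measurableSet_Iic)
    (volume_ballParams_inter_ne_top _ _ _ _ _), ← inter_sdiff_distrib_left]
  congr 2
  ext t
  simp [and_comm]

theorem monotone_edgeLengthTo (l : ℕ) : Monotone (P.edgeLengthTo z R l) := fun x y h => by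
  have := P.edgeLengthTo_sub z R l h
  have h' : 0 ≤ P.edgeLengthTo z R l y - P.edgeLengthTo z R l x := by rw [this]; positivity
  linarith

theorem monotone_lengthTo : Monotone (P.lengthTo z R) := fun _ _ h =>
  Finset.sum_le_sum fun l _ => P.monotone_edgeLengthTo z R l h

theorem abs_clipped_dist_eval_sub_le_of_edge {l : ℕ} (hl : l + 1 < P.size) {x y : ℝ}
    (hx : (l : ℝ) ≤ x) (hxy : x ≤ y) (hy : y ≤ l + 1) :
    |min (dist (P.eval y) z) R - min (dist (P.eval x) z) R| ≤
      P.lengthTo z R y - P.lengthTo z R x := by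
  rw [P.eval_eq_lineMap l hx (hxy.trans hy), P.eval_eq_lineMap l (hx.trans hxy) hy]
  refine (abs_clipped_dist_sub_le _ _ _ _ (by linarith) (by linarith) (by linarith)).trans ?_
  rw [← P.edgeLengthTo_sub z R l hxy, lengthTo, lengthTo, ← Finset.sum_sub_distrib]
  refine Finset.single_le_sum
    (f := fun l => P.edgeLengthTo z R l y - P.edgeLengthTo z R l x) (fun k _ => ?_)
    (Finset.mem_range.mpr (by omega))
  exact sub_nonneg.mpr (P.monotone_edgeLengthTo z R k hxy)

/-- A bound of the change of `ψ` by the growth of the length says that length plus `ψ` and length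
minus `ψ` are monotone. Monotonicity can be glued edge by edge; applying this to `ψ` and `-ψ`
recovers the two-sided bound. -/
theorem monotoneOn_lengthTo_add {ψ : ℝ → ℝ}
    (h : ∀ l : ℕ, l + 1 < P.size → ∀ x y : ℝ, (l : ℝ) ≤ x → x ≤ y → y ≤ l + 1 →
      |ψ y - ψ x| ≤ P.lengthTo z R y - P.lengthTo z R x) (k : ℕ) (hk : k < P.size) :
    MonotoneOn (fun x => P.lengthTo z R x + ψ x) (Icc 0 k) := by
  induction k with
  | zero => simp
  | succ k ih =>
    have hU : Icc (0 : ℝ) (k + 1 : ℕ) = Icc (0 : ℝ) k ∪ Icc (k : ℝ) (k + 1) := by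
      push_cast
      rw [Icc_union_Icc_eq_Icc (by positivity) (by linarith)]
    rw [hU]
    refine (ih (by omega)).union_right (c := (k : ℝ)) (fun x hx y hy hxy => ?_)
      ⟨right_mem_Icc.mpr (by positivity), fun x hx => hx.2⟩
      ⟨left_mem_Icc.mpr (by linarith), fun x hx => hx.1⟩
    have := (abs_le.mp (h k hk x y hx.1 hxy hy.2)).1
    linarith

theorem abs_clipped_dist_eval_sub_le {x y : ℝ} (hx : 0 ≤ x) (hxy : x ≤ y) (hy : y ≤ P.size - 1) :
    |min (dist (P.eval y) z) R - min (dist (P.eval x) z) R| ≤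
      P.lengthTo z R y - P.lengthTo z R x := by
  have hp := P.size_pos
  have hc : ((P.size - 1 : ℕ) : ℝ) = P.size - 1 := by rw [Nat.cast_sub (by omega), Nat.cast_one]
  have hmem : x ∈ Icc (0 : ℝ) (P.size - 1 : ℕ) ∧ y ∈ Icc (0 : ℝ) (P.size - 1 : ℕ) := by
    rw [hc]; exact ⟨⟨hx, hxy.trans hy⟩, hx.trans hxy, hy⟩
  have h1 := P.monotoneOn_lengthTo_add z R (ψ := fun x => min (dist (P.eval x) z) R)
    (fun l hl x y h h' h'' => P.abs_clipped_dist_eval_sub_le_of_edge z R hl h h' h'')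
    (P.size - 1) (by omega) hmem.1 hmem.2 hxy
  have h2 := P.monotoneOn_lengthTo_add z R (ψ := fun x => -min (dist (P.eval x) z) R)
    (fun l hl x y h h' h'' => by
      rw [← abs_neg, neg_sub, sub_neg_eq_add, add_comm, ← sub_eq_add_neg]
      exact P.abs_clipped_dist_eval_sub_le_of_edge z R hl h h' h'')
    (P.size - 1) (by omega) hmem.1 hmem.2 hxy
  simp only at h1 h2
  rw [abs_le]
  constructor <;> linarith

theorem edgeLength_eq_of_mem {l : ℕ} (h₀ : dist (P.vertex l) z ≤ R)
    (h₁ : dist (P.vertex (l + 1)) z ≤ R) :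
    P.edgeLength z R l = dist (P.vertex l) (P.vertex (l + 1)) := by
  have : ballParams (P.vertex l) (P.vertex (l + 1)) z R = Icc 0 1 :=
    Subset.antisymm (ballParams_subset _ _ _ _) fun t ht =>
      ⟨ht, (convex_closedBall z R).lineMap_mem h₀ h₁ ht⟩
  simp [edgeLength, this]

/-- Either both ends lie in the ball and the whole edge counts, or one end is outside and the
clipped distance changes by at least `R - r` on the way to it. -/
theorem le_edgeLength_of_mem {l : ℕ} {r t : ℝ} (ht : t ∈ Icc (0 : ℝ) 1)
    (h : dist (AffineMap.lineMap (P.vertex l) (P.vertex (l + 1)) t) z ≤ r) :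
    min (dist (P.vertex l) (P.vertex (l + 1))) (R - r) ≤ P.edgeLength z R l := by
  have hm : ∀ s : Set ℝ, dist (P.vertex l) (P.vertex (l + 1)) *
      volume.real (ballParams (P.vertex l) (P.vertex (l + 1)) z R ∩ s) ≤ P.edgeLength z R l :=
    fun s => mul_le_mul_of_nonneg_left (measureReal_mono inter_subset_left
      (by simpa using volume_ballParams_inter_ne_top (P.vertex l) (P.vertex (l + 1)) z R univ))
      dist_nonneg
  have hr : min (dist (AffineMap.lineMap (P.vertex l) (P.vertex (l + 1)) t : Pt d) z) R ≤ r :=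
    (min_le_left _ _).trans h
  by_cases h₀ : dist (P.vertex l) z ≤ R
  · by_cases h₁ : dist (P.vertex (l + 1)) z ≤ R
    · rw [P.edgeLength_eq_of_mem z R h₀ h₁]
      exact min_le_left _ _
    · have := (abs_clipped_dist_sub_le (P.vertex l) (P.vertex (l + 1)) z R ht.1 ht.2 le_rfl).trans
        (hm _)
      rw [AffineMap.lineMap_apply_one, min_eq_right (not_le.mp h₁).le] at this
      have := (abs_le.mp this).2
      exact (min_le_right _ _).trans (by linarith)
  · have := (abs_clipped_dist_sub_le (P.vertex l) (P.vertex (l + 1)) z R le_rfl ht.1 ht.2).trans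
      (hm _)
    rw [AffineMap.lineMap_apply_zero, min_eq_right (not_le.mp h₀).le] at this
    have := (abs_le.mp this).1
    exact (min_le_right _ _).trans (by linarith)

end Curve

/-! ### Simplifications of packed curves -/

namespace IsSimplification

variable {μ c : ℝ} {P S : Curve d} {ρ : ℕ → ℕ}

theorem exists_run_end (h : IsSimplification μ P S ρ) {k : ℕ} (hk : k + 1 < S.size) :
    ∃ l, l + 1 < P.size ∧ ρ l = k ∧ ρ (l + 1) = k + 1 := by
  by_contra! hne
  have key : ∀ l < P.size, ρ l ≤ k := by
    intro l
    induction l with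
    | zero => simp [h.zero]
    | succ l ih =>
      intro hl
      have := ih (by omega)
      have := hne l hl
      rcases h.step l hl with h | h <;> omega
  have := key (P.size - 1) (by have := P.size_pos; omega)
  have := h.last
  omega

theorem dist_edge_le_sum (h : IsSimplification μ P S ρ) {k : ℕ} (hk : k + 1 < S.size) :
    dist (S.vertex k) (S.vertex (k + 1)) ≤
      ∑ l ∈ (Finset.range (P.size - 1)).filter (fun l => ρ l = k),
        dist (P.vertex l) (P.vertex (l + 1)) := by
  rw [Finset.sum_filter]
  -- Telescoping potential: zero before the run of `k`, the distance from the start of the run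
  -- inside it, and the length of the edge of `S` after it. It grows only on edges of `P` that start
  -- in the run, and there by at most their length.
  let φ : ℕ → ℝ := fun l => if ρ l < k then 0 else if ρ l = k then dist (P.vertex l) (S.vertex k)
    else dist (S.vertex k) (S.vertex (k + 1))
  have h0 : φ 0 = 0 := by
    rcases Nat.eq_zero_or_pos k with rfl | hk0
    · simp [φ, h.zero, h.vertex_zero]
    · simp [φ, h.zero, hk0]
  have h1 : φ (P.size - 1) = dist (S.vertex k) (S.vertex (k + 1)) := by
    have h1 : ¬ (S.size - 1 < k) := by omega
    have h2 : ¬ (S.size - 1 = k) := by omega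
    simp [φ, h.last, h1, h2]
  have h2 := Finset.sum_range_sub φ (P.size - 1)
  rw [h0, h1, sub_zero] at h2
  rw [← h2]
  refine Finset.sum_le_sum fun l hl => ?_
  have hl' : l + 1 < P.size := by
    have := Finset.mem_range.mp hl
    omega
  have htri := dist_triangle_left (P.vertex (l + 1)) (S.vertex k) (P.vertex l)
  have hnn := dist_nonneg (x := P.vertex l) (y := P.vertex (l + 1))
  rcases h.step l hl' with hs | ⟨hs, hv, -⟩
  · simp only [φ, hs]
    split_ifs <;> linarith
  · rcases lt_trichotomy (ρ l) k with hlt | heq | hgt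
    · rcases Nat.lt_or_ge (ρ l + 1) k with hlt' | hge
      · simp [φ, hs, hlt, hlt', hlt.ne]
      · obtain rfl : k = ρ l + 1 := by omega
        simp [φ, hs, hv]
    · subst heq
      simp only [φ, hs, hv]
      simp
      have := dist_triangle_left (S.vertex (ρ l)) (P.vertex (l + 1)) (P.vertex l)
      linarith
    · have a1 : ¬ (ρ l < k) := by omega
      have a2 : ¬ (ρ l + 1 < k) := by omega
      have a3 : ¬ (ρ l = k) := by omega
      have a4 : ¬ (ρ l + 1 = k) := by omega
      simp [φ, hs, a1, a2, a3, a4]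

theorem le_dist_edge (h : IsSimplification μ P S ρ) {k : ℕ} (hk : k + 1 < S.size) :
    μ ≤ dist (S.vertex k) (S.vertex (k + 1)) := by
  obtain ⟨l, hl, hlk, hlk'⟩ := h.exists_run_end hk
  rcases h.step l hl with hs | ⟨-, -, hs⟩
  · omega
  · rwa [hlk] at hs

/-- If the edge of `S` has length at least `2μ`, the single edge of `P` that ends the run stays
within `μ` of it and has length at least `μ`. Otherwise the whole run, including its closing edge,
lies within `2μ` of `S.vertex k`, which is within `2μ` of the point near `z`; so the run is in the
ball and is at least as long as the edge. The two cases explain the radius `r + 4μ`. -/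
theorem le_sum_edgeLength (h : IsSimplification μ P S ρ) {k : ℕ} (hk : k + 1 < S.size) {z : Pt d}
    {r t : ℝ} (ht : t ∈ Icc (0 : ℝ) 1)
    (hz : dist (AffineMap.lineMap (S.vertex k) (S.vertex (k + 1)) t) z ≤ r) :
    μ ≤ ∑ l ∈ (Finset.range (P.size - 1)).filter (fun l => ρ l = k),
      P.edgeLength z (r + 4 * μ) l := by
  have hμ : 0 < μ := dist_nonneg.trans_lt (h.near 0 P.size_pos)
  rcases le_or_gt (2 * μ) (dist (S.vertex k) (S.vertex (k + 1))) with hlong | hshort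
  · obtain ⟨l, hl, hlk, hlk'⟩ := h.exists_run_end hk
    have hv : S.vertex (k + 1) = P.vertex (l + 1) := by
      rcases h.step l hl with hs | ⟨-, hs, -⟩
      · omega
      · rwa [hlk] at hs
    have hn := h.near l (by omega)
    rw [hlk] at hn
    have hd : dist (AffineMap.lineMap (P.vertex l) (P.vertex (l + 1)) t) z ≤ r + μ := by
      have h1 : dist (AffineMap.lineMap (P.vertex l) (P.vertex (l + 1)) t : Pt d)
          (AffineMap.lineMap (S.vertex k) (S.vertex (k + 1)) t) ≤ μ :=
        Curve.lineMap_dist_le hn.le (by rw [hv, dist_self]; exact hμ.le) ht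
      have h2 := dist_triangle (AffineMap.lineMap (P.vertex l) (P.vertex (l + 1)) t : Pt d)
        (AffineMap.lineMap (S.vertex k) (S.vertex (k + 1)) t) z
      linarith
    have h3 := P.le_edgeLength_of_mem z (r + 4 * μ) ht hd
    have h4 : μ ≤ dist (P.vertex l) (P.vertex (l + 1)) := by
      have := dist_triangle_left (S.vertex k) (S.vertex (k + 1)) (P.vertex l)
      rw [hv] at this hlong
      linarith
    refine (le_trans (le_min h4 (by linarith)) h3).trans ?_
    exact Finset.single_le_sum (f := fun l => P.edgeLength z (r + 4 * μ) l)
      (fun l _ => P.edgeLength_nonneg z _ l)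
      (Finset.mem_filter.mpr ⟨Finset.mem_range.mpr (by omega), hlk⟩)
  · have hk' : dist (S.vertex k) z ≤ r + 2 * μ := by
      have h1 := dist_triangle (S.vertex k)
        (AffineMap.lineMap (S.vertex k) (S.vertex (k + 1)) t) z
      rw [dist_left_lineMap, Real.norm_of_nonneg ht.1] at h1
      have : t * dist (S.vertex k) (S.vertex (k + 1)) ≤ dist (S.vertex k) (S.vertex (k + 1)) :=
        mul_le_of_le_one_left dist_nonneg ht.2
      linarith
    refine (h.le_dist_edge hk).trans ((h.dist_edge_le_sum hk).trans (Finset.sum_le_sum ?_))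
    intro l hl
    obtain ⟨hl1, hl2⟩ := Finset.mem_filter.mp hl
    have hl1 : l + 1 < P.size := by
      have := Finset.mem_range.mp hl1
      omega
    have hn := h.near l (by omega)
    rw [hl2] at hn
    refine (P.edgeLength_eq_of_mem z _ ?_ ?_).ge
    · linarith [dist_triangle (P.vertex l) (S.vertex k) z]
    · have h5 : dist (P.vertex (l + 1)) (S.vertex k) ≤ 2 * μ := by
        rcases h.step l hl1 with hs | ⟨-, hs, -⟩
        · have := h.near (l + 1) hl1
          rw [hs, hl2] at this
          linarith
        · rw [hl2] at hs
          rw [← hs, dist_comm]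
          exact hshort.le
      linarith [dist_triangle (P.vertex (l + 1)) (S.vertex k) z]

/-- A ball meets few edges of a simplification of a packed curve. -/
theorem card_edges_le (h : IsSimplification μ P S ρ) (hP : P.IsPacked c) {z : Pt d} {r : ℝ}
    (hr : 0 ≤ r) (A : Finset ℕ) (hA : ∀ k ∈ A, k + 1 < S.size)
    (hz : ∀ k ∈ A, ∃ t ∈ Icc (0 : ℝ) 1,
      dist (AffineMap.lineMap (S.vertex k) (S.vertex (k + 1)) t) z ≤ r) :
    (A.card : ℝ) * μ ≤ c * (r + 4 * μ) := by
  have hμ : 0 < μ := dist_nonneg.trans_lt (h.near 0 P.size_pos)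
  refine le_trans ?_ (hP z (r + 4 * μ) (by positivity))
  rw [Curve.lengthInBall_eq, ← nsmul_eq_mul]
  calc A.card • μ ≤ ∑ k ∈ A, ∑ l ∈ (Finset.range (P.size - 1)).filter (fun l => ρ l = k),
        P.edgeLength z (r + 4 * μ) l := by
        refine Finset.card_nsmul_le_sum _ _ _ fun k hk => ?_
        obtain ⟨t, ht, htz⟩ := hz k hk
        exact h.le_sum_edgeLength (hA k hk) ht htz
    _ = ∑ l ∈ (Finset.range (P.size - 1)).filter (fun l => ρ l ∈ A),
        P.edgeLength z (r + 4 * μ) l := by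
        -- The runs are the fibres of `ρ`, so no edge of `P` is charged twice.
        rw [← Finset.sum_fiberwise_of_maps_to (t := A) (g := ρ) (fun l hl =>
          (Finset.mem_filter.mp hl).2)]
        refine Finset.sum_congr rfl fun k hk => Finset.sum_congr ?_ fun _ _ => rfl
        ext l
        simp only [Finset.mem_filter]
        constructor
        · rintro ⟨h1, rfl⟩; exact ⟨⟨h1, hk⟩, rfl⟩
        · rintro ⟨⟨h1, -⟩, h2⟩; exact ⟨h1, h2⟩
    _ ≤ _ := Finset.sum_le_sum_of_subset_of_nonneg (Finset.filter_subset _ _)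
        fun l _ _ => P.edgeLength_nonneg z _ l

end IsSimplification

end

end Frechet

namespace Frechet

noncomputable section

open Set

variable {d : ℕ}

/-! ### Free intervals -/

theorem dist_lineMap_sq (s a b : Pt d) (t : ℝ) :
    dist (AffineMap.lineMap a b t) s ^ 2 =
      inner ℝ (b - a) (b - a) * t ^ 2 + 2 * inner ℝ (b - a) (a - s) * t
        + inner ℝ (a - s) (a - s) := by
  have : (AffineMap.lineMap a b t : Pt d) - s = t • (b - a) + (a - s) := by
    rw [AffineMap.lineMap_apply_module]; module
  rw [dist_eq_norm, this, norm_add_sq_real, norm_smul, mul_pow, inner_smul_left,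
    real_inner_self_eq_norm_sq, real_inner_self_eq_norm_sq]
  simp
  ring

theorem freeInterval_val (δ : ℝ) (s a b : Pt d) {A B D : ℝ} (hA : A = inner ℝ (b - a) (b - a))
    (hB : B = inner ℝ (b - a) (a - s)) (hD : D = B * B - A * (inner ℝ (a - s) (a - s) - δ * δ)) :
    (freeInterval δ s a b).val =
      if A = 0 then if inner ℝ (a - s) (a - s) - δ * δ ≤ 0 then some (0, 1) else none
      else if D < 0 then none
      else if max 0 ((-B - √D) / A) ≤ min 1 ((-B + √D) / A) then
        some (max 0 ((-B - √D) / A), min 1 ((-B + √D) / A))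
      else none := by
  subst hD hB hA
  simp only [freeInterval, op_bind_val, op_val, apply_ite Timed.val, decide_eq_true_eq]

theorem freeInterval_steps_le (δ : ℝ) (s a b : Pt d) : (freeInterval δ s a b).steps ≤ 23 := by
  simp only [freeInterval, op_bind_steps, op_steps, apply_ite Timed.steps, decide_eq_true_eq]
  split_ifs <;> norm_num

theorem freeInterval_le {δ : ℝ} {s a b : Pt d} {lo hi : ℝ}
    (h : (freeInterval δ s a b).val = some (lo, hi)) : lo ≤ hi := by
  rw [freeInterval_val δ s a b rfl rfl rfl] at h
  split_ifs at h with h₁ h₂ h₃ h₄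
  · obtain ⟨rfl, rfl⟩ := by simpa using h
    exact zero_le_one
  · simp only [Option.some.injEq, Prod.mk.injEq] at h
    rw [← h.1, ← h.2]
    exact h₄

theorem freeInterval_spec {δ : ℝ} (hδ : 0 ≤ δ) (s a b : Pt d) (t : ℝ) :
    (∃ lo hi, (freeInterval δ s a b).val = some (lo, hi) ∧ lo ≤ t ∧ t ≤ hi) ↔
      t ∈ Icc (0 : ℝ) 1 ∧ dist (AffineMap.lineMap a b t) s ≤ δ := by
  rw [← sq_le_sq₀ dist_nonneg hδ, dist_lineMap_sq, freeInterval_val δ s a b rfl rfl rfl]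
  set A : ℝ := inner ℝ (b - a) (b - a) with hA
  set B : ℝ := inner ℝ (b - a) (a - s) with hB
  set W : ℝ := inner ℝ (a - s) (a - s) with hW
  by_cases hA0 : A = 0
  · have hB0 : B = 0 := by
      rw [hB, inner_self_eq_zero.mp hA0, inner_zero_left]
    have hC : A * t ^ 2 + 2 * B * t + W ≤ δ ^ 2 ↔ W - δ * δ ≤ 0 := by
      rw [hA0, hB0, sub_nonpos, sq]; simp [sq]
    rw [if_pos hA0, hC]
    split_ifs with h
    · constructor
      · rintro ⟨lo, hi, h', h1, h2⟩
        simp only [Option.some.injEq, Prod.mk.injEq] at h'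
        obtain ⟨rfl, rfl⟩ := h'
        exact ⟨⟨h1, h2⟩, h⟩
      · rintro ⟨⟨h1, h2⟩, -⟩
        exact ⟨0, 1, rfl, h1, h2⟩
    · simp [h]
  · have hApos : 0 < A := lt_of_le_of_ne real_inner_self_nonneg (Ne.symm hA0)
    -- Multiplication by `A > 0` and completion of the square.
    have hquad : A * t ^ 2 + 2 * B * t + W ≤ δ ^ 2 ↔
        (A * t + B) ^ 2 ≤ B * B - A * (W - δ * δ) := by
      constructor <;> intro h
      · have := mul_le_mul_of_nonneg_left h hApos.le
        nlinarith
      · refine le_of_mul_le_mul_left ?_ hApos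
        nlinarith
    rw [hquad, if_neg hA0]
    split_ifs with hD hne
    · have : ¬ (A * t + B) ^ 2 ≤ B * B - A * (W - δ * δ) := fun h =>
        absurd ((sq_nonneg _).trans h) (not_le.mpr hD)
      simp [this]
    all_goals
      have hD' : 0 ≤ B * B - A * (W - δ * δ) := not_lt.mp hD
      set r := Real.sqrt (B * B - A * (W - δ * δ)) with hr
      have hroot : (A * t + B) ^ 2 ≤ B * B - A * (W - δ * δ) ↔
          (-B - r) / A ≤ t ∧ t ≤ (-B + r) / A := by
        rw [← Real.sqrt_le_sqrt_iff hD', Real.sqrt_sq_eq_abs, ← hr, abs_le, div_le_iff₀ hApos,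
          le_div_iff₀ hApos]
        constructor <;> rintro ⟨h, h'⟩ <;> constructor <;> linarith
      rw [hroot]
      constructor
    · rintro ⟨lo, hi, h, h1, h2⟩
      simp only [Option.some.injEq, Prod.mk.injEq] at h
      obtain ⟨rfl, rfl⟩ := h
      rw [max_le_iff] at h1
      rw [le_min_iff] at h2
      exact ⟨⟨h1.1, h2.1⟩, h1.2, h2.2⟩
    · rintro ⟨⟨h1, h2⟩, h3, h4⟩
      exact ⟨_, _, rfl, max_le h1 h3, le_min h2 h4⟩
    · rintro ⟨lo, hi, h, -⟩
      simp at h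
    · rintro ⟨⟨h1, h2⟩, h3, h4⟩
      exact absurd ((max_le h1 h3).trans (le_min h2 h4)) hne

theorem exitSide_steps_le (I : Option (ℝ × ℝ)) (o a : Option ℝ) : (exitSide I o a).steps ≤ 6 := by
  rcases I with _ | ⟨lo, hi⟩ <;> rcases a with _ | a <;> rcases o with _ | o <;> simp [exitSide]
  split_ifs <;> norm_num

theorem exitSide_sound {I : Option (ℝ × ℝ)} {o a : Option ℝ} {x : ℝ}
    (hI : ∀ lo hi, I = some (lo, hi) → lo ≤ hi) (h : (exitSide I o a).val = some x) :
    (∃ lo hi, I = some (lo, hi) ∧ lo ≤ x ∧ x ≤ hi) ∧ (a.isSome ∨ ∃ l, o = some l ∧ l ≤ x) := by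
  rcases I with _ | ⟨lo, hi⟩
  · simp [exitSide] at h
  have hle := hI lo hi rfl
  rcases a with _ | a
  · rcases o with _ | l
    · simp [exitSide] at h
    · by_cases hx : max lo l ≤ hi
      · have h' : max lo l = x := by
          simpa [exitSide, op_bind_val, hx, -sup_le_iff] using h
        subst h'
        exact ⟨⟨_, _, rfl, le_max_left _ _, hx⟩, Or.inr ⟨l, rfl, le_max_right _ _⟩⟩
      · simp [exitSide, hx, -sup_le_iff] at h
  · simp [exitSide] at h
    subst h
    exact ⟨⟨_, _, rfl, le_rfl, hle⟩, by simp⟩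

theorem exitSide_complete {lo hi t : ℝ} {o a : Option ℝ} (h₀ : lo ≤ t) (h₁ : t ≤ hi)
    (h : a.isSome ∨ ∃ l, o = some l ∧ l ≤ t) :
    ∃ x ≤ t, (exitSide (some (lo, hi)) o a).val = some x := by
  rcases a with _ | a
  · obtain ⟨l, rfl, hl⟩ := by simpa using h
    have : lo ≤ hi ∧ l ≤ hi := ⟨h₀.trans h₁, hl.trans h₁⟩
    exact ⟨max lo l, max_le h₀ hl, by simp [exitSide, this]⟩
  · exact ⟨lo, h₀, by simp [exitSide]⟩

/-! ### Monotone chains in the free space -/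

namespace Curve

/-- The number of edges, where a curve with one vertex counts as having one edge. -/
def edges (P : Curve d) : ℕ := max P.size 2 - 1

variable (P : Curve d)

theorem edges_pos : 0 < P.edges := by unfold edges; omega

theorem edges_le_size : P.edges ≤ P.size := by
  have := P.size_pos
  unfold edges; omega

theorem size_le_edges_add_one : P.size ≤ P.edges + 1 := by unfold edges; omega

theorem lt_edges_iff {i : ℕ} : i + 1 < P.edges ↔ i + 2 < P.size := by
  have := P.size_pos
  unfold edges; omega

theorem size_sub_one_le_edges : (P.size : ℝ) - 1 ≤ P.edges := by
  have : (P.size : ℝ) ≤ P.edges + 1 := by exact_mod_cast P.size_le_edges_add_one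
  linarith

theorem eval_edges : P.eval P.edges = P.verts.getLast P.ne_nil :=
  P.eval_of_le P.size_sub_one_le_edges

end Curve

/-- The point `(x, y)` can be reached from `(0, 0)` by a chain of points of the `δ`-free space of
`S` and `T`, non-decreasing in both coordinates, of which any two consecutive ones belong to a
common cell. -/
inductive Reach (S T : Curve d) (δ : ℝ) : ℝ → ℝ → Prop
  | start : dist (S.eval 0) (T.eval 0) ≤ δ → Reach S T δ 0 0
  | step (i j : ℕ) {x y u v : ℝ} : Reach S T δ x y → (i : ℝ) ≤ x → x ≤ u → u ≤ i + 1 →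
      (j : ℝ) ≤ y → y ≤ v → v ≤ j + 1 → dist (S.eval u) (T.eval v) ≤ δ → Reach S T δ u v

/-- From the point `(x, y)` of the `δ`-free space of `S` and `T` the final corner can be reached by a
chain as in `Reach`. -/
inductive ReachesEnd (S T : Curve d) (δ : ℝ) : ℝ → ℝ → Prop
  | corner : dist (S.eval S.edges) (T.eval T.edges) ≤ δ → ReachesEnd S T δ S.edges T.edges
  | step (i j : ℕ) {x y x' y' : ℝ} : i < S.edges → j < T.edges → (i : ℝ) ≤ x → x ≤ x' →
      x' ≤ i + 1 → (j : ℝ) ≤ y → y ≤ y' → y' ≤ j + 1 → dist (S.eval x) (T.eval y) ≤ δ →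
      ReachesEnd S T δ x' y' → ReachesEnd S T δ x y

variable {S T : Curve d} {δ : ℝ}

namespace Reach

theorem free {x y : ℝ} (h : Reach S T δ x y) : dist (S.eval x) (T.eval y) ≤ δ := by
  cases h <;> assumption

theorem nonneg {x y : ℝ} (h : Reach S T δ x y) : 0 ≤ x ∧ 0 ≤ y := by
  induction h with
  | start => simp
  | step i j _ _ h _ _ h' _ _ ih => exact ⟨ih.1.trans h, ih.2.trans h'⟩

theorem swap {x y : ℝ} (h : Reach S T δ x y) : Reach T S δ y x := by
  induction h with
  | start h => exact start (by rwa [dist_comm])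
  | step i j _ h1 h2 h3 h4 h5 h6 h7 ih => exact step j i ih h4 h5 h6 h1 h2 h3 (by rwa [dist_comm])

end Reach

theorem MonoOnto.extend {f : ℝ → ℝ} {x x' : ℝ} (hf : MonoOnto f 1 x) (hx : 0 ≤ x) (h : x ≤ x') :
    MonoOnto (fun t => if t ≤ 1 / 2 then f (2 * t) else x + (2 * t - 1) * (x' - x)) 1 x' := by
  have h1 := hf.map_right hx
  refine ⟨fun s hs t ht hst => ?_, Subset.antisymm ?_ ?_⟩
  · simp only
    split_ifs with hs' ht' ht'
    · exact hf.1 ⟨by linarith [hs.1], by linarith⟩ ⟨by linarith [ht.1], by linarith⟩ (by linarith)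
    · have := (hf.mapsTo (x := 2 * s) ⟨by linarith [hs.1], by linarith⟩).2
      have : 0 ≤ (2 * t - 1) * (x' - x) := mul_nonneg (by linarith) (by linarith)
      linarith
    · linarith
    · have := mul_le_mul_of_nonneg_right (show 2 * s - 1 ≤ 2 * t - 1 by linarith)
        (show 0 ≤ x' - x by linarith)
      linarith
  · rintro _ ⟨t, ht, rfl⟩
    simp only
    split_ifs with ht'
    · have := hf.mapsTo (x := 2 * t) ⟨by linarith [ht.1], by linarith⟩
      exact ⟨this.1, this.2.trans h⟩
    · have h2 : 0 ≤ (2 * t - 1) * (x' - x) := mul_nonneg (by linarith) (by linarith)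
      have h3 : (2 * t - 1) * (x' - x) ≤ x' - x :=
        mul_le_of_le_one_left (by linarith) (by linarith [ht.2])
      exact ⟨by linarith, by linarith⟩
  · rintro y ⟨hy0, hy1⟩
    rcases le_or_gt y x with hyx | hyx
    · obtain ⟨t, ht, rfl⟩ := hf.exists_eq ⟨hy0, hyx⟩
      refine ⟨t / 2, ⟨by linarith [ht.1], by linarith [ht.2]⟩, ?_⟩
      simp only
      rw [if_pos (by linarith [ht.2])]
      congr 1; ring
    · have hpos : 0 < x' - x := by linarith
      have h2 : 0 < (y - x) / (x' - x) := div_pos (by linarith) hpos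
      have h3 : (y - x) / (x' - x) ≤ 1 := by rw [div_le_one hpos]; linarith
      refine ⟨(1 + (y - x) / (x' - x)) / 2, ⟨by linarith, by linarith⟩, ?_⟩
      simp only
      rw [if_neg (by linarith)]
      field_simp
      ring

theorem dist_eval_le_of_cell (i j : ℕ) {x y x' y' t : ℝ} (ht : t ∈ Icc (0 : ℝ) 1)
    (hx : (i : ℝ) ≤ x) (hxx : x ≤ x') (hx' : x' ≤ i + 1) (hy : (j : ℝ) ≤ y) (hyy : y ≤ y')
    (hy' : y' ≤ j + 1) (h : dist (S.eval x) (T.eval y) ≤ δ) (h' : dist (S.eval x') (T.eval y') ≤ δ) :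
    dist (S.eval (x + t * (x' - x))) (T.eval (y + t * (y' - y))) ≤ δ := by
  have key : ∀ (R : Curve d) (k : ℕ) (u u' : ℝ), (k : ℝ) ≤ u → u ≤ u' → u' ≤ k + 1 →
      R.eval (u + t * (u' - u)) = AffineMap.lineMap (R.eval u) (R.eval u') t := by
    intro R k u u' h1 h2 h3
    have h4 : 0 ≤ t * (u' - u) := mul_nonneg ht.1 (by linarith)
    have h5 : t * (u' - u) ≤ u' - u := mul_le_of_le_one_left (by linarith) ht.2
    rw [R.eval_eq_lineMap k h1 (by linarith), R.eval_eq_lineMap k (h1.trans h2) h3,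
      R.eval_eq_lineMap k (by linarith) (by linarith)]
    simp only [AffineMap.lineMap_apply_module]
    module
  rw [key S i x x' hx hxx hx', key T j y y' hy hyy hy']
  exact Curve.lineMap_dist_le h h' ht

theorem Reach.matched {x y : ℝ} (h : Reach S T δ x y) : Matched S T x y δ := by
  induction h with
  | start h =>
    have h0 : MonoOnto (fun _ => 0) 1 0 :=
      MonoOnto.of_continuousOn (monotoneOn_const) (by fun_prop) zero_le_one rfl rfl
    exact ⟨_, _, h0, h0, fun _ _ => h⟩
  | step i j hr h1 h2 h3 h4 h5 h6 h7 ih =>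
    obtain ⟨f, g, hf, hg, h⟩ := ih
    refine ⟨_, _, hf.extend hr.nonneg.1 h2, hg.extend hr.nonneg.2 h5, fun t ht => ?_⟩
    split_ifs with ht'
    · exact h _ ⟨by linarith [ht.1], by linarith⟩
    · exact dist_eval_le_of_cell i j ⟨by linarith, by linarith [ht.2]⟩ h1 h2 h3 h4 h5 h6 hr.free h7

/-- The two parameter domains differ only for a curve with one vertex, and clamping to the true
domain does not change the points. -/
theorem Matched.of_edges (h : Matched S T S.edges T.edges δ) :
    Matched S T (S.size - 1) (T.size - 1) δ := by
  obtain ⟨f, g, hf, hg, h⟩ := h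
  refine ⟨_, _, (MonoOnto.min_right S.one_le_size S.size_sub_one_le_edges).comp hf,
    (MonoOnto.min_right T.one_le_size T.size_sub_one_le_edges).comp hg, fun t ht => ?_⟩
  rw [S.eval_min, T.eval_min]
  exact h t ht

namespace Curve

/-- For a parameter of `P` before the end, the next vertex is at distance at most one; at the end
there is the last edge. -/
theorem exists_edge_of_mem (P : Curve d) {x : ℝ} (hx : x ∈ Icc (0 : ℝ) (P.size - 1)) :
    (∃ i : ℕ, i < P.edges ∧ (i : ℝ) ≤ x ∧ x < i + 1 ∧ (i : ℝ) + 1 ≤ P.size - 1) ∨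
      (x = P.size - 1 ∧ ∃ i : ℕ, i < P.edges ∧ (i : ℝ) ≤ x ∧ i + 1 = P.edges) := by
  have hp := P.size_pos
  rcases hx.2.lt_or_eq with h | h
  · left
    have h1 := Nat.floor_le hx.1
    have h2 : ⌊x⌋₊ + 1 < P.size := by
      have : (⌊x⌋₊ : ℝ) + 1 < P.size := by linarith
      exact_mod_cast this
    have h3 : ((⌊x⌋₊ + 1 : ℕ) : ℝ) + 1 ≤ P.size := by exact_mod_cast h2
    refine ⟨⌊x⌋₊, ?_, h1, Nat.lt_floor_add_one x, ?_⟩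
    · unfold edges; omega
    · push_cast at h3; linarith
  · right
    refine ⟨h, P.edges - 1, ?_, ?_, ?_⟩
    · have := P.edges_pos; omega
    · rw [h]
      have : P.edges - 1 ≤ P.size - 1 := by have := P.edges_le_size; omega
      have : ((P.edges - 1 : ℕ) : ℝ) ≤ (P.size - 1 : ℕ) := by exact_mod_cast this
      rwa [Nat.cast_sub (by omega : 1 ≤ P.size), Nat.cast_one] at this
    · have := P.edges_pos; omega

end Curve

/-- The matching is cut at the times when one of the parameters reaches its next integer;
consecutive cuts share a cell. A curve that has arrived at its last vertex stays in its last cell.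
-/
theorem reachesEnd_of_matched (h : Matched S T (S.size - 1) (T.size - 1) δ) :
    ReachesEnd S T δ 0 0 := by
  obtain ⟨f, g, hf, hg, h⟩ := h
  -- `N` bounds the number of integers that the two parameters can still cross.
  have key : ∀ N : ℕ, ∀ t ∈ Icc (0 : ℝ) 1, (S.size : ℝ) + T.size ≤ ⌊f t⌋₊ + ⌊g t⌋₊ + N →
      ReachesEnd S T δ (f t) (g t) := by
    intro N
    induction N with
    | zero =>
      intro t ht hN
      have h1 := Nat.floor_le (hf.mapsTo ht).1
      have h2 := Nat.floor_le (hg.mapsTo ht).1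
      have h3 := (hf.mapsTo ht).2
      have h4 := (hg.mapsTo ht).2
      push_cast at hN
      linarith
    | succ N ih =>
      intro t ht hN
      have next : ∀ s ∈ Icc (0 : ℝ) 1, ∀ i j : ℕ, i < S.edges → j < T.edges → t ≤ s →
          (i : ℝ) ≤ f t → f s ≤ i + 1 → (j : ℝ) ≤ g t → g s ≤ j + 1 →
          ((⌊f t⌋₊ : ℝ) + 1 ≤ f s ∨ (⌊g t⌋₊ : ℝ) + 1 ≤ g s) →
          ReachesEnd S T δ (f t) (g t) := by
        intro s hs i j hi hj hts h1 h2 h3 h4 h5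
        have hfm := hf.1 ht hs hts
        have hgm := hg.1 ht hs hts
        refine ReachesEnd.step i j hi hj h1 hfm h2 h3 hgm h4 (h t ht) (ih s hs ?_)
        have hfl : ⌊f t⌋₊ ≤ ⌊f s⌋₊ := Nat.floor_mono hfm
        have hgl : ⌊g t⌋₊ ≤ ⌊g s⌋₊ := Nat.floor_mono hgm
        have : ⌊f t⌋₊ + ⌊g t⌋₊ + 1 ≤ ⌊f s⌋₊ + ⌊g s⌋₊ := by
          rcases h5 with h5 | h5
          · have : ⌊f t⌋₊ + 1 ≤ ⌊f s⌋₊ := Nat.le_floor (by exact_mod_cast h5)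
            omega
          · have : ⌊g t⌋₊ + 1 ≤ ⌊g s⌋₊ := Nat.le_floor (by exact_mod_cast h5)
            omega
        have : (⌊f t⌋₊ : ℝ) + ⌊g t⌋₊ + 1 ≤ ⌊f s⌋₊ + ⌊g s⌋₊ := by exact_mod_cast this
        push_cast at hN
        linarith
      have hfl : ∀ {k : ℕ}, (k : ℝ) ≤ f t → f t < k + 1 → ⌊f t⌋₊ = k := fun h1 h2 =>
        (Nat.floor_eq_iff (hf.mapsTo ht).1).mpr ⟨h1, h2⟩
      have hgl : ∀ {k : ℕ}, (k : ℝ) ≤ g t → g t < k + 1 → ⌊g t⌋₊ = k := fun h1 h2 =>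
        (Nat.floor_eq_iff (hg.mapsTo ht).1).mpr ⟨h1, h2⟩
      rcases S.exists_edge_of_mem (hf.mapsTo ht) with
        ⟨i, hi, hi1, hi2, hi3⟩ | ⟨hx, i, hi, hi1, hi2⟩ <;>
      rcases T.exists_edge_of_mem (hg.mapsTo ht) with
        ⟨j, hj, hj1, hj2, hj3⟩ | ⟨hy, j, hj, hj1, hj2⟩
      · obtain ⟨s₁, hs₁, e₁⟩ := hf.exists_eq (y := i + 1) ⟨by positivity, hi3⟩
        obtain ⟨s₂, hs₂, e₂⟩ := hg.exists_eq (y := j + 1) ⟨by positivity, hj3⟩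
        have ht₁ : t ≤ s₁ := le_of_not_ge fun hh => by linarith [hf.1 hs₁ ht hh]
        have ht₂ : t ≤ s₂ := le_of_not_ge fun hh => by linarith [hg.1 hs₂ ht hh]
        rcases le_total s₁ s₂ with hle | hle
        · exact next s₁ hs₁ i j hi hj ht₁ hi1 e₁.le hj1 ((hg.1 hs₁ hs₂ hle).trans e₂.le)
            (Or.inl (by rw [hfl hi1 hi2, e₁]))
        · exact next s₂ hs₂ i j hi hj ht₂ hi1 ((hf.1 hs₂ hs₁ hle).trans e₁.le) hj1 e₂.le
            (Or.inr (by rw [hgl hj1 hj2, e₂]))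
      · obtain ⟨s₁, hs₁, e₁⟩ := hf.exists_eq (y := i + 1) ⟨by positivity, hi3⟩
        have ht₁ : t ≤ s₁ := le_of_not_ge fun hh => by linarith [hf.1 hs₁ ht hh]
        have hgs := (hg.mapsTo hs₁).2
        have := T.size_sub_one_le_edges
        have hj2' : (j : ℝ) + 1 = T.edges := by exact_mod_cast hj2
        exact next s₁ hs₁ i j hi hj ht₁ hi1 e₁.le hj1 (by linarith)
          (Or.inl (by rw [hfl hi1 hi2, e₁]))
      · obtain ⟨s₂, hs₂, e₂⟩ := hg.exists_eq (y := j + 1) ⟨by positivity, hj3⟩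
        have ht₂ : t ≤ s₂ := le_of_not_ge fun hh => by linarith [hg.1 hs₂ ht hh]
        have hfs := (hf.mapsTo hs₂).2
        have := S.size_sub_one_le_edges
        have hi2' : (i : ℝ) + 1 = S.edges := by exact_mod_cast hi2
        exact next s₂ hs₂ i j hi hj ht₂ hi1 (by linarith) hj1 e₂.le
          (Or.inr (by rw [hgl hj1 hj2, e₂]))
      -- Both curves have ended. The last step to the corner moves the parameter only for a curve
      -- with one vertex.
      · have hS := S.size_sub_one_le_edges
        have hT := T.size_sub_one_le_edges
        have hi2' : (i : ℝ) + 1 = S.edges := by exact_mod_cast hi2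
        have hj2' : (j : ℝ) + 1 = T.edges := by exact_mod_cast hj2
        refine ReachesEnd.step i j hi hj hi1 (by linarith) hi2'.ge hj1 (by linarith) hj2'.ge (h t ht)
          (ReachesEnd.corner ?_)
        have := h t ht
        rwa [hx, hy, S.eval_of_le le_rfl, T.eval_of_le le_rfl, ← S.eval_edges, ← T.eval_edges] at this
  have h0 := key (S.size + T.size) 0 (by simp) (by
    push_cast
    have : (0 : ℝ) ≤ ⌊f 0⌋₊ := by positivity
    have : (0 : ℝ) ≤ ⌊g 0⌋₊ := by positivity
    linarith)
  rwa [hf.map_zero S.one_le_size, hg.map_zero T.one_le_size] at h0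

end

end Frechet

namespace Frechet

noncomputable section

open Set

variable {d : ℕ} {S T : Curve d} {δ : ℝ}

/-! ### Correctness of the exploration -/

/-- The lowest reachable point of the top side of the cell of `e`, unless the cell is in the last
row. -/
def topExit (S T : Curve d) (δ : ℝ) (e : Entry) : Option ℝ :=
  if e.j + 2 < T.size then
    (exitSide (freeInterval δ (T.vertex (e.j + 1)) (S.vertex e.i) (S.vertex (e.i + 1))).val
      e.bottom e.left).val
  else none

/-- The lowest reachable point of the right side of the cell of `e`, unless the cell is in the last
column. -/
def rightExit (S T : Curve d) (δ : ℝ) (e : Entry) : Option ℝ :=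
  if e.i + 2 < S.size then
    (exitSide (freeInterval δ (S.vertex (e.i + 1)) (T.vertex e.j) (T.vertex (e.j + 1))).val
      e.left e.bottom).val
  else none

/-- The records that the exploration of the cell of `e` appends to the queue. -/
def successors (S T : Curve d) (δ : ℝ) (e : Entry) : List Entry :=
  ((topExit S T δ e).map fun x => ⟨e.i, e.j + 1, none, some x⟩).toList ++
    ((rightExit S T δ e).map fun y => ⟨e.i + 1, e.j, some y, none⟩).toList

theorem enqueue_val (q : List Entry) (lo : Option ℝ) (f : ℝ → Entry) :
    (enqueue q lo f).val = q ++ (lo.map f).toList := by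
  cases lo <;> simp [enqueue]

theorem enqueue_steps (q : List Entry) (lo : Option ℝ) (f : ℝ → Entry) :
    (enqueue q lo f).steps = 1 := by
  cases lo <;> simp [enqueue]

theorem popCell_steps_le (e : Entry) (q : List Entry) : (popCell e q).steps ≤ 3 := by
  rcases q with _ | ⟨e', q⟩
  · simp [popCell]
  · simp only [popCell, op_bind_steps, apply_ite Timed.steps, op_steps]
    split_ifs <;> norm_num

theorem explore_cons_val (k : ℕ) (e : Entry) (q : List Entry) :
    (explore S T δ (k + 1) (e :: q)).val =
      if ¬ (popCell e q).val.1.i + 2 < S.size ∧ ¬ (popCell e q).val.1.j + 2 < T.size ∧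
          dist (S.vertex ((popCell e q).val.1.i + 1)) (T.vertex ((popCell e q).val.1.j + 1)) ≤ δ then
        Answer.yes
      else (explore S T δ k ((popCell e q).val.2 ++ successors S T δ (popCell e q).val.1)).val := by
  rw [explore]
  simp only [Timed.bind_val]
  generalize (popCell e q).val = c
  obtain ⟨c, q'⟩ := c
  by_cases h1 : c.i + 2 < S.size <;> by_cases h2 : c.j + 2 < T.size
  · simp [h1, h2, successors, topExit, rightExit, enqueue_val]
  · simp [h1, h2, successors, topExit, rightExit, enqueue_val]
  · simp [h1, h2, successors, topExit, rightExit, enqueue_val]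
  · by_cases h3 : dist (S.vertex (c.i + 1)) (T.vertex (c.j + 1)) ≤ δ <;>
    simp [h1, h2, h3, successors, topExit, rightExit]

/-- One cell costs at most `3 + 4 + 2 + 2 * (23 + 6) + 2 = 69` steps: popping, four vertices, two
tests, two exits, two insertions. -/
theorem explore_steps_le (k : ℕ) (q : List Entry) :
    (explore S T δ k q).steps ≤ 70 * k + 1 := by
  induction k generalizing q with
  | zero => simp [explore]
  | succ k ih =>
    rcases q with _ | ⟨e, q⟩
    · simp [explore]
    · have hp := popCell_steps_le e q
      rw [explore]
      simp only [Timed.bind_steps]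
      generalize (popCell e q).val = c
      obtain ⟨c, q'⟩ := c
      have hq := ih q'
      have f1 := freeInterval_steps_le δ (T.vertex (c.j + 1)) (S.vertex c.i) (S.vertex (c.i + 1))
      have f2 := freeInterval_steps_le δ (S.vertex (c.i + 1)) (T.vertex c.j) (T.vertex (c.j + 1))
      have x1 := exitSide_steps_le (freeInterval δ (T.vertex (c.j + 1)) (S.vertex c.i)
        (S.vertex (c.i + 1))).val c.bottom c.left
      have x2 := exitSide_steps_le (freeInterval δ (S.vertex (c.i + 1)) (T.vertex c.j)
        (T.vertex (c.j + 1))).val c.left c.bottom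
      by_cases h1 : c.i + 2 < S.size <;> by_cases h2 : c.j + 2 < T.size
      on_goal 4 =>
        by_cases h3 : dist (S.vertex (c.i + 1)) (T.vertex (c.j + 1)) ≤ δ <;>
        simp [h1, h2, h3] <;> omega
      all_goals
        simp only [h1, h2, decide_true, decide_false, Bool.not_true, Bool.not_false,
          Bool.false_and, Bool.and_false, Bool.false_eq_true, if_false, if_true, Timed.bind_steps,
          enqueue_steps, op_steps, op_val]
        generalize hE : explore S T δ k _ = E
        have hE' : E.steps ≤ 70 * k + 1 := hE ▸ ih _
        omega

/-! ### The order of the queue and its preservation. -/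

namespace Entry

/-- The records that the exploration produces hold exactly one point, except for the first one. -/
def IsProper (a : Entry) : Prop :=
  (a.left.isSome ∧ a.bottom = none) ∨ (a.left = none ∧ a.bottom.isSome) ∨
    (a.i + a.j = 0 ∧ a.left.isSome)

/-- The order of the records in the queue. -/
def Before (a b : Entry) : Prop :=
  0 < b.i + b.j ∧ (a.i + a.j < b.i + b.j ∨ (a.i + a.j = b.i + b.j ∧
    (a.i < b.i ∨ (a.i = b.i ∧ a.left.isSome ∧ b.left = none))))

/-- The record `b` precedes everything that the exploration of the cell of `a` appends. -/
def Within (a b : Entry) : Prop :=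
  b.i + b.j ≤ a.i + a.j ∨ (b.i + b.j = a.i + a.j + 1 ∧
    (b.i < a.i ∨ (b.i = a.i ∧ b.left.isSome)))

/-- The cell of `b` comes strictly after that of `a`. -/
def CellLT (a b : Entry) : Prop :=
  a.i + a.j < b.i + b.j ∨ (a.i + a.j = b.i + b.j ∧ a.i < b.i)

/-- The points of the record are reachable. -/
structure IsSound (S T : Curve d) (δ : ℝ) (e : Entry) : Prop where
  i_lt : e.i < S.edges
  j_lt : e.j < T.edges
  left : ∀ y, e.left = some y → y ∈ Icc (0 : ℝ) 1 ∧ Reach S T δ e.i (e.j + y)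
  bottom : ∀ x, e.bottom = some x → x ∈ Icc (0 : ℝ) 1 ∧ Reach S T δ (e.i + x) e.j

/-- The point `(x, y)` of the cell of `e` is above one of the points of the record `e`. -/
structure Covers (e : Entry) (x y : ℝ) : Prop where
  i_le : (e.i : ℝ) ≤ x
  le_i : x ≤ e.i + 1
  j_le : (e.j : ℝ) ≤ y
  le_j : y ≤ e.j + 1
  above : (∃ l, e.left = some l ∧ e.j + l ≤ y) ∨ ∃ b, e.bottom = some b ∧ e.i + b ≤ x

end Entry

/-- The invariant of the queue. -/
structure QueueOrdered (q : List Entry) : Prop where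
  pairwise : q.Pairwise Entry.Before
  proper : ∀ a ∈ q, a.IsProper
  within : ∀ a ∈ q, ∀ b ∈ q, a.Within b

theorem mem_successors {e b : Entry} (h : b ∈ successors S T δ e) :
    (∃ x, topExit S T δ e = some x ∧ b = ⟨e.i, e.j + 1, none, some x⟩) ∨
      ∃ y, rightExit S T δ e = some y ∧ b = ⟨e.i + 1, e.j, some y, none⟩ := by
  rw [successors, List.mem_append] at h
  rcases h with h | h
  · left
    simpa [Option.mem_toList, eq_comm] using h
  · right
    simpa [Option.mem_toList, eq_comm] using h

theorem pairwise_successors (e : Entry) : (successors S T δ e).Pairwise Entry.Before := by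
  unfold successors
  rcases topExit S T δ e with _ | x <;> rcases rightExit S T δ e with _ | y <;>
    simp [Entry.Before]
  omega

/-- What `popCell` does with a queue that is in order. -/
structure PopSpec (e : Entry) (q : List Entry) (c : Entry) (q' : List Entry) : Prop where
  i_eq : c.i = e.i
  j_eq : c.j = e.j
  sublist : q'.Sublist q
  cell_lt : ∀ b ∈ q', c.CellLT b
  nonempty : c.left.isSome ∨ c.bottom.isSome
  left_eq : ∀ y, c.left = some y → ∃ b ∈ e :: q, b.i = c.i ∧ b.j = c.j ∧ b.left = some y
  bottom_eq : ∀ x, c.bottom = some x → ∃ b ∈ e :: q, b.i = c.i ∧ b.j = c.j ∧ b.bottom = some x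
  covers : ∀ b ∈ e :: q, ∀ x y, b.Covers x y → c.Covers x y ∨ b ∈ q'

/-- A cell has at most two records, one for each entry side, and the order makes them adjacent with
the left one first. Looking at one further record therefore suffices. The initial record is alone in
its cell. -/
theorem popCell_spec {e : Entry} {q : List Entry} (h : QueueOrdered (e :: q)) :
    PopSpec e q (popCell e q).val.1 (popCell e q).val.2 := by
  have he := h.proper e (by simp)
  have hne : e.left.isSome ∨ e.bottom.isSome := by
    rcases he with h | h | h
    · exact Or.inl h.1
    · exact Or.inr h.2
    · exact Or.inl h.2
  rcases q with _ | ⟨e', q⟩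
  · refine ⟨rfl, rfl, List.Sublist.refl _, by simp [popCell], hne, ?_, ?_, ?_⟩
    · intro y hy; exact ⟨e, by simp, rfl, rfl, hy⟩
    · intro y hy; exact ⟨e, by simp, rfl, rfl, hy⟩
    · intro b hb x y hc
      obtain rfl : b = e := by simpa using hb
      exact Or.inl hc
  have hpw := h.pairwise
  simp only [List.pairwise_cons] at hpw
  obtain ⟨hpe, hpe', -⟩ := hpw
  have hb := hpe e' (by simp)
  by_cases hsame : e.i = e'.i ∧ e.j = e'.j
  · have hv : (popCell e (e' :: q)).val =
        (⟨e.i, e.j, e.left.or e'.left, e.bottom.or e'.bottom⟩, q) := by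
      simp [popCell, hsame.1, hsame.2]
    obtain ⟨hpos, hb⟩ := hb
    have hl : e.left.isSome ∧ e'.left = none := by
      rcases hb with hb | ⟨-, hb | hb⟩
      · omega
      · omega
      · exact hb.2
    have hbot : e.bottom = none := by
      rcases he with h | h | h
      · exact h.2
      · rw [h.1] at hl; simp at hl
      · omega
    obtain ⟨l, hl'⟩ := Option.isSome_iff_exists.mp hl.1
    rw [hv]
    refine ⟨rfl, rfl, List.sublist_cons_self _ _, ?_, ?_, ?_, ?_, ?_⟩
    · intro b hb
      have h1 := (hpe' b hb).2
      have h2 := (hpe b (by simp [hb])).2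
      simp only [Entry.CellLT]
      rcases h1 with h1 | ⟨h1, h1 | h1⟩
      · left; omega
      · right; omega
      · rw [hl.2] at h1; simp at h1
    · simp [hl']
    · intro y hy
      simp [hl'] at hy
      exact ⟨e, by simp, rfl, rfl, by simp [hl', hy]⟩
    · intro x hx
      simp [hbot] at hx
      exact ⟨e', by simp, hsame.1.symm, hsame.2.symm, hx⟩
    · intro b hb x y hc
      rcases List.mem_cons.mp hb with rfl | hb
      · left
        refine ⟨hc.i_le, hc.le_i, hc.j_le, hc.le_j, ?_⟩
        rcases hc.above with ⟨l, h1, h2⟩ | ⟨l, h1, -⟩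
        · exact Or.inl ⟨l, by simp [h1], h2⟩
        · rw [hbot] at h1; simp at h1
      rcases List.mem_cons.mp hb with rfl | hb
      · left
        refine ⟨by simpa [hsame.1] using hc.i_le, by simpa [hsame.1] using hc.le_i,
          by simpa [hsame.2] using hc.j_le, by simpa [hsame.2] using hc.le_j, ?_⟩
        rcases hc.above with ⟨l, h1, h2⟩ | ⟨l, h1, h2⟩
        · rw [hl.2] at h1; simp at h1
        · exact Or.inr ⟨l, by simp [hbot, h1], by simpa [hsame.1] using h2⟩
      · exact Or.inr hb
  · have hv : (popCell e (e' :: q)).val = (e, e' :: q) := by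
      by_cases h1 : e.i = e'.i
      · simp [popCell, h1, show e.j ≠ e'.j from fun h2 => hsame ⟨h1, h2⟩]
      · simp [popCell, h1]
    rw [hv]
    refine ⟨rfl, rfl, List.Sublist.refl _, ?_, hne, ?_, ?_, ?_⟩
    · have h1 : e.CellLT e' := by
        rcases hb.2 with h1 | ⟨h1, h2 | h2⟩
        · exact Or.inl h1
        · exact Or.inr ⟨h1, h2⟩
        · exact absurd ⟨h2.1, by omega⟩ hsame
      intro b hb
      rcases List.mem_cons.mp hb with rfl | hb
      · exact h1
      · have h2 := (hpe' b hb).2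
        simp only [Entry.CellLT] at *
        omega
    · intro y hy; exact ⟨e, by simp, rfl, rfl, hy⟩
    · intro y hy; exact ⟨e, by simp, rfl, rfl, hy⟩
    · intro b hb x y hc
      rcases List.mem_cons.mp hb with rfl | hb
      · exact Or.inl hc
      · exact Or.inr hb

theorem PopSpec.cell_lt_append {e c : Entry} {q q' : List Entry} (hp : PopSpec e q c q') {b : Entry}
    (hb : b ∈ q' ++ successors S T δ c) : c.CellLT b := by
  rcases List.mem_append.mp hb with hb | hb
  · exact hp.cell_lt b hb
  · rcases mem_successors hb with ⟨x, -, rfl⟩ | ⟨x, -, rfl⟩ <;> left <;> simp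

/-- Every waiting record is on the antidiagonal of `c` or on the next one, and there ahead of the
successors of `c`. So appending at the end keeps the order without any sorting. -/
theorem PopSpec.queueOrdered {e c : Entry} {q q' : List Entry} (hp : PopSpec e q c q')
    (h : QueueOrdered (e :: q)) : QueueOrdered (q' ++ successors S T δ c) := by
  have hsub : ∀ b ∈ q', b ∈ e :: q := fun b hb => List.mem_cons_of_mem _ (hp.sublist.subset hb)
  have hwin : ∀ b ∈ q', c.Within b := fun b hb => by
    have := h.within e (by simp) b (hsub b hb)
    simpa only [Entry.Within, hp.i_eq, hp.j_eq] using this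
  refine ⟨?_, ?_, ?_⟩
  · refine List.pairwise_append.mpr ⟨?_, pairwise_successors c, ?_⟩
    · have := h.pairwise
      rw [List.pairwise_cons] at this
      exact this.2.sublist hp.sublist
    · intro a ha b hb
      have h1 := hwin a ha
      rcases mem_successors hb with ⟨x, -, rfl⟩ | ⟨x, -, rfl⟩
      · refine ⟨by simp, ?_⟩
        rcases h1 with h1 | ⟨h1, h2 | h2⟩
        · left; simp only; omega
        · right; exact ⟨by simp only; omega, Or.inl h2⟩
        · right; exact ⟨by simp only; omega, Or.inr ⟨h2.1, h2.2, rfl⟩⟩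
      · refine ⟨by simp, ?_⟩
        rcases h1 with h1 | ⟨h1, h2⟩
        · left; simp only; omega
        · right; exact ⟨by simp only; omega, Or.inl (by simp only; omega)⟩
  · intro a ha
    rcases List.mem_append.mp ha with ha | ha
    · exact h.proper a (hsub a ha)
    · rcases mem_successors ha with ⟨x, -, rfl⟩ | ⟨x, -, rfl⟩
      · exact Or.inr (Or.inl (by simp))
      · exact Or.inl (by simp)
  · intro a ha b hb
    have hlt := hp.cell_lt_append ha
    rcases List.mem_append.mp hb with hb | hb
    · rcases List.mem_append.mp ha with ha | ha
      · exact h.within a (hsub a ha) b (hsub b hb)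
      · have := hwin b hb
        rcases mem_successors ha with ⟨x, -, rfl⟩ | ⟨x, -, rfl⟩ <;>
          simp only [Entry.Within] at * <;> omega
    · simp only [Entry.CellLT] at hlt
      rcases mem_successors hb with ⟨x, -, rfl⟩ | ⟨x, -, rfl⟩
      · simp only [Entry.Within]; omega
      · simp only [Entry.Within, Option.isSome_some, and_true]; omega

/-! ### Soundness: recorded points are reachable. -/

theorem topExit_sound (hδ : 0 ≤ δ) {e : Entry} (he : e.IsSound S T δ) {x : ℝ}
    (h : topExit S T δ e = some x) :
    Entry.IsSound S T δ ⟨e.i, e.j + 1, none, some x⟩ := by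
  unfold topExit at h
  split_ifs at h with hT
  obtain ⟨⟨lo, hi, hI, h1, h2⟩, h3⟩ := exitSide_sound (fun lo hi h => freeInterval_le h) h
  obtain ⟨hx, hd⟩ := (freeInterval_spec hδ _ _ _ x).mp ⟨lo, hi, hI, h1, h2⟩
  have hfree : dist (S.eval (e.i + x)) (T.eval (e.j + 1 : ℕ)) ≤ δ := by
    rw [S.eval_eq_lineMap e.i (by linarith [hx.1]) (by linarith [hx.2]), T.eval_natCast]
    simpa using hd
  refine ⟨he.i_lt, T.lt_edges_iff.mpr hT, by simp, ?_⟩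
  intro x' hx'
  obtain rfl : x = x' := by simpa using hx'
  refine ⟨hx, ?_⟩
  rcases h3 with h3 | ⟨l, h3, h4⟩
  · obtain ⟨y, hy⟩ := Option.isSome_iff_exists.mp h3
    obtain ⟨hy1, hy2⟩ := he.left y hy
    exact hy2.step e.i e.j le_rfl (by linarith [hx.1]) (by linarith [hx.2]) (by linarith [hy1.1])
      (by push_cast; linarith [hy1.2]) (by push_cast; rfl) hfree
  · obtain ⟨hl1, hl2⟩ := he.bottom l h3
    exact hl2.step e.i e.j (by linarith [hl1.1]) (by linarith) (by linarith [hx.2]) le_rfl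
      (by push_cast; linarith) (by push_cast; rfl) hfree

theorem rightExit_sound (hδ : 0 ≤ δ) {e : Entry} (he : e.IsSound S T δ) {y : ℝ}
    (h : rightExit S T δ e = some y) :
    Entry.IsSound S T δ ⟨e.i + 1, e.j, some y, none⟩ := by
  unfold rightExit at h
  split_ifs at h with hS
  obtain ⟨⟨lo, hi, hI, h1, h2⟩, h3⟩ := exitSide_sound (fun lo hi h => freeInterval_le h) h
  obtain ⟨hy, hd⟩ := (freeInterval_spec hδ _ _ _ y).mp ⟨lo, hi, hI, h1, h2⟩
  have hfree : dist (S.eval (e.i + 1 : ℕ)) (T.eval (e.j + y)) ≤ δ := by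
    rw [T.eval_eq_lineMap e.j (by linarith [hy.1]) (by linarith [hy.2]), S.eval_natCast, dist_comm]
    simpa using hd
  refine ⟨S.lt_edges_iff.mpr hS, he.j_lt, ?_, by simp⟩
  intro y' hy'
  obtain rfl : y = y' := by simpa using hy'
  refine ⟨hy, ?_⟩
  rcases h3 with h3 | ⟨l, h3, h4⟩
  · obtain ⟨x, hx⟩ := Option.isSome_iff_exists.mp h3
    obtain ⟨hx1, hx2⟩ := he.bottom x hx
    exact hx2.step e.i e.j (by linarith [hx1.1]) (by push_cast; linarith [hx1.2])
      (by push_cast; rfl) le_rfl (by linarith [hy.1]) (by linarith [hy.2]) hfree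
  · obtain ⟨hl1, hl2⟩ := he.left l h3
    exact hl2.step e.i e.j le_rfl (by push_cast; linarith) (by push_cast; rfl) (by linarith [hl1.1])
      (by linarith) (by linarith [hy.2]) hfree

theorem PopSpec.isSound {e c : Entry} {q q' : List Entry} (hp : PopSpec e q c q')
    (h : ∀ b ∈ e :: q, b.IsSound S T δ) : c.IsSound S T δ := by
  have he := h e (by simp)
  refine ⟨hp.i_eq ▸ he.i_lt, hp.j_eq ▸ he.j_lt, fun y hy => ?_, fun x hx => ?_⟩
  · obtain ⟨b, hb, h1, h2, h3⟩ := hp.left_eq y hy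
    rw [← h1, ← h2]
    exact (h b hb).left y h3
  · obtain ⟨b, hb, h1, h2, h3⟩ := hp.bottom_eq x hx
    rw [← h1, ← h2]
    exact (h b hb).bottom x h3

theorem PopSpec.isSound_append (hδ : 0 ≤ δ) {e c : Entry} {q q' : List Entry} (hp : PopSpec e q c q')
    (h : ∀ b ∈ e :: q, b.IsSound S T δ) :
    ∀ b ∈ q' ++ successors S T δ c, b.IsSound S T δ := by
  intro b hb
  rcases List.mem_append.mp hb with hb | hb
  · exact h b (List.mem_cons_of_mem _ (hp.sublist.subset hb))
  · rcases mem_successors hb with ⟨x, hx, rfl⟩ | ⟨x, hx, rfl⟩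
    · exact topExit_sound hδ (hp.isSound h) hx
    · exact rightExit_sound hδ (hp.isSound h) hx

theorem reach_corner_of_explore_yes (hδ : 0 ≤ δ) {k : ℕ} {q : List Entry} (hq : QueueOrdered q)
    (hs : ∀ b ∈ q, b.IsSound S T δ) (h : (explore S T δ k q).val = Answer.yes) :
    Reach S T δ S.edges T.edges := by
  induction k generalizing q with
  | zero => simp [explore] at h
  | succ k ih =>
    rcases q with _ | ⟨e, q⟩
    · simp [explore] at h
    rw [explore_cons_val] at h
    have hp := popCell_spec hq
    generalize (popCell e q).val = c at h hp
    obtain ⟨c, q'⟩ := c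
    simp only at h hp
    split_ifs at h with hf
    · have hc := hp.isSound hs
      obtain ⟨h1, h2, h3⟩ := hf
      have hi : c.i + 1 = S.edges := by
        have := hc.i_lt
        have := S.lt_edges_iff (i := c.i)
        omega
      have hj : c.j + 1 = T.edges := by
        have := hc.j_lt
        have := T.lt_edges_iff (i := c.j)
        omega
      rw [← S.eval_natCast, ← T.eval_natCast, hi, hj] at h3
      have hi' : (c.i : ℝ) + 1 = S.edges := by exact_mod_cast hi
      have hj' : (c.j : ℝ) + 1 = T.edges := by exact_mod_cast hj
      rcases hp.nonempty with hl | hb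
      · obtain ⟨y, hy⟩ := Option.isSome_iff_exists.mp hl
        obtain ⟨hy1, hy2⟩ := hc.left y hy
        exact hy2.step c.i c.j le_rfl (by linarith) hi'.ge (by linarith [hy1.1])
          (by linarith [hy1.2]) hj'.ge h3
      · obtain ⟨x, hx⟩ := Option.isSome_iff_exists.mp hb
        obtain ⟨hx1, hx2⟩ := hc.bottom x hx
        exact hx2.step c.i c.j (by linarith [hx1.1]) (by linarith [hx1.2]) hi'.ge le_rfl
          (by linarith) hj'.ge h3
    · exact ih (hp.queueOrdered hq) (hp.isSound_append hδ hs) h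

/-! ### Completeness: chains to the final corner are not lost. -/

theorem exists_successor_covers_top (hδ : 0 ≤ δ) {c : Entry} {x y : ℝ} (hc : c.Covers x y)
    (hy : y = c.j + 1) (hj : c.j + 1 < T.edges) (hd : dist (S.eval x) (T.eval y) ≤ δ) :
    ∃ b ∈ successors S T δ c, b.Covers x y := by
  have hT := T.lt_edges_iff.mp hj
  have hy' : y = (c.j + 1 : ℕ) := by push_cast; exact hy
  rw [S.eval_eq_lineMap c.i hc.i_le hc.le_i, hy', T.eval_natCast] at hd
  obtain ⟨lo, hi, hI, h1, h2⟩ := (freeInterval_spec hδ (T.vertex (c.j + 1)) (S.vertex c.i)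
    (S.vertex (c.i + 1)) (x - c.i)).mpr ⟨⟨by linarith [hc.i_le], by linarith [hc.le_i]⟩, hd⟩
  obtain ⟨t, ht, htv⟩ := exitSide_complete (o := c.bottom) (a := c.left) h1 h2 (by
    rcases hc.above with ⟨l, h3, -⟩ | ⟨l, h3, h4⟩
    · left; simp [h3]
    · right; exact ⟨l, h3, by linarith⟩)
  have htop : topExit S T δ c = some t := by
    rw [topExit, if_pos hT, hI, htv]
  refine ⟨⟨c.i, c.j + 1, none, some t⟩, by simp [successors, htop], hc.i_le, hc.le_i, ?_, ?_,
    Or.inr ⟨t, rfl, ?_⟩⟩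
  · simp [hy]
  · simp [hy]
  · simp only; linarith

theorem exists_successor_covers_right (hδ : 0 ≤ δ) {c : Entry} {x y : ℝ} (hc : c.Covers x y)
    (hx : x = c.i + 1) (hi : c.i + 1 < S.edges) (hd : dist (S.eval x) (T.eval y) ≤ δ) :
    ∃ b ∈ successors S T δ c, b.Covers x y := by
  have hS := S.lt_edges_iff.mp hi
  have hx' : x = (c.i + 1 : ℕ) := by push_cast; exact hx
  rw [T.eval_eq_lineMap c.j hc.j_le hc.le_j, hx', S.eval_natCast, dist_comm] at hd
  obtain ⟨lo, hi, hI, h1, h2⟩ := (freeInterval_spec hδ (S.vertex (c.i + 1)) (T.vertex c.j)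
    (T.vertex (c.j + 1)) (y - c.j)).mpr ⟨⟨by linarith [hc.j_le], by linarith [hc.le_j]⟩, hd⟩
  obtain ⟨t, ht, htv⟩ := exitSide_complete (o := c.left) (a := c.bottom) h1 h2 (by
    rcases hc.above with ⟨l, h3, h4⟩ | ⟨l, h3, -⟩
    · right; exact ⟨l, h3, by linarith⟩
    · left; simp [h3])
  have hright : rightExit S T δ c = some t := by
    rw [rightExit, if_pos hS, hI, htv]
  refine ⟨⟨c.i + 1, c.j, some t, none⟩, by simp [successors, hright], ?_, ?_, hc.j_le, hc.le_j,
    Or.inl ⟨t, rfl, ?_⟩⟩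
  · simp [hx]
  · simp [hx]
  · simp only; linarith

/-- A chain to the final corner that starts in the cell of `c` ends there or leaves the cell through
one of the exits. -/
theorem ReachesEnd.exists_exit (hδ : 0 ≤ δ) {c : Entry} {x y : ℝ} (h : ReachesEnd S T δ x y)
    (hc : c.Covers x y) :
    (¬ c.i + 2 < S.size ∧ ¬ c.j + 2 < T.size ∧
      dist (S.vertex (c.i + 1)) (T.vertex (c.j + 1)) ≤ δ) ∨
    ∃ x' y', ReachesEnd S T δ x' y' ∧ ∃ b ∈ successors S T δ c, b.Covers x' y' := by
  induction h with
  | corner h =>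
    left
    have h1 : S.edges ≤ c.i + 1 := by exact_mod_cast hc.le_i
    have h2 : T.edges ≤ c.j + 1 := by exact_mod_cast hc.le_j
    have h3 := S.size_le_edges_add_one
    have h4 := T.size_le_edges_add_one
    refine ⟨by omega, by omega, ?_⟩
    rwa [S.vertex_of_le (by omega), T.vertex_of_le (by omega), ← S.eval_edges, ← T.eval_edges]
  | @step i j x y x' y' hi hj h1 h2 h3 h4 h5 h6 h7 h ih =>
    by_cases hx : x' ≤ c.i + 1
    · by_cases hy : y' ≤ c.j + 1
      · refine ih ⟨hc.i_le.trans h2, hx, hc.j_le.trans h5, hy, ?_⟩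
        rcases hc.above with ⟨l, h8, h9⟩ | ⟨l, h8, h9⟩
        · exact Or.inl ⟨l, h8, h9.trans h5⟩
        · exact Or.inr ⟨l, h8, h9.trans h2⟩
      -- The cell shared by the two chain points is above that of `c`, so `y ≥ j ≥ c.j + 1`, and
      -- `(x, y)` itself lies on the top side.
      · have hcj : c.j < j := by
          have : (c.j : ℝ) < j := by linarith
          exact_mod_cast this
        have hcj' : (c.j : ℝ) + 1 ≤ j := by exact_mod_cast hcj
        exact Or.inr ⟨x, y, ReachesEnd.step i j hi hj h1 h2 h3 h4 h5 h6 h7 h,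
          exists_successor_covers_top hδ hc (by linarith [hc.le_j]) (by omega) h7⟩
    · have hci : c.i < i := by
        have : (c.i : ℝ) < i := by linarith
        exact_mod_cast this
      have hci' : (c.i : ℝ) + 1 ≤ i := by exact_mod_cast hci
      exact Or.inr ⟨x, y, ReachesEnd.step i j hi hj h1 h2 h3 h4 h5 h6 h7 h,
        exists_successor_covers_right hδ hc (by linarith [hc.le_i]) (by omega) h7⟩

/-- If some record covers a point from which the end can be reached, then after each step that does
not answer "yes" another record does. The queue thus never runs empty. -/
theorem not_reachesEnd_of_explore_no (hδ : 0 ≤ δ) {k : ℕ} {q : List Entry} (hq : QueueOrdered q)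
    (h : (explore S T δ k q).val = Answer.no) {b : Entry} (hb : b ∈ q) {x y : ℝ}
    (hc : b.Covers x y) : ¬ ReachesEnd S T δ x y := by
  induction k generalizing q b x y with
  | zero => simp [explore] at h
  | succ k ih =>
    rcases q with _ | ⟨e, q⟩
    · simp at hb
    rw [explore_cons_val] at h
    have hp := popCell_spec hq
    generalize (popCell e q).val = c at h hp
    obtain ⟨c, q'⟩ := c
    simp only at h hp
    split_ifs at h with hf
    intro hend
    rcases hp.covers b hb x y hc with hc | hb
    · rcases hend.exists_exit hδ hc with h1 | ⟨x', y', h1, b', hb', hc'⟩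
      · exact hf h1
      · exact ih (hp.queueOrdered hq) h (List.mem_append_right _ hb') hc' h1
    · exact ih (hp.queueOrdered hq) h (List.mem_append_left _ hb) hc hend

/-- The cell `p` has a reachable point on its left or on its bottom side. -/
def ReachableCell (S T : Curve d) (δ : ℝ) (p : ℕ × ℕ) : Prop :=
  p.1 < S.edges ∧ p.2 < T.edges ∧
    ((∃ y ∈ Icc (p.2 : ℝ) (p.2 + 1), Reach S T δ p.1 y) ∨
      ∃ x ∈ Icc (p.1 : ℝ) (p.1 + 1), Reach S T δ x p.2)

/-- The explored cells strictly increase in the cell order, hence are distinct. The second conjunct,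
that each one is no earlier than some record of the queue, carries this through the induction. -/
theorem exists_reachableCells_of_explore_timeout (hδ : 0 ≤ δ) {k : ℕ} {q : List Entry}
    (hq : QueueOrdered q) (hs : ∀ b ∈ q, b.IsSound S T δ)
    (h : (explore S T δ k q).val = Answer.timeout) :
    ∃ A : Finset (ℕ × ℕ), A.card = k ∧ ∀ p ∈ A, ReachableCell S T δ p ∧
      ∃ b ∈ q, b.i + b.j < p.1 + p.2 ∨ (b.i + b.j = p.1 + p.2 ∧ b.i ≤ p.1) := by
  induction k generalizing q with
  | zero => exact ⟨∅, rfl, by simp⟩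
  | succ k ih =>
    rcases q with _ | ⟨e, q⟩
    · simp [explore] at h
    rw [explore_cons_val] at h
    have hp := popCell_spec hq
    generalize (popCell e q).val = c at h hp
    obtain ⟨c, q'⟩ := c
    simp only at h hp
    split_ifs at h with hf
    obtain ⟨A, hA, hA'⟩ := ih (hp.queueOrdered hq) (hp.isSound_append hδ hs) h
    have hlt : ∀ p ∈ A, c.i + c.j < p.1 + p.2 ∨ (c.i + c.j = p.1 + p.2 ∧ c.i < p.1) := by
      intro p hpA
      obtain ⟨-, b, hb, hbp⟩ := hA' p hpA
      have := hp.cell_lt_append hb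
      simp only [Entry.CellLT] at this
      omega
    have hnot : (c.i, c.j) ∉ A := fun hmem => by
      have := hlt _ hmem
      simp at this
    refine ⟨insert (c.i, c.j) A, by rw [Finset.card_insert_of_notMem hnot, hA], ?_⟩
    intro p hpA
    rcases Finset.mem_insert.mp hpA with rfl | hpA
    · have hc := hp.isSound hs
      refine ⟨⟨hc.i_lt, hc.j_lt, ?_⟩, e, by simp, Or.inr ⟨?_, hp.i_eq.ge⟩⟩
      · rcases hp.nonempty with hl | hb
        · obtain ⟨y, hy⟩ := Option.isSome_iff_exists.mp hl
          obtain ⟨hy1, hy2⟩ := hc.left y hy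
          exact Or.inl ⟨c.j + y, ⟨by linarith [hy1.1], by linarith [hy1.2]⟩, hy2⟩
        · obtain ⟨x, hx⟩ := Option.isSome_iff_exists.mp hb
          obtain ⟨hx1, hx2⟩ := hc.bottom x hx
          exact Or.inr ⟨c.i + x, ⟨by linarith [hx1.1], by linarith [hx1.2]⟩, hx2⟩
      · simp [hp.i_eq, hp.j_eq]
    · refine ⟨(hA' p hpA).1, e, by simp, ?_⟩
      have := hlt p hpA
      have := hp.i_eq
      have := hp.j_eq
      omega

theorem startQueue_val (S T : Curve d) (δ : ℝ) : (startQueue S T δ).val =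
    if dist (S.vertex 0) (T.vertex 0) ≤ δ then [⟨0, 0, some 0, some 0⟩] else [] := by
  simp only [startQueue, op_bind_val, apply_ite Timed.val, op_val, decide_eq_true_eq]

theorem startQueue_steps (S T : Curve d) (δ : ℝ) : (startQueue S T δ).steps = 5 := by
  simp only [startQueue, op_bind_steps, apply_ite Timed.steps, op_steps, ite_self]

theorem queueOrdered_startQueue : QueueOrdered (startQueue S T δ).val := by
  rw [startQueue_val]
  split_ifs
  · refine ⟨by simp, ?_, ?_⟩
    · intro a ha
      obtain rfl := List.mem_singleton.mp ha
      exact Or.inr (Or.inr (by simp))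
    · intro a ha b hb
      obtain rfl := List.mem_singleton.mp ha
      obtain rfl := List.mem_singleton.mp hb
      exact Or.inl le_rfl
  · exact ⟨by simp, by simp, by simp⟩

theorem isSound_startQueue : ∀ b ∈ (startQueue S T δ).val, b.IsSound S T δ := by
  rw [startQueue_val]
  split_ifs with h
  · intro b hb
    obtain rfl := List.mem_singleton.mp hb
    have h0 : Reach S T δ 0 0 := by
      refine Reach.start ?_
      rw [← S.eval_natCast, ← T.eval_natCast] at h
      simpa using h
    refine ⟨S.edges_pos, T.edges_pos, ?_, ?_⟩
    · intro y hy
      obtain rfl : 0 = y := by simpa using hy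
      simpa using h0
    · intro x hx
      obtain rfl : 0 = x := by simpa using hx
      simpa using h0
  · simp

theorem ReachesEnd.free {x y : ℝ} (h : ReachesEnd S T δ x y) : dist (S.eval x) (T.eval y) ≤ δ := by
  cases h <;> assumption

theorem not_reachesEnd_of_start_no (hδ : 0 ≤ δ) {k : ℕ}
    (h : (explore S T δ k (startQueue S T δ).val).val = Answer.no) : ¬ ReachesEnd S T δ 0 0 := by
  intro hend
  have hfree := hend.free
  rw [← Nat.cast_zero, S.eval_natCast, T.eval_natCast] at hfree
  refine not_reachesEnd_of_explore_no hδ queueOrdered_startQueue h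
    (b := ⟨0, 0, some 0, some 0⟩) ?_ ?_ hend
  · rw [startQueue_val, if_pos hfree]; simp
  · refine ⟨by simp, by simp, by simp, by simp, Or.inl ⟨0, rfl, by simp⟩⟩

end

end Frechet

namespace Frechet

noncomputable section

open Set

variable {d : ℕ} {P S T : Curve d} {ρ : ℕ → ℕ} {c δ μ : ℝ}

/-! ### Counting the reachable cells -/

theorem card_le_of_fibers (A : Finset (ℕ × ℕ)) (f : ℕ × ℕ → ℕ) (n : ℕ) (b : ℝ)
    (hn : ∀ p ∈ A, f p < n) (hb : ∀ j < n, ((A.filter fun p => f p = j).card : ℝ) ≤ b) :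
    (A.card : ℝ) ≤ n * b := by
  rw [Finset.card_eq_sum_card_fiberwise (t := Finset.range n) (f := f)
    (fun p hp => by simpa using hn p hp)]
  push_cast
  calc ∑ j ∈ Finset.range n, ((A.filter fun p => f p = j).card : ℝ)
      ≤ (Finset.range n).card • b :=
        Finset.sum_le_card_nsmul _ _ _ fun j hj => hb j (by simpa using hj)
    _ = n * b := by simp

/-- The summand `1` allows for the artificial edge of a simplification with one vertex. -/
theorem IsSimplification.card_near_le (h : IsSimplification μ P S ρ) (hP : P.IsPacked c) {z : Pt d}
    {r : ℝ} (hr : 0 ≤ r) (A : Finset ℕ) (hA : ∀ k ∈ A, k < S.edges)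
    (hz : ∀ k ∈ A, ∃ t ∈ Icc (0 : ℝ) 1,
      dist (AffineMap.lineMap (S.vertex k) (S.vertex (k + 1)) t) z ≤ r) :
    (A.card : ℝ) ≤ c * (r + 4 * μ) / μ + 1 := by
  have hμ : 0 < μ := dist_nonneg.trans_lt (h.near 0 P.size_pos)
  have h1 := h.card_edges_le hP hr (A.filter fun k => k + 1 < S.size)
    (fun k hk => (Finset.mem_filter.mp hk).2) (fun k hk => hz k (Finset.mem_filter.mp hk).1)
  rw [← le_div_iff₀ hμ] at h1
  have h2 : A ⊆ insert 0 (A.filter fun k => k + 1 < S.size) := by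
    intro k hk
    have := hA k hk
    have := S.size_pos
    rw [Finset.mem_insert, Finset.mem_filter]
    unfold Curve.edges at *
    by_cases hs : k + 1 < S.size
    · exact Or.inr ⟨hk, hs⟩
    · left; omega
  have h3 := (Finset.card_le_card h2).trans (Finset.card_insert_le _ _)
  have h4 : (A.card : ℝ) ≤ (A.filter fun k => k + 1 < S.size).card + 1 := by exact_mod_cast h3
  linarith

/-- A chain in the free space of `S` and `T` yields a monotone matching of the part of `T` with
points of `P`. -/
theorem IsSimplification.exists_lift (h : IsSimplification μ P S ρ) {x y : ℝ}
    (hr : Reach S T δ x y) :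
    ∃ X : ℝ → ℝ, MonotoneOn X (Icc 0 y) ∧ ∀ v ∈ Icc 0 y,
      X v ∈ Icc (0 : ℝ) (P.size - 1) ∧ dist (P.eval (X v)) (T.eval v) ≤ μ + δ := by
  obtain ⟨f, g, hf, hg, hd⟩ := hr.matched
  have hσ := h.reparam_monoOnto
  -- Right inverses of monotone surjections are monotone. They may jump, but continuity of `X` is
  -- not needed. The `min` below is there because a chain may run past the end of `S`.
  have hτ : ∀ v ∈ Icc 0 y, ∃ t ∈ Icc (0 : ℝ) 1, g t = v := fun v hv => hg.exists_eq hv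
  choose! τ hτ1 hτ2 using hτ
  have hι : ∀ u ∈ Icc (0 : ℝ) (S.size - 1), ∃ w ∈ Icc (0 : ℝ) (P.size - 1),
      IsSimplification.reparam ρ w = u := fun u hu => hσ.exists_eq hu
  choose! ι hι1 hι2 using hι
  have hmem : ∀ v ∈ Icc 0 y, min (f (τ v)) ((S.size : ℝ) - 1) ∈ Icc (0 : ℝ) (S.size - 1) :=
    fun v hv => ⟨le_min (hf.mapsTo (hτ1 v hv)).1 S.one_le_size, min_le_right _ _⟩
  refine ⟨fun v => ι (min (f (τ v)) ((S.size : ℝ) - 1)), ?_, fun v hv => ⟨hι1 _ (hmem v hv), ?_⟩⟩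
  · intro v hv v' hv' hvv
    by_contra! hlt
    have h1 := hσ.1 (hι1 _ (hmem v' hv')) (hι1 _ (hmem v hv)) hlt.le
    rw [hι2 _ (hmem v hv), hι2 _ (hmem v' hv')] at h1
    have h2 : min (f (τ v)) ((S.size : ℝ) - 1) ≤ min (f (τ v')) ((S.size : ℝ) - 1) := by
      rcases hvv.eq_or_lt with rfl | hvv
      · exact le_rfl
      · refine min_le_min_right _ (hf.1 (hτ1 v hv) (hτ1 v' hv') (le_of_not_ge fun hh => ?_))
        have := hg.1 (hτ1 v' hv') (hτ1 v hv) hh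
        rw [hτ2 v hv, hτ2 v' hv'] at this
        linarith
    simp only [le_antisymm h1 h2, lt_irrefl] at hlt
  · have h1 := h.dist_eval_reparam_le (fun l hl => (h.near l hl).le) (hι1 _ (hmem v hv))
    rw [hι2 _ (hmem v hv), S.eval_min] at h1
    have h2 := hd _ (hτ1 v hv)
    rw [hτ2 v hv] at h2
    exact (dist_triangle _ _ _).trans (add_le_add h1 h2)

/-- Few long edges of `T` can be reached from a given vertex of a simplification of a packed
curve. -/
theorem IsSimplification.card_long_le (h : IsSimplification μ P S ρ) (hP : P.IsPacked c)
    (hμδ : μ ≤ δ) (i : ℕ) (B : Finset ℕ)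
    (hB : ∀ j ∈ B, ∃ y ∈ Icc (j : ℝ) (j + 1), Reach S T δ i y)
    (hlong : ∀ j ∈ B, 16 * δ < dist (T.vertex j) (T.vertex (j + 1))) (hc : 0 ≤ c) :
    (B.card : ℝ) ≤ 5 / 2 * c + 1 := by
  have hδ : 0 < δ := (dist_nonneg.trans_lt (h.near 0 P.size_pos)).trans_le hμδ
  rcases B.eq_empty_or_nonempty with rfl | hne
  · simp; linarith
  -- The last edge is set aside, since the chain need not pass its far end; it accounts for the
  -- summand `1`. All earlier edges are traversed completely by the chain that reaches it.
  set J := B.max' hne with hJ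
  have hJB : J ∈ B := B.max'_mem hne
  obtain ⟨yJ, hyJ, hrJ⟩ := hB J hJB
  obtain ⟨X, hXm, hX⟩ := h.exists_lift hrJ
  set z := S.vertex i with hz
  let H : ℕ → ℝ := fun j => P.lengthTo z (5 * δ) (X j)
  have hmem : ∀ v : ℝ, 0 ≤ v → v ≤ J → v ∈ Icc 0 yJ := fun v h1 h2 => ⟨h1, h2.trans hyJ.1⟩
  have hstep : ∀ j ∈ B.erase J, 2 * δ ≤ H (j + 1) - H j := by
    intro j hj
    obtain ⟨hjJ, hjB⟩ := Finset.mem_erase.mp hj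
    have hlt : j + 1 ≤ J := lt_of_le_of_ne (B.le_max' j hjB) hjJ
    have hlt' : (j : ℝ) + 1 ≤ J := by exact_mod_cast hlt
    obtain ⟨y, hy, hry⟩ := hB j hjB
    have hfree := hry.free
    rw [S.eval_natCast, ← hz] at hfree
    have hj0 : (0 : ℝ) ≤ j := by positivity
    have mj := hmem j hj0 (by linarith)
    have mj1 := hmem (j + 1) (by linarith) hlt'
    have my := hmem y (hj0.trans hy.1) (hy.2.trans hlt')
    -- The lifted point is within `μ + δ ≤ 2δ` of the point on `T`. So `P` is at distance at least
    -- `8δ - 2δ - δ = 5δ` from `z` at `v` and at most `3δ` at `y`; the clipped distance changes by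
    -- `2δ` in between.
    have key : ∀ v : ℝ, v ∈ Icc (j : ℝ) (j + 1) → 8 * δ ≤ dist (T.eval v) (T.eval y) →
        2 * δ ≤ H (j + 1) - H j := by
      intro v hv hd
      have mv := hmem v (hj0.trans hv.1) (hv.2.trans hlt')
      have h1 := (hX v mv).2
      have h2 := (hX y my).2
      have h3 : 5 * δ ≤ dist (P.eval (X v)) z := by
        have t1 := dist_triangle (T.eval v) (P.eval (X v)) (T.eval y)
        have t2 := dist_triangle (P.eval (X v)) z (T.eval y)
        rw [dist_comm (T.eval v) (P.eval (X v))] at t1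
        linarith
      have h4 : dist (P.eval (X y)) z ≤ 3 * δ := by
        have t1 := dist_triangle (P.eval (X y)) (T.eval y) z
        rw [dist_comm (T.eval y) z] at t1
        linarith
      have h5 : min (dist (P.eval (X y)) z) (5 * δ) ≤ 3 * δ := (min_le_left _ _).trans h4
      have h6 : min (dist (P.eval (X v)) z) (5 * δ) = 5 * δ := min_eq_right h3
      have hH : ∀ a b : ℝ, a ∈ Icc (j : ℝ) (j + 1) → b ∈ Icc (j : ℝ) (j + 1) → a ≤ b →
          |min (dist (P.eval (X b)) z) (5 * δ) - min (dist (P.eval (X a)) z) (5 * δ)| ≤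
            H (j + 1) - H j := by
        intro a b ha hb hab
        have ma := hmem a (hj0.trans ha.1) (ha.2.trans hlt')
        have mb := hmem b (hj0.trans hb.1) (hb.2.trans hlt')
        refine (P.abs_clipped_dist_eval_sub_le z (5 * δ) (hX a ma).1.1 (hXm ma mb hab)
          (hX b mb).1.2).trans ?_
        have e1 := P.monotone_lengthTo z (5 * δ) (hXm mj ma ha.1)
        have e2 := P.monotone_lengthTo z (5 * δ) (hXm mb mj1 hb.2)
        simp only [H, Nat.cast_add, Nat.cast_one]
        linarith
      rcases le_total v y with hvy | hvy
      · have := (abs_le.mp (hH v y hv hy hvy)).1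
        linarith
      · have := (abs_le.mp (hH y v hy hv hvy)).2
        linarith
    have hl := hlong j hjB
    rw [← T.eval_natCast j, ← T.eval_natCast (j + 1)] at hl
    push_cast at hl
    -- One end of an edge longer than `16δ` is at distance at least `8δ` from any given point.
    have htri := dist_triangle_right (T.eval j) (T.eval (j + 1)) (T.eval y)
    rcases le_or_gt (8 * δ) (dist (T.eval j) (T.eval y)) with h1 | h1
    · exact key j ⟨le_rfl, by linarith⟩ h1
    · exact key (j + 1) ⟨by linarith, le_rfl⟩ (by linarith)
  have hsum : ((B.erase J).card : ℝ) * (2 * δ) ≤ 5 * c * δ := by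
    rw [← nsmul_eq_mul]
    calc (B.erase J).card • (2 * δ) ≤ ∑ j ∈ B.erase J, (H (j + 1) - H j) :=
          Finset.card_nsmul_le_sum _ _ _ hstep
      _ ≤ ∑ j ∈ Finset.range J, (H (j + 1) - H j) := by
          refine Finset.sum_le_sum_of_subset_of_nonneg ?_ ?_
          · intro j hj
            obtain ⟨hjJ, hjB⟩ := Finset.mem_erase.mp hj
            exact Finset.mem_range.mpr (lt_of_le_of_ne (B.le_max' j hjB) hjJ)
          · intro j hj _
            have hj' : j + 1 ≤ J := Finset.mem_range.mp hj
            have hj'' : (j : ℝ) + 1 ≤ J := by exact_mod_cast hj'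
            have hj0 : (0 : ℝ) ≤ j := by positivity
            refine sub_nonneg.mpr (P.monotone_lengthTo z (5 * δ) (hXm (hmem _ hj0 (by linarith))
              (hmem _ (by positivity) (by push_cast; exact hj'')) (by push_cast; linarith)))
      _ = H J - H 0 := Finset.sum_range_sub H J
      _ ≤ P.lengthInBall z (5 * δ) := by
          have h1 := P.lengthTo_le z (5 * δ) (X J)
          have h2 := P.lengthTo_nonneg z (5 * δ) (X (0 : ℕ))
          simp only [H]
          linarith
      _ ≤ 5 * c * δ := by
          have := hP z (5 * δ) (by linarith)
          linarith
  have hcard : ((B.erase J).card : ℝ) + 1 = B.card := by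
    exact_mod_cast Finset.card_erase_add_one hJB
  have : ((B.erase J).card : ℝ) ≤ 5 / 2 * c := by
    refine le_of_mul_le_mul_right ?_ hδ
    linarith
  linarith

/-- Three kinds of cells. Entered from below (`A₁`): the edge of `S` passes within `δ` of a vertex
of `T`. Entered from the left with a short edge of `T` (`A₂`): the vertex of `S` is within `16δ + δ`
of that of `T`. These two are counted row by row with `card_near_le`. Entered from the left with a
long edge of `T` (`A₃`): counted column by column with `card_long_le`. -/
theorem IsSimplification.card_reachableCells_le (h : IsSimplification μ P S ρ) (hP : P.IsPacked c)
    (hc : 1 ≤ c) (hμδ : μ ≤ δ) {κ : ℝ} (hκ : δ ≤ κ * μ) (A : Finset (ℕ × ℕ))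
    (hA : ∀ p ∈ A, ReachableCell S T δ p) :
    (A.card : ℝ) ≤ 28 * κ * c * (S.edges + T.edges) := by
  classical
  have hμ : 0 < μ := dist_nonneg.trans_lt (h.near 0 P.size_pos)
  have hδ : 0 < δ := hμ.trans_le hμδ
  have hκ1 : 1 ≤ κ := by
    refine le_of_mul_le_mul_right ?_ hμ
    linarith
  set A₁ := A.filter fun p => ∃ x ∈ Icc (p.1 : ℝ) (p.1 + 1), Reach S T δ x p.2 with hA₁
  set A₂ := A.filter fun p => (∃ y ∈ Icc (p.2 : ℝ) (p.2 + 1), Reach S T δ p.1 y) ∧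
    dist (T.vertex p.2) (T.vertex (p.2 + 1)) ≤ 16 * δ with hA₂
  set A₃ := A.filter fun p => (∃ y ∈ Icc (p.2 : ℝ) (p.2 + 1), Reach S T δ p.1 y) ∧
    16 * δ < dist (T.vertex p.2) (T.vertex (p.2 + 1)) with hA₃
  have hcover : A ⊆ A₁ ∪ (A₂ ∪ A₃) := by
    intro p hp
    simp only [Finset.mem_union, hA₁, hA₂, hA₃, Finset.mem_filter]
    rcases (hA p hp).2.2 with h1 | h1
    · rcases le_or_gt (dist (T.vertex p.2) (T.vertex (p.2 + 1))) (16 * δ) with h2 | h2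
      · exact Or.inr (Or.inl ⟨hp, h1, h2⟩)
      · exact Or.inr (Or.inr ⟨hp, h1, h2⟩)
    · exact Or.inl ⟨hp, h1⟩
  have hrow : ∀ (B : Finset (ℕ × ℕ)) (r : ℝ), 0 ≤ r → B ⊆ A →
      (∀ p ∈ B, ∃ t ∈ Icc (0 : ℝ) 1, dist (AffineMap.lineMap (S.vertex p.1) (S.vertex (p.1 + 1)) t)
        (T.vertex p.2) ≤ r) → (B.card : ℝ) ≤ T.edges * (c * (r / μ + 5)) := by
    intro B r hr hBA hB
    refine card_le_of_fibers B Prod.snd T.edges _ (fun p hp => (hA p (hBA hp)).2.1) fun j _ => ?_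
    have hinj : InjOn Prod.fst (B.filter fun p => p.2 = j : Set (ℕ × ℕ)) := by
      intro p hp q hq hpq
      simp only [Finset.coe_filter, mem_ofPred_eq] at hp hq
      exact Prod.ext hpq (hp.2.trans hq.2.symm)
    rw [← Finset.card_image_of_injOn hinj]
    refine (h.card_near_le hP (z := T.vertex j) hr _ ?_ ?_).trans ?_
    · intro k hk
      obtain ⟨p, hp, rfl⟩ := Finset.mem_image.mp hk
      exact (hA p (hBA (Finset.mem_filter.mp hp).1)).1
    · intro k hk
      obtain ⟨p, hp, rfl⟩ := Finset.mem_image.mp hk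
      obtain ⟨hp1, rfl⟩ := Finset.mem_filter.mp hp
      exact hB p hp1
    · have : c * (r + 4 * μ) / μ = c * (r / μ + 4) := by field_simp
      rw [this]; linarith
  have h₁ := hrow A₁ δ hδ.le (Finset.filter_subset _ _) (by
    intro p hp
    obtain ⟨-, x, hx, hr⟩ := Finset.mem_filter.mp hp
    have := hr.free
    rw [S.eval_eq_lineMap p.1 hx.1 hx.2, T.eval_natCast] at this
    exact ⟨_, ⟨by linarith [hx.1], by linarith [hx.2]⟩, this⟩)
  have h₂ := hrow A₂ (17 * δ) (by linarith) (Finset.filter_subset _ _) (by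
    intro p hp
    obtain ⟨-, ⟨y, hy, hr⟩, hs⟩ := Finset.mem_filter.mp hp
    have hf := hr.free
    refine ⟨0, by simp, ?_⟩
    rw [AffineMap.lineMap_apply_zero]
    rw [S.eval_natCast] at hf
    have h1 : dist (T.eval y) (T.vertex p.2) ≤ 16 * δ := by
      rw [T.eval_eq_lineMap p.2 hy.1 hy.2, dist_lineMap_left, Real.norm_of_nonneg (by linarith [hy.1])]
      exact (mul_le_of_le_one_left dist_nonneg (by linarith [hy.2])).trans hs
    linarith [dist_triangle (S.vertex p.1) (T.eval y) (T.vertex p.2)])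
  have h₃ : (A₃.card : ℝ) ≤ S.edges * (5 / 2 * c + 1) := by
    refine card_le_of_fibers A₃ Prod.fst S.edges _
      (fun p hp => (hA p (Finset.mem_filter.mp hp).1).1) fun i _ => ?_
    have hinj : InjOn Prod.snd (A₃.filter fun p => p.1 = i : Set (ℕ × ℕ)) := by
      intro p hp q hq hpq
      simp only [Finset.coe_filter, mem_ofPred_eq] at hp hq
      exact Prod.ext (hp.2.trans hq.2.symm) hpq
    rw [← Finset.card_image_of_injOn hinj]
    refine h.card_long_le (T := T) hP hμδ i _ ?_ ?_ (by linarith)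
    · intro k hk
      obtain ⟨p, hp, rfl⟩ := Finset.mem_image.mp hk
      obtain ⟨hp1, rfl⟩ := Finset.mem_filter.mp hp
      exact (Finset.mem_filter.mp hp1).2.1
    · intro k hk
      obtain ⟨p, hp, rfl⟩ := Finset.mem_image.mp hk
      obtain ⟨hp1, rfl⟩ := Finset.mem_filter.mp hp
      exact (Finset.mem_filter.mp hp1).2.2
  have hcard : (A.card : ℝ) ≤ A₁.card + (A₂.card + A₃.card) := by
    have := (Finset.card_le_card hcover).trans ((Finset.card_union_le _ _).trans
      (Nat.add_le_add_left (Finset.card_union_le _ _) _))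
    exact_mod_cast this
  have hq : δ / μ ≤ κ := by rwa [div_le_iff₀ hμ]
  have hq' : 17 * δ / μ ≤ 17 * κ := by rw [mul_div_assoc]; linarith
  -- Since `κ ≥ 1`, the rows contribute `κ + 5 ≤ 6κ` and `17κ + 5 ≤ 22κ`, in total `28κ`.
  have b₁ : c * (δ / μ + 5) ≤ c * (6 * κ) := mul_le_mul_of_nonneg_left (by linarith) (by linarith)
  have b₂ : c * (17 * δ / μ + 5) ≤ c * (22 * κ) :=
    mul_le_mul_of_nonneg_left (by linarith) (by linarith)
  have b₃ : 5 / 2 * c + 1 ≤ c * (28 * κ) := by nlinarith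
  have hTe : (0 : ℝ) ≤ T.edges := by positivity
  have hSe : (0 : ℝ) ≤ S.edges := by positivity
  have d₁ := mul_le_mul_of_nonneg_left b₁ hTe
  have d₂ := mul_le_mul_of_nonneg_left b₂ hTe
  have d₃ := mul_le_mul_of_nonneg_left b₃ hSe
  nlinarith

theorem ReachableCell.swap {p : ℕ × ℕ} (h : ReachableCell S T δ p) : ReachableCell T S δ p.swap := by
  obtain ⟨h1, h2, h3⟩ := h
  refine ⟨h2, h1, ?_⟩
  rcases h3 with ⟨y, hy, hr⟩ | ⟨x, hx, hr⟩
  · exact Or.inr ⟨y, hy, hr.swap⟩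
  · exact Or.inl ⟨x, hx, hr.swap⟩

theorem card_reachableCells_le {P Q S T : Curve d} {ρ ρ' : ℕ → ℕ} (hS : IsSimplification μ P S ρ)
    (hT : IsSimplification μ Q T ρ') (hPQ : P.IsPacked c ∨ Q.IsPacked c) (hc : 1 ≤ c) (hμδ : μ ≤ δ)
    {κ : ℝ} (hκ : δ ≤ κ * μ) (A : Finset (ℕ × ℕ)) (hA : ∀ p ∈ A, ReachableCell S T δ p) :
    (A.card : ℝ) ≤ 28 * κ * c * (S.edges + T.edges) := by
  rcases hPQ with hP | hQ
  · exact hS.card_reachableCells_le hP hc hμδ hκ A hA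
  · have := hT.card_reachableCells_le hQ hc hμδ hκ (A.map (Equiv.prodComm ℕ ℕ).toEmbedding) (by
      intro p hp
      obtain ⟨q, hq, rfl⟩ := Finset.mem_map.mp hp
      exact (hA q hq).swap)
    rwa [Finset.card_map, add_comm (T.edges : ℝ)] at this

end

end Frechet

namespace Frechet

noncomputable section

open Set

variable {d : ℕ} {P Q : Curve d} {Δ ε c : ℝ}

/-! ### The fallible decider -/

theorem fallibleDecider_val (P Q : Curve d) (Δ ε c : ℝ) :
    (fallibleDecider P Q Δ ε c).val =
      (explore (simplify (ε / 4 * Δ) P).val (simplify (ε / 4 * Δ) Q).val ((1 + ε / 2) * Δ)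
        (⌊(1 + ε) * (1 + ε) * (27 * c + 96 * c / ε) * ((P.size + Q.size : ℕ) : ℝ)⌋₊ + 1)
        (startQueue (simplify (ε / 4 * Δ) P).val (simplify (ε / 4 * Δ) Q).val
          ((1 + ε / 2) * Δ)).val).val := by
  simp only [fallibleDecider, Timed.bind_val, op_val, countBeyond]

/-- Returning from the simplifications to `P` and `Q` costs `εΔ/4` for each curve on top of `(1 +
ε/2)Δ`. -/
theorem frechetDist_le_of_fallibleDecider_yes (hΔ : 0 < Δ) (hε : 0 < ε)
    (h : (fallibleDecider P Q Δ ε c).val = Answer.yes) : frechetDist P Q ≤ (1 + ε) * Δ := by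
  rw [fallibleDecider_val] at h
  obtain ⟨ρ, hS⟩ := exists_isSimplification (μ := ε / 4 * Δ) (by positivity) P
  obtain ⟨ρ', hT⟩ := exists_isSimplification (μ := ε / 4 * Δ) (by positivity) Q
  have hr := reach_corner_of_explore_yes (by positivity) queueOrdered_startQueue
    isSound_startQueue h
  have h1 := hr.matched.of_edges.pullback hS.reparam_monoOnto
    fun x hx => hS.dist_eval_reparam_le (fun l hl => (hS.near l hl).le) hx
  have h2 := h1.symm.pullback hT.reparam_monoOnto
    fun x hx => hT.dist_eval_reparam_le (fun l hl => (hT.near l hl).le) hx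
  refine (frechetDist_le_of_matched h2.symm).trans (le_of_eq ?_)
  ring

/-- Simplifying costs `μ₁` and `μ₂`, both strictly below `εΔ/4`. So a Fréchet distance of at most
`Δ` is strictly below `(1 + ε/2)Δ - μ₁ - μ₂`, as `matched_of_frechetDist_lt` demands. -/
theorem lt_frechetDist_of_fallibleDecider_no (hΔ : 0 < Δ) (hε : 0 < ε)
    (h : (fallibleDecider P Q Δ ε c).val = Answer.no) : Δ < frechetDist P Q := by
  rw [fallibleDecider_val] at h
  obtain ⟨ρ, hS⟩ := exists_isSimplification (μ := ε / 4 * Δ) (by positivity) P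
  obtain ⟨ρ', hT⟩ := exists_isSimplification (μ := ε / 4 * Δ) (by positivity) Q
  by_contra! hle
  obtain ⟨μ₁, hμ₁, hn₁⟩ := hS.exists_near_le
  obtain ⟨μ₂, hμ₂, hn₂⟩ := hT.exists_near_le
  have hm := matched_of_frechetDist_lt
    (show frechetDist P Q < (1 + ε / 2) * Δ - μ₁ - μ₂ by nlinarith)
  have h1 := hm.pushforward hS.reparam_monoOnto fun x hx => hS.dist_eval_reparam_le hn₁ hx
  have h2 := h1.symm.pushforward hT.reparam_monoOnto fun x hx => hT.dist_eval_reparam_le hn₂ hx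
  have h3 := h2.symm
  rw [show μ₂ + (μ₁ + ((1 + ε / 2) * Δ - μ₁ - μ₂)) = (1 + ε / 2) * Δ by ring] at h3
  exact not_reachesEnd_of_start_no (by positivity) h (reachesEnd_of_matched h3)

/-- With `κ = 6/ε` there are at most `28 * 6 * (c/ε) * N = 168 * (c/ε) * N` reachable cells, while
the budget exceeds `96 * (c'/ε) * N ≥ 192 * (c/ε) * N`. This is where `c' ≥ 2c` enters. -/
theorem fallibleDecider_ne_timeout {c' : ℝ} (hΔ : 0 < Δ) (hε : 0 < ε) (hε1 : ε ≤ 1) (hc : 1 ≤ c)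
    (hPQ : P.IsPacked c ∨ Q.IsPacked c) (hc' : 2 * c ≤ c') :
    (fallibleDecider P Q Δ ε c').val ≠ Answer.timeout := by
  intro h
  rw [fallibleDecider_val] at h
  obtain ⟨ρ, hS⟩ := exists_isSimplification (μ := ε / 4 * Δ) (by positivity) P
  obtain ⟨ρ', hT⟩ := exists_isSimplification (μ := ε / 4 * Δ) (by positivity) Q
  obtain ⟨A, hA, hA'⟩ := exists_reachableCells_of_explore_timeout (by positivity)
    queueOrdered_startQueue isSound_startQueue h
  have hκ : (1 + ε / 2) * Δ ≤ 6 / ε * (ε / 4 * Δ) := by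
    have : 6 / ε * (ε / 4 * Δ) = 3 / 2 * Δ := by field_simp; norm_num
    rw [this]
    nlinarith
  have hcard := card_reachableCells_le hS hT hPQ hc (by nlinarith) hκ A fun p hp => (hA' p hp).1
  have hedges : ((simplify (ε / 4 * Δ) P).val.edges : ℝ) + (simplify (ε / 4 * Δ) Q).val.edges ≤
      P.size + Q.size := by
    have h1 := (Curve.edges_le_size _).trans hS.size_le
    have h2 := (Curve.edges_le_size _).trans hT.size_le
    exact_mod_cast Nat.add_le_add h1 h2
  set N : ℝ := ((P.size + Q.size : ℕ) : ℝ) with hN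
  have hN0 : 0 < N := by
    have := P.size_pos
    rw [hN]; exact_mod_cast (by omega)
  have hN' : (P.size : ℝ) + Q.size = N := by rw [hN]; push_cast; ring
  rw [hN'] at hedges
  have hfl := Nat.lt_floor_add_one ((1 + ε) * (1 + ε) * (27 * c' + 96 * c' / ε) * N)
  have hA2 : (A.card : ℝ) = ⌊(1 + ε) * (1 + ε) * (27 * c' + 96 * c' / ε) * N⌋₊ + 1 := by
    rw [hA]; push_cast; ring
  rw [← hA2] at hfl
  have h1 : 28 * (6 / ε) * c * ((simplify (ε / 4 * Δ) P).val.edges +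
      (simplify (ε / 4 * Δ) Q).val.edges) ≤ 168 * (c / ε) * N := by
    have : 28 * (6 / ε) * c = 168 * (c / ε) := by ring
    rw [this]
    exact mul_le_mul_of_nonneg_left hedges (by positivity)
  have h2 : 192 * (c / ε) ≤ (1 + ε) * (1 + ε) * (27 * c' + 96 * c' / ε) := by
    have e1 : 192 * (c / ε) ≤ 96 * c' / ε := by
      rw [← mul_div_assoc]
      exact div_le_div_of_nonneg_right (by linarith) hε.le
    have e2 : 0 ≤ 27 * c' := by linarith
    have e3 : 0 ≤ 96 * c' / ε := by apply div_nonneg <;> linarith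
    have e4 : 1 ≤ (1 + ε) * (1 + ε) := by nlinarith
    have := mul_le_mul_of_nonneg_right e4 (add_nonneg e2 e3)
    linarith
  have h3 := mul_le_mul_of_nonneg_right h2 hN0.le
  have h4 : 0 < c / ε * N := by positivity
  nlinarith

/-- The unit in which running times are measured. -/
def workUnit (P Q : Curve d) (ε : ℝ) : ℝ := ((P.size : ℝ) + Q.size) / ε

theorem two_le_workUnit (P Q : Curve d) (hε : 0 < ε) (hε1 : ε ≤ 1) : 2 ≤ workUnit P Q ε := by
  have h1 : (1 : ℝ) ≤ P.size := by exact_mod_cast P.size_pos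
  have h2 : (1 : ℝ) ≤ Q.size := by exact_mod_cast Q.size_pos
  rw [workUnit, le_div_iff₀ hε]
  nlinarith

theorem fallibleDecider_steps_le_floor (P Q : Curve d) (Δ ε c : ℝ) :
    (fallibleDecider P Q Δ ε c).steps ≤ 4 * (P.size + Q.size) + 100 +
      72 * ⌊(1 + ε) * (1 + ε) * (27 * c + 96 * c / ε) * ((P.size + Q.size : ℕ) : ℝ)⌋₊ := by
  simp only [fallibleDecider, Timed.bind_steps, op_steps, op_val, startQueue_steps, countBeyond]
  have h1 := simplify_steps_le (ε / 4 * Δ) P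
  have h2 := simplify_steps_le (ε / 4 * Δ) Q
  generalize ⌊(1 + ε) * (1 + ε) * (27 * c + 96 * c / ε) * ((P.size + Q.size : ℕ) : ℝ)⌋₊ = F
  have h3 := explore_steps_le (S := (simplify (ε / 4 * Δ) P).val)
    (T := (simplify (ε / 4 * Δ) Q).val) (δ := (1 + ε / 2) * Δ) (F + 1)
    (startQueue (simplify (ε / 4 * Δ) P).val (simplify (ε / 4 * Δ) Q).val
      ((1 + ε / 2) * Δ)).val
  generalize (explore _ _ _ _ _).steps = E at h3 ⊢
  generalize (simplify (ε / 4 * Δ) P).steps = a at h1 ⊢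
  generalize (simplify (ε / 4 * Δ) Q).steps = b at h2 ⊢
  linarith

/-- The budget is at most `4 * 123 * M = 492 * M`, and each unit of it costs `70` steps of
exploration and `2` of counting; `36000` leaves room for the rest. -/
theorem fallibleDecider_steps_le (P Q : Curve d) (Δ : ℝ) (hε : 0 < ε) (hε1 : ε ≤ 1) (hc : 1 ≤ c) :
    ((fallibleDecider P Q Δ ε c).steps : ℝ) ≤ 36000 * (c * workUnit P Q ε) := by
  have hnat := fallibleDecider_steps_le_floor P Q Δ ε c
  generalize (fallibleDecider P Q Δ ε c).steps = st at hnat ⊢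
  have hcast : (st : ℝ) ≤ 4 * ((P.size : ℝ) + Q.size) + 100 +
      72 * ⌊(1 + ε) * (1 + ε) * (27 * c + 96 * c / ε) * ((P.size : ℝ) + Q.size)⌋₊ := by
    rw [Nat.cast_add P.size] at hnat
    exact_mod_cast hnat
  have hW := two_le_workUnit P Q hε hε1
  set M := c * workUnit P Q ε with hM
  have hWM : workUnit P Q ε ≤ M := by
    rw [hM]; exact le_mul_of_one_le_left (by linarith) hc
  have hs : (P.size : ℝ) + Q.size ≤ workUnit P Q ε := by
    rw [workUnit, le_div_iff₀ hε]
    have : (0 : ℝ) ≤ P.size + Q.size := by positivity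
    nlinarith
  have hK : (1 + ε) * (1 + ε) * (27 * c + 96 * c / ε) * ((P.size : ℝ) + Q.size) ≤ 492 * M := by
    have e1 : 27 * c + 96 * c / ε ≤ 123 * (c / ε) := by
      have : c ≤ c / ε := by rw [le_div_iff₀ hε]; nlinarith
      have : 96 * c / ε = 96 * (c / ε) := mul_div_assoc _ _ _
      linarith
    have e2 : (1 + ε) * (1 + ε) ≤ 4 := by nlinarith
    have e3 : 0 ≤ 123 * (c / ε) := by positivity
    have e4 : (1 + ε) * (1 + ε) * (27 * c + 96 * c / ε) ≤ 4 * (123 * (c / ε)) :=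
      mul_le_mul e2 e1 (by positivity) (by norm_num)
    have e5 : M = c / ε * ((P.size : ℝ) + Q.size) := by rw [hM, workUnit]; ring
    have := mul_le_mul_of_nonneg_right e4 (show (0 : ℝ) ≤ P.size + Q.size by positivity)
    rw [e5]
    linarith
  have hfl := Nat.floor_le (show 0 ≤ (1 + ε) * (1 + ε) * (27 * c + 96 * c / ε) *
    ((P.size : ℝ) + Q.size) by positivity)
  linarith

end

end Frechet

namespace Frechet

noncomputable section

open Set

variable {d : ℕ} {P Q : Curve d} {Δup ε c : ℝ}

/-! ### The search procedure -/

theorem Timed.ext_of {α : Type} {x y : Timed α} (h : x.val = y.val) (h' : x.steps = y.steps) :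
    x = y := by
  cases x; cases y; simp_all

/-- The list `r ^ 2 ^ (k - 1), …, r ^ 2 ^ 0`. -/
def powList (r : ℝ) : ℕ → List ℝ
  | 0 => []
  | k + 1 => r ^ 2 ^ k :: powList r k

theorem scan_of_yes {k : ℕ} {r : ℝ} {pows : List ℝ}
    (h : (fallibleDecider P Q (Δup / r) ε c).val = Answer.yes) :
    scan P Q Δup ε c (k + 1) r pows = ⟨(scan P Q Δup ε c k (r * r) (r :: pows)).val,
      (fallibleDecider P Q (Δup / r) ε c).steps + 4 +
        (scan P Q Δup ε c k (r * r) (r :: pows)).steps⟩ := by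
  rw [scan]
  refine Timed.ext_of ?_ ?_
  · simp [h]
  · simp [h]
    ring

theorem scan_of_ne_yes {k : ℕ} {r : ℝ} {pows : List ℝ}
    (h : (fallibleDecider P Q (Δup / r) ε c).val ≠ Answer.yes) :
    scan P Q Δup ε c (k + 1) r pows =
      ⟨some pows, (fallibleDecider P Q (Δup / r) ε c).steps + 3⟩ := by
  rw [scan]
  rcases ha : (fallibleDecider P Q (Δup / r) ε c).val with _ | _ | _
  · exact absurd ha h
  · refine Timed.ext_of ?_ ?_
    · simp [ha]
    · simp [ha]; ring
  · refine Timed.ext_of ?_ ?_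
    · simp [ha]
    · simp [ha]; ring

/-- Value and step count are the same for every sufficient `fuel`, as termination without a cut-off
requires. Here `i` is the current round and `m` the number of rounds before the last. -/
theorem exists_scan_eq {r D : ℝ} {b : ℕ}
    (hD : ∀ Δ, ((fallibleDecider P Q Δ ε c).steps : ℝ) ≤ D)
    (hyes : ∀ i < b, (fallibleDecider P Q (Δup / r ^ 2 ^ i) ε c).val = Answer.yes)
    (hb : (fallibleDecider P Q (Δup / r ^ 2 ^ b) ε c).val ≠ Answer.yes) (m i : ℕ) (hi : i + m = b) :
    ∃ st : ℕ, (∀ fuel, m + 1 ≤ fuel →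
      scan P Q Δup ε c fuel (r ^ 2 ^ i) (powList r i) = ⟨some (powList r b), st⟩) ∧
      (st : ℝ) ≤ (m + 1) * (D + 4) := by
  induction m generalizing i with
  | zero =>
    obtain rfl : i = b := by omega
    refine ⟨(fallibleDecider P Q (Δup / r ^ 2 ^ i) ε c).steps + 3, fun fuel hf => ?_, ?_⟩
    · obtain ⟨k, rfl⟩ : ∃ k, fuel = k + 1 := ⟨fuel - 1, by omega⟩
      exact scan_of_ne_yes hb
    · push_cast
      linarith [hD (Δup / r ^ 2 ^ i)]
  | succ m ih =>
    obtain ⟨st, h1, h2⟩ := ih (i + 1) (by omega)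
    refine ⟨(fallibleDecider P Q (Δup / r ^ 2 ^ i) ε c).steps + 4 + st, fun fuel hf => ?_, ?_⟩
    · obtain ⟨k, rfl⟩ : ∃ k, fuel = k + 1 := ⟨fuel - 1, by omega⟩
      have hr : r ^ 2 ^ i * r ^ 2 ^ i = r ^ 2 ^ (i + 1) := by
        rw [← pow_add]; congr 1; ring
      rw [scan_of_yes (hyes i (by omega)), hr]
      have := h1 k (by omega)
      rw [powList] at this
      rw [this]
    · push_cast
      linarith [hD (Δup / r ^ 2 ^ i)]

/-- The invariant is "yes" at the lower index and not "yes" at the upper one. The answers need not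
be monotone in `Δ`; some change of answer is found in any case. -/
theorem binarySearch_spec {r D : ℝ} (hr : 0 < r)
    (hD : ∀ Δ, ((fallibleDecider P Q Δ ε c).steps : ℝ) ≤ D) (k : ℕ) {Δlo : ℝ} (hlo : 0 < Δlo)
    (hyes : (fallibleDecider P Q Δlo ε c).val = Answer.yes)
    (hno : (fallibleDecider P Q (Δlo / r ^ 2 ^ k) ε c).val ≠ Answer.yes) :
    0 < (binarySearch P Q ε c Δlo (powList r k)).val ∧
    (fallibleDecider P Q (binarySearch P Q ε c Δlo (powList r k)).val ε c).val = Answer.yes ∧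
    (fallibleDecider P Q ((binarySearch P Q ε c Δlo (powList r k)).val / r) ε c).val ≠ Answer.yes ∧
    ((binarySearch P Q ε c Δlo (powList r k)).steps : ℝ) ≤ k * (D + 2) + 1 := by
  induction k generalizing Δlo with
  | zero =>
    simp only [powList, binarySearch, op_val, op_steps]
    refine ⟨hlo, hyes, by simpa using hno, by simp⟩
  | succ k ih =>
    have hDk := hD (Δlo / r ^ 2 ^ k)
    by_cases ha : (fallibleDecider P Q (Δlo / r ^ 2 ^ k) ε c).val = Answer.yes
    · have hval : (binarySearch P Q ε c Δlo (powList r (k + 1))).val =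
          (binarySearch P Q ε c (Δlo / r ^ 2 ^ k) (powList r k)).val := by
        simp [powList, binarySearch, ha]
      have hst : (binarySearch P Q ε c Δlo (powList r (k + 1))).steps =
          (fallibleDecider P Q (Δlo / r ^ 2 ^ k) ε c).steps + 2 +
          (binarySearch P Q ε c (Δlo / r ^ 2 ^ k) (powList r k)).steps := by
        simp [powList, binarySearch, ha]; ring
      have := ih (Δlo := Δlo / r ^ 2 ^ k) (by positivity) ha (by
        rwa [div_div, ← pow_add, show 2 ^ k + 2 ^ k = 2 ^ (k + 1) by ring])
      rw [hval, hst]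
      refine ⟨this.1, this.2.1, this.2.2.1, ?_⟩
      push_cast
      linarith [this.2.2.2]
    · have hval : (binarySearch P Q ε c Δlo (powList r (k + 1))).val =
          (binarySearch P Q ε c Δlo (powList r k)).val := by
        rcases ha' : (fallibleDecider P Q (Δlo / r ^ 2 ^ k) ε c).val with _ | _ | _
        · exact absurd ha' ha
        all_goals simp [powList, binarySearch, ha']
      have hst : (binarySearch P Q ε c Δlo (powList r (k + 1))).steps =
          (fallibleDecider P Q (Δlo / r ^ 2 ^ k) ε c).steps + 2 +
          (binarySearch P Q ε c Δlo (powList r k)).steps := by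
        rcases ha' : (fallibleDecider P Q (Δlo / r ^ 2 ^ k) ε c).val with _ | _ | _
        · exact absurd ha' ha
        all_goals simp [powList, binarySearch, ha']; ring
      have := ih hlo hyes ha
      rw [hval, hst]
      refine ⟨this.1, this.2.1, this.2.2.1, ?_⟩
      push_cast
      linarith [this.2.2.2]

/-- The logarithmic factor of the running time. -/
def logFactor (P Q : Curve d) (Δup ε : ℝ) : ℝ :=
  1 + Real.log (1 + 1 / ε * Real.log (Δup / frechetDist P Q))

theorem one_le_logFactor (hpos : 0 < frechetDist P Q) (hup : frechetDist P Q ≤ Δup) (hε : 0 < ε) :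
    1 ≤ logFactor P Q Δup ε := by
  have h1 : 0 ≤ Real.log (Δup / frechetDist P Q) := Real.log_nonneg (by rwa [one_le_div hpos])
  have h2 : 0 ≤ 1 / ε * Real.log (Δup / frechetDist P Q) := by positivity
  have := Real.log_nonneg (show 1 ≤ 1 + 1 / ε * Real.log (Δup / frechetDist P Q) by linarith)
  unfold logFactor
  linarith

/-- The last "yes" alone gives `(1 + ε)^(2^(b-1)) ≤ (1 + ε) Δ⁺ / d_F`. Taking logarithms twice, with
`log (1 + ε) ≥ ε/2`, bounds `b`, and so also shows that the scan stops. -/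
theorem rounds_le_of_yes (hpos : 0 < frechetDist P Q) (hup : frechetDist P Q ≤ Δup) (hε : 0 < ε)
    (hε1 : ε ≤ 1) {b : ℕ}
    (hyes : ∀ i < b, (fallibleDecider P Q (Δup / (1 + ε) ^ 2 ^ i) ε c).val = Answer.yes) :
    (b : ℝ) ≤ 2 * logFactor P Q Δup ε := by
  have hΔ : 0 < Δup := hpos.trans_le hup
  have hL1 := one_le_logFactor hpos hup hε
  rcases b with _ | b
  · simp; linarith
  have h1 := frechetDist_le_of_fallibleDecider_yes (by positivity) hε (hyes b (by omega))
  set L := Real.log (Δup / frechetDist P Q) with hL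
  have hL0 : 0 ≤ L := Real.log_nonneg (by rwa [one_le_div hpos])
  have hlog : ε / 2 ≤ Real.log (1 + ε) := by
    have := Real.one_sub_inv_le_log_of_pos (show 0 < 1 + ε by linarith)
    have h2 : ε / 2 ≤ 1 - (1 + ε)⁻¹ := by
      rw [show 1 - (1 + ε)⁻¹ = ε / (1 + ε) by field_simp; ring]
      exact div_le_div_of_nonneg_left hε.le (by linarith) (by linarith)
    linarith
  have h2 : (1 + ε) ^ 2 ^ b ≤ (1 + ε) * (Δup / frechetDist P Q) := by
    rw [← mul_div_assoc, le_div_iff₀ hpos]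
    rw [← mul_div_assoc, le_div_iff₀ (by positivity)] at h1
    linarith
  have h3 : (2 : ℝ) ^ b * Real.log (1 + ε) ≤ Real.log (1 + ε) + L := by
    have := Real.log_le_log (by positivity) h2
    rw [Real.log_pow, Real.log_mul (by positivity) (by positivity)] at this
    push_cast at this
    exact this
  have h4 : (2 : ℝ) ^ b ≤ 2 * (1 + 1 / ε * L) := by
    have e0 : (1 : ℝ) ≤ 2 ^ b := one_le_pow₀ (by norm_num)
    have e1 : ((2 : ℝ) ^ b - 1) * (ε / 2) ≤ L :=
      (mul_le_mul_of_nonneg_left hlog (by linarith)).trans (by linarith)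
    have e2 : (2 : ℝ) ^ b - 1 ≤ 2 * (1 / ε * L) := by
      rw [show 2 * (1 / ε * L) = L / (ε / 2) by field_simp, le_div_iff₀ (by positivity)]
      exact e1
    linarith
  have h5 : ((b : ℝ) + 1) * Real.log 2 ≤ 2 * Real.log 2 + Real.log (1 + 1 / ε * L) := by
    have e0 : 0 < 1 + 1 / ε * L := by positivity
    have e1 : (2 : ℝ) ^ (b + 1) ≤ 2 ^ 2 * (1 + 1 / ε * L) := by
      rw [pow_succ]; linarith
    have := Real.log_le_log (by positivity) e1
    rw [Real.log_pow, Real.log_mul (by positivity) e0.ne', Real.log_pow] at this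
    push_cast at this
    exact this
  have h6 : 0 ≤ Real.log (1 + 1 / ε * L) := by
    unfold logFactor at hL1
    linarith
  -- Only `log 2 > 1/2` matters: it produces the factor `2` in front of `logFactor`.
  have h7 := Real.log_two_gt_d9
  push_cast
  unfold logFactor
  rw [← hL]
  by_contra! hlt
  nlinarith

end

end Frechet

/-! ### One round of the search, and the doubling of the packedness estimate. -/

namespace Frechet

noncomputable section

open Set

variable {d : ℕ} {P Q : Curve d} {Δup ε c : ℝ}

/-- What a round of the search with the estimate `c'` achieves. -/
theorem exists_refineRound_eq (hpos : 0 < frechetDist P Q) (hup : frechetDist P Q ≤ Δup)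
    (hε : 0 < ε) (hε1 : ε ≤ 1) (hc : 1 ≤ c) (hPQ : P.IsPacked c ∨ Q.IsPacked c) {c' : ℝ}
    (hc' : 1 ≤ c') :
    ∃ (res : Option ℝ) (st : ℕ),
      (∀ fuel : ℕ, 2 * logFactor P Q Δup ε + 1 ≤ fuel →
        refineRound fuel P Q Δup ε c' = ⟨some res, st⟩) ∧
      (st : ℝ) ≤ 288000 * (workUnit P Q ε * logFactor P Q Δup ε) * c' ∧
      (∀ Δ, res = some Δ → frechetDist P Q ≤ Δ ∧ Δ < (1 + ε) ^ 2 * frechetDist P Q) ∧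
      (2 * c ≤ c' → res ≠ none) := by
  classical
  have hΔ : 0 < Δup := hpos.trans_le hup
  have hL := one_le_logFactor hpos hup hε
  have hW := two_le_workUnit P Q hε hε1
  set Lg := logFactor P Q Δup ε with hLg
  set D := 36000 * (c' * workUnit P Q ε) with hDdef
  have hD : ∀ Δ, ((fallibleDecider P Q Δ ε c').steps : ℝ) ≤ D := fun Δ =>
    fallibleDecider_steps_le P Q Δ hε hε1 hc'
  have hD0 : 25 ≤ D := by rw [hDdef]; nlinarith
  -- A round makes at most `2b + 3 ≤ 7 * Lg` probes of cost `D`; the eighth `D * Lg` covers the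
  -- remaining steps, because `D ≥ 25`.
  have hbound : 8 * (D * Lg) = 288000 * (workUnit P Q ε * Lg) * c' := by rw [hDdef]; ring
  rw [← hbound]
  have hDL : D ≤ D * Lg := le_mul_of_one_le_right (by linarith) hL
  by_cases hup_yes : (fallibleDecider P Q Δup ε c').val = Answer.yes
  swap
  · refine ⟨none, (fallibleDecider P Q Δup ε c').steps + 2, fun fuel _ => ?_, ?_, by simp, ?_⟩
    · rcases ha : (fallibleDecider P Q Δup ε c').val with _ | _ | _
      · exact absurd ha hup_yes
      all_goals
        refine Timed.ext_of ?_ ?_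
        · simp [refineRound, ha]
        · simp [refineRound, ha]
    · push_cast
      linarith [hD Δup]
    · intro h2c
      rcases ha : (fallibleDecider P Q Δup ε c').val with _ | _ | _
      · exact absurd ha hup_yes
      · exact absurd (lt_frechetDist_of_fallibleDecider_no hΔ hε ha) (not_lt.mpr hup)
      · exact absurd ha (fallibleDecider_ne_timeout hΔ hε hε1 hc hPQ h2c)
  have hex : ∃ b, (fallibleDecider P Q (Δup / (1 + ε) ^ 2 ^ b) ε c').val ≠ Answer.yes := by
    by_contra! hall
    obtain ⟨n, hn⟩ := exists_nat_gt (2 * Lg)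
    exact absurd (rounds_le_of_yes hpos hup hε hε1 (b := n) fun i _ => hall i) (not_le.mpr hn)
  set b := Nat.find hex with hb
  have hb_no := Nat.find_spec hex
  rw [← hb] at hb_no
  have hb_yes : ∀ i < b, (fallibleDecider P Q (Δup / (1 + ε) ^ 2 ^ i) ε c').val = Answer.yes :=
    fun i hi => not_not.mp (Nat.find_min hex hi)
  have hbL := rounds_le_of_yes hpos hup hε hε1 hb_yes
  rw [← hLg] at hbL
  obtain ⟨st, hscan, hst⟩ := exists_scan_eq hD hb_yes hb_no b 0 (by simp)
  simp only [pow_zero, pow_one, powList] at hscan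
  obtain ⟨hv0, hv1, hv2, hv3⟩ := binarySearch_spec (by positivity) hD b hΔ hup_yes hb_no
  set bs := binarySearch P Q ε c' Δup (powList (1 + ε) b) with hbs
  have hbD : (b : ℝ) * D ≤ 2 * (D * Lg) := by
    have := mul_le_mul_of_nonneg_right hbL (show 0 ≤ D by linarith)
    linarith
  have hDL' : 25 * Lg ≤ D * Lg := mul_le_mul_of_nonneg_right hD0 (by linarith)
  have hfuel : ∀ fuel : ℕ, 2 * Lg + 1 ≤ fuel → scan P Q Δup ε c' fuel (1 + ε) [] =
      ⟨some (powList (1 + ε) b), st⟩ := fun fuel hf => hscan fuel (by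
    have : (b : ℝ) + 1 ≤ fuel := by linarith
    exact_mod_cast this)
  have d1 := hD Δup
  have d2 := hD (bs.val / (1 + ε))
  by_cases hno : (fallibleDecider P Q (bs.val / (1 + ε)) ε c').val = Answer.no
  · refine ⟨some ((1 + ε) * bs.val), (fallibleDecider P Q Δup ε c').steps + 2 + st + bs.steps + 1 +
      (fallibleDecider P Q (bs.val / (1 + ε)) ε c').steps + 3, fun fuel hf => ?_, ?_, ?_, by simp⟩
    · refine Timed.ext_of ?_ ?_
      · simp [refineRound, hup_yes, hfuel fuel hf, ← hbs, hno]
      · simp [refineRound, hup_yes, hfuel fuel hf, ← hbs, hno]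
        ring
    · push_cast
      linarith
    · intro Δ hres
      obtain rfl : (1 + ε) * bs.val = Δ := by simpa using hres
      refine ⟨frechetDist_le_of_fallibleDecider_yes hv0 hε hv1, ?_⟩
      have := lt_frechetDist_of_fallibleDecider_no (by positivity) hε hno
      rw [div_lt_iff₀ (by positivity)] at this
      nlinarith
  · refine ⟨none, (fallibleDecider P Q Δup ε c').steps + 2 + st + bs.steps + 1 +
      (fallibleDecider P Q (bs.val / (1 + ε)) ε c').steps + 2, fun fuel hf => ?_, ?_, by simp, ?_⟩
    · rcases ha : (fallibleDecider P Q (bs.val / (1 + ε)) ε c').val with _ | _ | _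
      · exact absurd ha hv2
      · exact absurd ha hno
      · refine Timed.ext_of ?_ ?_
        · simp [refineRound, hup_yes, hfuel fuel hf, ← hbs, ha]
        · simp [refineRound, hup_yes, hfuel fuel hf, ← hbs, ha]
          ring
    · push_cast
      linarith
    · intro h2c
      rcases ha : (fallibleDecider P Q (bs.val / (1 + ε)) ε c').val with _ | _ | _
      · exact absurd ha hv2
      · exact absurd ha hno
      · exact absurd ha (fallibleDecider_ne_timeout (by positivity) hε hε1 hc hPQ h2c)

/-- At most `m` doublings lift the estimate to `2c`, where a round must succeed. The costs sum to a
multiple of `c' * (1 + 2 + ⋯ + 2^m)`; the one extra step per round is absorbed by `1 ≤ c'`. An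
earlier success only shortens the run. -/
theorem exists_refineLoop_eq (hpos : 0 < frechetDist P Q) (hup : frechetDist P Q ≤ Δup)
    (hε : 0 < ε) (hε1 : ε ≤ 1) (hc : 1 ≤ c) (hPQ : P.IsPacked c ∨ Q.IsPacked c) (m : ℕ) {c' : ℝ}
    (hc' : 1 ≤ c') (hm : 2 * c ≤ c' * 2 ^ m) :
    ∃ (Δ : ℝ) (time : ℕ),
      (∀ fuel : ℕ, 2 * logFactor P Q Δup ε + 1 ≤ fuel → ∀ k, m + 1 ≤ k →
        refineLoop fuel P Q Δup ε k c' = ⟨some Δ, time⟩) ∧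
      frechetDist P Q ≤ Δ ∧ Δ < (1 + ε) ^ 2 * frechetDist P Q ∧
      (time : ℝ) ≤ (288000 * (workUnit P Q ε * logFactor P Q Δup ε) + 1) *
        (c' * (2 ^ (m + 1) - 1)) := by
  have hW := two_le_workUnit P Q hε hε1
  have hL := one_le_logFactor hpos hup hε
  set G := 288000 * (workUnit P Q ε * logFactor P Q Δup ε) with hG
  have hG0 : 0 ≤ G := by rw [hG]; positivity
  induction m generalizing c' with
  | zero =>
    obtain ⟨res, st, h1, h2, h3, h4⟩ := exists_refineRound_eq hpos hup hε hε1 hc hPQ hc'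
    obtain ⟨Δ, rfl⟩ := Option.ne_none_iff_exists'.mp (h4 (by simpa using hm))
    refine ⟨Δ, st + 1, fun fuel hf k hk => ?_, (h3 Δ rfl).1, (h3 Δ rfl).2, ?_⟩
    · obtain ⟨k, rfl⟩ : ∃ j, k = j + 1 := ⟨k - 1, by omega⟩
      refine Timed.ext_of ?_ ?_ <;> simp [refineLoop, h1 fuel hf]
    · push_cast
      linarith
  | succ m ih =>
    obtain ⟨res, st, h1, h2, h3, -⟩ := exists_refineRound_eq hpos hup hε hε1 hc hPQ hc'
    have h2m : (1 : ℝ) ≤ 2 ^ (m + 1) := one_le_pow₀ (by norm_num)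
    have hcm : c' ≤ c' * 2 ^ (m + 1) := le_mul_of_one_le_right (by linarith) h2m
    rcases res with _ | Δ
    · obtain ⟨Δ, time, i1, i2, i3, i4⟩ := ih (c' := 2 * c') (by linarith)
        (by rw [pow_succ] at hm; linarith)
      refine ⟨Δ, st + 1 + time, fun fuel hf k hk => ?_, i2, i3, ?_⟩
      · obtain ⟨k, rfl⟩ : ∃ j, k = j + 1 := ⟨k - 1, by omega⟩
        have := i1 fuel hf k (by omega)
        refine Timed.ext_of ?_ ?_
        · simp [refineLoop, h1 fuel hf, this]
        · simp [refineLoop, h1 fuel hf, this]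
          ring
      · push_cast
        have e : (G + 1) * (c' * (2 ^ (m + 1 + 1) - 1)) =
            (G + 1) * (2 * c' * (2 ^ (m + 1) - 1)) + (G * c' + c') := by ring
        rw [e]
        linarith
    · refine ⟨Δ, st + 1, fun fuel hf k hk => ?_, (h3 Δ rfl).1, (h3 Δ rfl).2, ?_⟩
      · obtain ⟨k, rfl⟩ : ∃ j, k = j + 1 := ⟨k - 1, by omega⟩
        refine Timed.ext_of ?_ ?_ <;> simp [refineLoop, h1 fuel hf]
      · push_cast
        have e : (G + 1) * c' ≤ (G + 1) * (c' * (2 ^ (m + 1 + 1) - 1)) := by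
          refine mul_le_mul_of_nonneg_left ?_ (by linarith)
          rw [pow_succ]; linarith
        linarith

end

end Frechet

/-! ### Conclusion. -/

theorem mainTheorem4 :
    ∃ C : ℝ, 0 < C ∧
      ∀ (d : ℕ) (P Q : Frechet.Curve d) (c Δup ε : ℝ),
        1 ≤ c →
        (P.IsPacked c ∨ Q.IsPacked c) →
        0 < Frechet.frechetDist P Q →
        Frechet.frechetDist P Q ≤ Δup →
        0 < ε → ε ≤ 1 →
        ∃ (Δ : ℝ) (time : ℕ),
          Frechet.RefineUpperBoundReturns P Q Δup ε Δ time ∧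
          Frechet.frechetDist P Q ≤ Δ ∧
          Δ < (1 + ε) ^ 2 * Frechet.frechetDist P Q ∧
          (time : ℝ) ≤ C * (c * ((P.size + Q.size : ℝ) / ε) *
            (1 + Real.log (1 + 1 / ε * Real.log (Δup / Frechet.frechetDist P Q)))) := by
  -- `4608000 = 2 * 8 * 288000`: the factor `8` comes from the sum of all estimates, at most `8c`,
  -- and the factor `2` absorbs the step per round.
  refine ⟨4608000, by norm_num, ?_⟩
  intro d P Q c Δup ε hc hPQ hpos hup hε hε1
  have hW := Frechet.two_le_workUnit P Q hε hε1
  have hL := Frechet.one_le_logFactor hpos hup hε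
  -- With `2^n ≤ 2c < 2^(n+1)`, `n + 1` doublings suffice.
  obtain ⟨n, hn1, hn2⟩ := exists_nat_pow_near (show 1 ≤ 2 * c by linarith) (one_lt_two (α := ℝ))
  obtain ⟨Δ, time, h1, h2, h3, h4⟩ := Frechet.exists_refineLoop_eq hpos hup hε hε1 hc hPQ (n + 1)
    le_rfl (by rw [one_mul]; exact hn2.le)
  refine ⟨Δ, time, ?_, h2, h3, ?_⟩
  · obtain ⟨N, hN⟩ := exists_nat_ge (2 * Frechet.logFactor P Q Δup ε + 1)
    refine ⟨max N (n + 2), fun fuel hf => h1 fuel ?_ fuel (le_trans (le_max_right _ _) hf)⟩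
    have : (N : ℝ) ≤ fuel := by exact_mod_cast (le_max_left _ _).trans hf
    linarith
  · change (time : ℝ) ≤ 4608000 * (c * Frechet.workUnit P Q ε * Frechet.logFactor P Q Δup ε)
    have hX : 1 ≤ Frechet.workUnit P Q ε * Frechet.logFactor P Q Δup ε := by nlinarith
    set X := Frechet.workUnit P Q ε * Frechet.logFactor P Q Δup ε with hXdef
    have h5 : (1 : ℝ) * (2 ^ (n + 1 + 1) - 1) ≤ 8 * c := by
      rw [pow_succ, pow_succ]; linarith
    have h6 := mul_le_mul_of_nonneg_left h5 (show 0 ≤ 288000 * X + 1 by linarith)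
    rw [mul_assoc, ← hXdef]
    nlinarith
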